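/- Let $\overline{\mathbb Q}$ be the field of algebraic numbers, let $K_0=\mathbb Q(i,\sqrt2,\sqrt5,\sqrt{-2+2\sqrt2})\subset\overline{\mathbb Q}$ and $G_{K_0}=\mathrm{Gal}(\overline{\mathbb Q}/K_0)$. Let $a,b,c\in\mathbb Z$ satisfy $$abc(5a+5b+c)(20a+5b+2c)(4a^2+b^2)(c^2-100ab)(c^2+5bc+10ac+25ab)\neq 0 .$$ Let $B\subset\mathbb P^4$, with coordinates $(v_0:v_1:v_2:w_0:w_1)$, be the (smooth) curve $$v_0v_1+5v_2^2=w_0^2,\qquad (v_0+v_1)(v_0+2v_1)=w_0^2-5w_1^2,\qquad av_0^2+bv_1^2+cv_2^2=0,$$ let $\sigma$ be its fixed-point-free involution $(v_0:v_1:v_2:w_0:w_1)\mapsto(-v_0:-v_1:-v_2:w_0:w_1)$, let $\widetilde B=B/\sigma$, and let $f\colon B\to\widetilde B$ be the (étale) quotient map. Consider $f^*\colon \mathrm{Jac}(\widetilde B_{\overline{\mathbb Q}})[2]\to\mathrm{Jac}(B_{\overline{\mathbb Q}})[2]$, where $\mathrm{Jac}=\mathrm{Pic}^0$ is the group of classes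 of degree-$0$ divisors modulo principal divisors. **(1)** The set $f(V(w_0))$ consists of four points $P_1,\dots,P_4$ of $\widetilde B(\overline{\mathbb Q})$, and $f(V(w_1))$ of four points $Q_1,\dots,Q_4$. The kernel of $f^*$ is isomorphic to $\mathbb Z/2\mathbb Z$, and its unique nontrivial element is $\{P_1,P_2,P_3,P_4\}$, that is, the class of the divisor $P_1+P_2+P_3+P_4-4W$ for any $W\in\{P_1,\dots,P_4,Q_1,\dots,Q_4\}$ (these eight points are the Weierstrass points of the hyperelliptic curve $\widetilde B_{\overline{\mathbb Q}}$, and the class does not depend on $W$). **(2)** Put $\theta_0=\sqrt{4a^2+b^2}$ and suppose that none of $ab$, $4a^2+b^2$, $c^2-100ab$ is a square in $K_0$. Then the image of $f^*$ fits in a *non-split* exact sequence of $G_{K_0}$-modules $$0\to \mathrm{Ind}^{K_0}_{K_0(\theta_0)}(\mathbb Z/2\mathbb Z)\times \mathrm{Ind}^{K_0}_{K_0(\sqrt{ab})}(\mathbb Z/2\mathbb Z)\to \mathrm{im} f^*\to\mathbb Z/2\mathbb Z\to 0 ,$$ where $\mathrm{Ind}^{K_0}_{L}(\mathbb Z/2\mathbb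 Z)$ denotes the $G_{K_0}$-module induced from the trivial $G_L$-module $\mathbb Z/2\mathbb Z$. -/

import Mathlib

open scoped LinearAlgebra.Projectivization

noncomputable section

namespace EnriquesBranch

/-! ### The ground fields -/

/-- The field `ℚ̄` of algebraic numbers. -/
abbrev Qbar : Type := AlgebraicClosure ℚ

/-- `K₀ = ℚ(i, √2, √5, √(-2 + 2√2))`.  Adjoining all roots of `x² + 1`, `x² - 2`, `x² - 5` and
`(x² + 2)² - 8` gives this field, because
`√(-2 - 2√2) = 2i / √(-2 + 2√2)`; so no choice of square roots has to be made. -/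
def K0 : IntermediateField ℚ Qbar :=
  IntermediateField.adjoin ℚ {x | x ^ 2 = -1 ∨ x ^ 2 = 2 ∨ x ^ 2 = 5 ∨ (x ^ 2 + 2) ^ 2 = 8}

/-- The absolute Galois group `G_{K₀} = Gal(ℚ̄ / K₀)`. -/
abbrev GK0 : Type := Qbar ≃ₐ[K0] Qbar

/-- The subgroup `G_{K₀(√d)}` of `G_{K₀}`, for an integer `d`. -/
def galSqrt (d : ℤ) : Subgroup GK0 :=
  (IntermediateField.adjoin K0 {x : Qbar | x ^ 2 = (d : Qbar)}).fixingSubgroup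

/-- The module underlying the induced module `Ind^{K₀}_{K₀(√d)}(ℤ/2ℤ)`. -/
abbrev IndV (d : ℤ) : Type :=
  Representation.IndV (galSqrt d).subtype
    (Representation.trivial (ZMod 2) (galSqrt d) (ZMod 2))

/-- The `G_{K₀}`-module `Ind^{K₀}_{K₀(√d)}(ℤ/2ℤ)`, as a representation of `G_{K₀}` over `ℤ/2ℤ`. -/
def indRep (d : ℤ) : Representation (ZMod 2) GK0 (IndV d) :=
  Representation.ind (galSqrt d).subtype
    (Representation.trivial (ZMod 2) (galSqrt d) (ZMod 2))

/-! ### The curve `B` -/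

/-- A triple `𝐚 = (a, b, c)` of integers for which the surface `Y_𝐚` is smooth. -/
structure Triple where
  a : ℤ
  b : ℤ
  c : ℤ
  nonsing : a * b * c * (5 * a + 5 * b + c) * (20 * a + 5 * b + 2 * c) * (4 * a ^ 2 + b ^ 2) *
    (c ^ 2 - 100 * a * b) * (c ^ 2 + 5 * b * c + 10 * a * c + 25 * a * b) ≠ 0

/-- The homogeneous coordinate ring `ℚ̄[v₀, v₁, v₂, w₀, w₁]` of `ℙ⁴`;
the variables `0, 1, 2, 3, 4` are `v₀, v₁, v₂, w₀, w₁`. -/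
abbrev Poly : Type := MvPolynomial (Fin 5) Qbar

open MvPolynomial

/-- The quadric `v₀v₁ + 5v₂² - w₀²`. -/
def q1 : Poly := X 0 * X 1 + 5 * X 2 ^ 2 - X 3 ^ 2

/-- The quadric `(v₀ + v₁)(v₀ + 2v₁) - w₀² + 5w₁²`. -/
def q2 : Poly := (X 0 + X 1) * (X 0 + 2 * X 1) - X 3 ^ 2 + 5 * X 4 ^ 2

/-- The quadric `av₀² + bv₁² + cv₂²`. -/
def q3 (t : Triple) : Poly :=
  C (t.a : Qbar) * X 0 ^ 2 + C (t.b : Qbar) * X 1 ^ 2 + C (t.c : Qbar) * X 2 ^ 2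

/-- The homogeneous ideal of the curve `B ⊂ ℙ⁴`, the branch locus of `Y_𝐚 → S`. -/
def idealB (t : Triple) : Ideal Poly := Ideal.span {q1, q2, q3 t}

/-- The (closed) points of `ℙ⁴` over `ℚ̄`. -/
abbrev P4 : Type := ℙ Qbar (Fin 5 → Qbar)

/-- A polynomial vanishes at a point of `ℙ⁴`, i.e. on the line that the point represents. -/
def Vanishes (F : Poly) (P : P4) : Prop :=
  ∀ x : Fin 5 → Qbar, x ∈ P.submodule → eval x F = 0

/-- The (closed) points of the curve `B` over `ℚ̄`. -/
def PtB (t : Triple) : Type := {P : P4 // Vanishes q1 P ∧ Vanishes q2 P ∧ Vanishes (q3 t) P}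

/-- The homogeneous prime ideal of a point of `ℙ⁴`. -/
def idealPt (P : P4) : Ideal Poly := Ideal.span {F | Vanishes F P}

/-- The germ at `P` of the form `F`, restricted to `B`, lies in the `n`-th power of the maximal
ideal of the local ring of `B` at `P`: after multiplication by a form not vanishing at `P`,
it lies in `𝔭ⁿ + I(B)`. -/
def VanishesToOrder (t : Triple) (P : PtB t) (n : ℕ) (F : Poly) : Prop :=
  ∃ (e : ℕ) (H : Poly), H.IsHomogeneous e ∧ ¬ Vanishes H P.1 ∧
    H * F ∈ idealPt P.1 ^ n ⊔ idealB t

/-- The form `F` has order of vanishing exactly `m` at the point `P` of the smooth curve `B`. -/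
def HasOrder (t : Triple) (P : PtB t) (F : Poly) (m : ℕ) : Prop :=
  IsGreatest {n | VanishesToOrder t P n F} m

/-- The order at `P` of the rational function `F / G` on `B` is the integer `m`. -/
def HasOrderQuot (t : Triple) (P : PtB t) (F G : Poly) (m : ℤ) : Prop :=
  ∃ m₁ m₂ : ℕ, HasOrder t P F m₁ ∧ HasOrder t P G m₂ ∧ m = (m₁ : ℤ) - (m₂ : ℤ)

/-- `F / G` is a nonzero rational function on `B`: a quotient of two forms of the same degree,
neither of which vanishes identically on `B`. -/
def IsRatFun (t : Triple) (F G : Poly) : Prop :=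
  (∃ n : ℕ, F.IsHomogeneous n ∧ G.IsHomogeneous n) ∧ F ∉ idealB t ∧ G ∉ idealB t

/-- The group of divisors on `B` over `ℚ̄`. -/
abbrev DivB (t : Triple) : Type := PtB t →₀ ℤ

/-- The divisors `div(F / G)` of nonzero rational functions on `B`. -/
def princSetB (t : Triple) : Set (DivB t) :=
  {D | ∃ F G : Poly, IsRatFun t F G ∧ ∀ P, HasOrderQuot t P F G (D P)}

/-- The group of principal divisors on `B`. -/
def princB (t : Triple) : AddSubgroup (DivB t) := AddSubgroup.closure (princSetB t)

/-- `Pic B = Div B / Princ B`, over `ℚ̄`. -/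
abbrev PicB (t : Triple) : Type := DivB t ⧸ princB t

/-- The degree of a divisor. -/
def deg {X : Type*} : (X →₀ ℤ) →+ ℤ := Finsupp.liftAddHom fun _ => AddMonoidHom.id ℤ

/-- `Jac(B) = Pic⁰(B)`, over `ℚ̄`: the classes of divisors of degree zero. -/
def jacB (t : Triple) : AddSubgroup (PicB t) :=
  (deg (X := PtB t)).ker.map (QuotientAddGroup.mk' (princB t))

/-- `Jac(B)[2]`, over `ℚ̄`. -/
def jacB2 (t : Triple) : AddSubgroup (PicB t) := jacB t ⊓ AddSubgroup.torsionBy (PicB t) 2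

/-! ### The involution `σ` and the quotient curve `B̃ = B / σ` -/

/-- The signs by which `σ` acts on the coordinates. -/
def sgn (i : Fin 5) : Qbar := if i < 3 then -1 else 1

lemma sgn_mul_sgn (i : Fin 5) : sgn i * sgn i = 1 := by
  unfold sgn; split_ifs <;> simp

/-- `(v₀, v₁, v₂, w₀, w₁) ↦ (-v₀, -v₁, -v₂, w₀, w₁)`, as a linear map. -/
def sigmaLin : (Fin 5 → Qbar) →ₗ[Qbar] (Fin 5 → Qbar) where
  toFun x i := sgn i * x i
  map_add' x y := by ext i; simp [mul_add]
  map_smul' r x := by ext i; simp; ring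

lemma sigmaLin_sigmaLin (x : Fin 5 → Qbar) : sigmaLin (sigmaLin x) = x := by
  ext i; simp [sigmaLin, ← mul_assoc, sgn_mul_sgn]

lemma sigmaLin_injective : Function.Injective sigmaLin :=
  Function.LeftInverse.injective sigmaLin_sigmaLin

/-- The involution `σ` of `ℙ⁴`. -/
def sigmaP4 : P4 → P4 := Projectivization.map sigmaLin sigmaLin_injective

/-- The action `F ↦ F ∘ σ` of `σ` on forms. -/
def sigmaPoly : Poly →ₐ[Qbar] Poly := aeval fun i => C (sgn i) * X i

lemma sigmaP4_sigmaP4 (P : P4) : sigmaP4 (sigmaP4 P) = P := by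
  induction P using Projectivization.ind with
  | h v hv => simp [sigmaP4, Projectivization.map_mk, sigmaLin_sigmaLin]

lemma vanishes_mk {F : Poly} {v : Fin 5 → Qbar} (hv : v ≠ 0) :
    Vanishes F (Projectivization.mk Qbar v hv) ↔ ∀ r : Qbar, eval (r • v) F = 0 := by
  simp only [Vanishes, Projectivization.submodule_mk, Submodule.mem_span_singleton]
  exact ⟨fun h r => h _ ⟨r, rfl⟩, by rintro h _ ⟨r, rfl⟩; exact h r⟩

lemma eval_q1 (x : Fin 5 → Qbar) : eval x q1 = x 0 * x 1 + 5 * x 2 ^ 2 - x 3 ^ 2 := by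
  simp [q1]

lemma eval_q2 (x : Fin 5 → Qbar) :
    eval x q2 = (x 0 + x 1) * (x 0 + 2 * x 1) - x 3 ^ 2 + 5 * x 4 ^ 2 := by
  simp [q2]

lemma eval_q3 (t : Triple) (x : Fin 5 → Qbar) :
    eval x (q3 t) = (t.a : Qbar) * x 0 ^ 2 + (t.b : Qbar) * x 1 ^ 2 + (t.c : Qbar) * x 2 ^ 2 := by
  simp [q3]

lemma eval_sigmaPoly (x : Fin 5 → Qbar) (F : Poly) :
    eval x (sigmaPoly F) = eval (sigmaLin x) F := by
  have h : (eval x).comp (sigmaPoly : Poly →+* Poly) = eval (sigmaLin x) := by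
    ext i <;> simp [sigmaPoly, sigmaLin]
  exact congrArg (fun f => f F) h

lemma vanishes_sigma {F : Poly} {P : P4} (hF : ∀ x, eval (sigmaLin x) F = eval x F)
    (h : Vanishes F P) : Vanishes F (sigmaP4 P) := by
  induction P using Projectivization.ind with
  | h v hv =>
    rw [sigmaP4, Projectivization.map_mk, vanishes_mk]
    rw [vanishes_mk] at h
    intro r
    rw [← map_smul, hF]
    exact h r

/-- The involution `σ` of `B`. -/
def sigma (t : Triple) (P : PtB t) : PtB t :=
  ⟨sigmaP4 P.1,
    vanishes_sigma (fun x => by simp only [eval_q1]; simp [sigmaLin, sgn]) P.2.1,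
    vanishes_sigma (fun x => by simp only [eval_q2]; simp [sigmaLin, sgn]; ring) P.2.2.1,
    vanishes_sigma (fun x => by simp only [eval_q3]; simp [sigmaLin, sgn]) P.2.2.2⟩

lemma sigma_sigma (t : Triple) (P : PtB t) : sigma t (sigma t P) = P :=
  Subtype.ext (sigmaP4_sigmaP4 P.1)

/-- `σ` acts freely on `B`, so the quotient morphism `f : B → B̃ = B / σ` is étale. -/
lemma sigma_ne (t : Triple) (P : PtB t) : sigma t P ≠ P := by
  obtain ⟨P, h1, h2, h3⟩ := P
  intro h
  have h := congrArg Subtype.val h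
  change sigmaP4 P = P at h
  induction P using Projectivization.ind with
  | h v hv =>
    rw [sigmaP4, Projectivization.map_mk, Projectivization.mk_eq_mk_iff'] at h
    obtain ⟨r, hr⟩ := h
    have e1 := (vanishes_mk hv).1 h1 1
    have e2 := (vanishes_mk hv).1 h2 1
    have e3 := (vanishes_mk hv).1 h3 1
    rw [one_smul, eval_q1] at e1
    rw [one_smul, eval_q2] at e2
    rw [one_smul, eval_q3] at e3
    have c0 := congrFun hr 0
    have c1 := congrFun hr 1
    have c2 := congrFun hr 2
    have c3 := congrFun hr 3
    have c4 := congrFun hr 4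
    simp [sigmaLin, sgn] at c0 c1 c2
    have c3 : r * v 3 = v 3 := by simpa [sigmaLin, sgn] using c3
    have c4 : r * v 4 = v 4 := by simpa [sigmaLin, sgn] using c4
    have hns := t.nonsing
    simp only [ne_eq, mul_eq_zero, not_or] at hns
    obtain ⟨⟨⟨⟨⟨⟨⟨ha, hb⟩, hc⟩, hl1⟩, hl2⟩, -⟩, -⟩, -⟩ := hns
    by_cases hr1 : r = 1
    · subst hr1
      have z0 : v 0 = 0 := by linear_combination (1 / 2 : Qbar) * c0
      have z1 : v 1 = 0 := by linear_combination (1 / 2 : Qbar) * c1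
      have z2 : v 2 = 0 := by linear_combination (1 / 2 : Qbar) * c2
      have z3 : v 3 = 0 := by
        have : v 3 ^ 2 = 0 := by rw [z0, z2] at e1; linear_combination -e1
        simpa using this
      have z4 : v 4 = 0 := by
        have : v 4 ^ 2 = 0 := by
          rw [z0, z1, z3] at e2; linear_combination (1 / 5 : Qbar) * e2
        simpa using this
      apply hv
      ext i
      fin_cases i <;> simp [z0, z1, z2, z3, z4]
    · have hr1' : r - 1 ≠ 0 := sub_ne_zero.2 hr1
      have z3 : v 3 = 0 := by
        have : (r - 1) * v 3 = 0 := by linear_combination c3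
        exact (mul_eq_zero.1 this).resolve_left hr1'
      have z4 : v 4 = 0 := by
        have : (r - 1) * v 4 = 0 := by linear_combination c4
        exact (mul_eq_zero.1 this).resolve_left hr1'
      rw [z3] at e1
      rw [z3, z4] at e2
      have hl1' : ((5 * t.a + 5 * t.b + t.c : ℤ) : Qbar) ≠ 0 := Int.cast_ne_zero.2 hl1
      have hl2' : ((20 * t.a + 5 * t.b + 2 * t.c : ℤ) : Qbar) ≠ 0 := Int.cast_ne_zero.2 hl2
      push_cast at hl1' hl2'
      have z1 : v 1 = 0 := by
        have e2' : (v 0 + v 1) * (v 0 + 2 * v 1) = 0 := by linear_combination e2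
        rcases mul_eq_zero.1 e2' with h0 | h0
        · have h0 : v 0 = -v 1 := by linear_combination h0
          rw [h0] at e1 e3
          have : (5 * (t.a : Qbar) + 5 * t.b + t.c) * v 1 ^ 2 = 0 := by
            linear_combination 5 * e3 - t.c * e1
          simpa using (mul_eq_zero.1 this).resolve_left hl1'
        · have h0 : v 0 = -2 * v 1 := by linear_combination h0
          rw [h0] at e1 e3
          have : (20 * (t.a : Qbar) + 5 * t.b + 2 * t.c) * v 1 ^ 2 = 0 := by
            linear_combination 5 * e3 - t.c * e1
          simpa using (mul_eq_zero.1 this).resolve_left hl2'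
      rw [z1] at e1 e2
      have z0 : v 0 = 0 := by
        have : v 0 ^ 2 = 0 := by linear_combination e2
        simpa using this
      have z2 : v 2 = 0 := by
        have : v 2 ^ 2 = 0 := by linear_combination (1 / 5 : Qbar) * e1
        simpa using this
      apply hv
      ext i
      fin_cases i <;> simp [z0, z1, z2, z3, z4]

/-- Two points of `B` are equivalent when they lie in the same orbit of `σ`. -/
def orbitSetoid (t : Triple) : Setoid (PtB t) where
  r P Q := Q = P ∨ Q = sigma t P
  iseqv :=
    { refl := fun _ => Or.inl rfl
      symm := by
        rintro P Q (rfl | rfl)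
        · exact Or.inl rfl
        · exact Or.inr (sigma_sigma t P).symm
      trans := by
        rintro P Q R (rfl | rfl) (rfl | rfl)
        · exact Or.inl rfl
        · exact Or.inr rfl
        · exact Or.inr rfl
        · exact Or.inl (sigma_sigma t P) }

/-- The (closed) points of `B̃ = B / σ` over `ℚ̄`. -/
def PtBt (t : Triple) : Type := Quotient (orbitSetoid t)

/-- The quotient map `f : B → B̃`, on points. -/
def f (t : Triple) (P : PtB t) : PtBt t := Quotient.mk (orbitSetoid t) P

lemma f_eq_f {t : Triple} {P Q : PtB t} : f t P = f t Q ↔ Q = P ∨ Q = sigma t P :=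
  Quotient.eq (r := orbitSetoid t)

lemma f_surjective (t : Triple) : Function.Surjective (f t) := Quotient.mk_surjective

/-- The rational function `F / G` on `B` is invariant under `σ`, i.e. lies in the function field
`𝐤(B̃) = 𝐤(B)^σ`. -/
def IsSigmaInvariant (t : Triple) (F G : Poly) : Prop :=
  sigmaPoly F * G - F * sigmaPoly G ∈ idealB t

/-- The group of divisors on `B̃` over `ℚ̄`. -/
abbrev DivBt (t : Triple) : Type := PtBt t →₀ ℤ

/-- The divisors of nonzero rational functions on `B̃`.  As `f` is étale, the order at `f(P)` of a
function on `B̃` is the order at `P` of its pullback to `B`. -/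
def princSetBt (t : Triple) : Set (DivBt t) :=
  {D | ∃ F G : Poly, IsRatFun t F G ∧ IsSigmaInvariant t F G ∧
    ∀ P, HasOrderQuot t P F G (D (f t P))}

/-- The group of principal divisors on `B̃`. -/
def princBt (t : Triple) : AddSubgroup (DivBt t) := AddSubgroup.closure (princSetBt t)

/-- `Pic B̃ = Div B̃ / Princ B̃`, over `ℚ̄`. -/
abbrev PicBt (t : Triple) : Type := DivBt t ⧸ princBt t

/-- `Jac(B̃) = Pic⁰(B̃)`, over `ℚ̄`. -/
def jacBt (t : Triple) : AddSubgroup (PicBt t) :=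
  (deg (X := PtBt t)).ker.map (QuotientAddGroup.mk' (princBt t))

/-- `Jac(B̃)[2]`, over `ℚ̄`. -/
def jacBt2 (t : Triple) : AddSubgroup (PicBt t) :=
  jacBt t ⊓ AddSubgroup.torsionBy (PicBt t) 2

/-! ### The pullback `f^*` -/

/-- Pullback of divisors along the étale morphism `f`: the point `x` goes to the sum of the points
of its fibre. -/
def pullDiv (t : Triple) : DivBt t →+ DivB t where
  toFun D := Finsupp.ofSupportFinite (fun P => D (f t P)) <| by
    classical
    refine (D.support.finite_toSet.biUnion (t := fun x => f t ⁻¹' {x}) fun x _ => ?_).subset ?_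
    · obtain ⟨P, rfl⟩ := f_surjective t x
      refine (Set.toFinite {P, sigma t P}).subset fun Q hQ => ?_
      exact f_eq_f.1 (Eq.symm hQ)
    · intro P hP
      exact Set.mem_biUnion (x := f t P) (by simpa using hP) rfl
  map_zero' := by ext; rfl
  map_add' _ _ := by ext; rfl

lemma pullDiv_apply (t : Triple) (D : DivBt t) (P : PtB t) : pullDiv t D P = D (f t P) := rfl

lemma pullDiv_mem (t : Triple) : princBt t ≤ (princB t).comap (pullDiv t) := by
  refine (AddSubgroup.closure_le _).2 ?_
  rintro D ⟨F, G, h, -, hD⟩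
  exact AddSubgroup.subset_closure ⟨F, G, h, hD⟩

lemma pullDiv_single (t : Triple) (P : PtB t) (n : ℤ) :
    pullDiv t (Finsupp.single (f t P) n) =
      Finsupp.single P n + Finsupp.single (sigma t P) n := by
  classical
  ext Q
  rw [pullDiv_apply, Finsupp.add_apply]
  simp only [Finsupp.single_apply, f_eq_f]
  have := sigma_ne t P
  by_cases h1 : P = Q
  · subst h1; simp [this]
  · by_cases h2 : sigma t P = Q
    · subst h2; simp [h1]
    · simp [h1, h2, Ne.symm h1, Ne.symm h2]

lemma deg_pullDiv (t : Triple) (D : DivBt t) : deg (pullDiv t D) = 2 * deg D := by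
  have : (deg (X := PtB t)).comp (pullDiv t) = (2 : ℕ) • deg (X := PtBt t) := by
    refine Finsupp.addHom_ext fun x n => ?_
    obtain ⟨P, rfl⟩ := f_surjective t x
    simp only [AddMonoidHom.comp_apply, pullDiv_single, map_add, AddMonoidHom.smul_apply]
    simp [deg, two_mul]
  simpa using DFunLike.congr_fun this D

/-- `f^* : Pic B̃ → Pic B`. -/
def fstarPic (t : Triple) : PicBt t →+ PicB t :=
  QuotientAddGroup.map _ _ (pullDiv t) (pullDiv_mem t)

lemma fstarPic_mem (t : Triple) {x : PicBt t} (hx : x ∈ jacBt2 t) :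
    fstarPic t x ∈ jacB2 t := by
  obtain ⟨⟨D, hD, rfl⟩, h2⟩ := hx
  refine ⟨⟨pullDiv t D, ?_, rfl⟩, ?_⟩
  · have hD : deg D = 0 := hD
    change deg (pullDiv t D) = 0
    rw [deg_pullDiv, hD, mul_zero]
  · have h2 : (2 : ℤ) • (QuotientAddGroup.mk' (princBt t) D) = 0 := h2
    change (2 : ℤ) • (fstarPic t (QuotientAddGroup.mk' (princBt t) D)) = 0
    rw [← map_zsmul, h2, map_zero]

/-- `f^* : Jac(B̃)[2] → Jac(B)[2]`, over `ℚ̄`. -/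
def fstar (t : Triple) : jacBt2 t →+ jacB2 t :=
  ((fstarPic t).comp (jacBt2 t).subtype).codRestrict (jacB2 t) fun x => fstarPic_mem t x.2

/-! ### The points `P_i` and `Q_j` -/

/-- `f(V(w₀)) ⊂ B̃`. -/
def fVw0 (t : Triple) : Set (PtBt t) := f t '' {P | Vanishes (X 3) P.1}

/-- `f(V(w₁)) ⊂ B̃`. -/
def fVw1 (t : Triple) : Set (PtBt t) := f t '' {P | Vanishes (X 4) P.1}

/-- The class in `Pic B̃` of the subset `{P₁, …, Pₙ}` of the Weierstrass points, for even `n`: the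
class of `P₁ + ⋯ + Pₙ - n W`, where `W` is any Weierstrass point
(`2W` being a divisor of the hyperelliptic linear system, this is the class of
`P₁ + ⋯ + Pₙ` minus `n / 2` times the hyperelliptic class). -/
def subsetClass (t : Triple) {n : ℕ} (P : Fin n → PtBt t) (W : PtBt t) : PicBt t :=
  QuotientAddGroup.mk' (princBt t)
    (∑ i, Finsupp.single (P i) 1 - (n : ℤ) • Finsupp.single W 1)

/-! ### The Galois action -/

/-- The action of `g ∈ G_{K₀}` on coordinates. -/
def galLin (g : GK0) : (Fin 5 → Qbar) →ₛₗ[(g : Qbar →+* Qbar)] (Fin 5 → Qbar) where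
  toFun x i := g (x i)
  map_add' x y := by ext i; simp
  map_smul' r x := by ext i; simp

lemma galLin_apply (g : GK0) (x : Fin 5 → Qbar) (i : Fin 5) : galLin g x i = g (x i) := rfl

lemma galLin_injective (g : GK0) : Function.Injective (galLin g) := fun x y h => by
  ext i; exact g.injective (congrFun h i)

/-- The action of `g ∈ G_{K₀}` on the points of `ℙ⁴`. -/
def galP4 (g : GK0) : P4 → P4 := Projectivization.map (galLin g) (galLin_injective g)

/-- The action of `g ∈ G_{K₀}` on polynomials, through the coefficients. -/
def galPoly (g : GK0) : Poly →+* Poly := MvPolynomial.map (g : Qbar →+* Qbar)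

lemma galP4_one (P : P4) : galP4 1 P = P := by
  induction P using Projectivization.ind with
  | h v hv => rfl

lemma galP4_mul (g h : GK0) (P : P4) : galP4 (g * h) P = galP4 g (galP4 h P) := by
  induction P using Projectivization.ind with
  | h v hv => rfl

lemma galPoly_inv (g : GK0) (F : Poly) : galPoly g (galPoly g⁻¹ F) = F := by
  rw [galPoly, galPoly, MvPolynomial.map_map]
  have h : (g : Qbar →+* Qbar).comp ((g⁻¹ : GK0) : Qbar →+* Qbar) = RingHom.id Qbar :=
    RingHom.ext fun x => g.apply_symm_apply x
  rw [h, MvPolynomial.map_id]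

lemma galPoly_inv' (g : GK0) (F : Poly) : galPoly g⁻¹ (galPoly g F) = F := by
  have := galPoly_inv g⁻¹ F
  rwa [inv_inv] at this

lemma eval_galPoly (g : GK0) (x : Fin 5 → Qbar) (F : Poly) :
    eval (galLin g x) (galPoly g F) = g (eval x F) := by
  have h : (eval (galLin g x)).comp (galPoly g) = (g : Qbar →+* Qbar).comp (eval x) := by
    ext i <;> simp [galPoly, galLin]
  exact congrArg (fun f => f F) h

lemma vanishes_gal (g : GK0) {F : Poly} {P : P4} (h : Vanishes F P) :
    Vanishes (galPoly g F) (galP4 g P) := by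
  induction P using Projectivization.ind with
  | h v hv =>
    rw [galP4, Projectivization.map_mk, vanishes_mk]
    rw [vanishes_mk] at h
    intro r
    have : r • galLin g v = galLin g (g⁻¹ r • v) := by
      rw [map_smulₛₗ]
      congr 1
      exact (g.apply_symm_apply r).symm
    rw [this, eval_galPoly, h, map_zero]

lemma vanishes_gal_iff (g : GK0) {F : Poly} {P : P4} :
    Vanishes (galPoly g F) (galP4 g P) ↔ Vanishes F P := by
  refine ⟨fun h => ?_, vanishes_gal g⟩
  have := vanishes_gal g⁻¹ h
  rwa [galPoly_inv', ← galP4_mul, inv_mul_cancel, galP4_one] at this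

lemma galPoly_q1 (g : GK0) : galPoly g q1 = q1 := by simp [galPoly, q1]

lemma galPoly_q2 (g : GK0) : galPoly g q2 = q2 := by simp [galPoly, q2]

lemma galPoly_q3 (g : GK0) (t : Triple) : galPoly g (q3 t) = q3 t := by simp [galPoly, q3]

instance (t : Triple) : MulAction GK0 (PtB t) where
  smul g P := ⟨galP4 g P.1, by
    obtain ⟨h1, h2, h3⟩ := P.2
    have h1 := vanishes_gal g h1
    have h2 := vanishes_gal g h2
    have h3 := vanishes_gal g h3
    rw [galPoly_q1] at h1
    rw [galPoly_q2] at h2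
    rw [galPoly_q3] at h3
    exact ⟨h1, h2, h3⟩⟩
  one_smul P := Subtype.ext (galP4_one P.1)
  mul_smul g h P := Subtype.ext (galP4_mul g h P.1)

lemma smul_val {t : Triple} (g : GK0) (P : PtB t) : (g • P).1 = galP4 g P.1 := rfl

lemma smul_sigma {t : Triple} (g : GK0) (P : PtB t) : g • sigma t P = sigma t (g • P) := by
  apply Subtype.ext
  change galP4 g (sigmaP4 P.1) = sigmaP4 (galP4 g P.1)
  obtain ⟨P, -⟩ := P
  induction P using Projectivization.ind with
  | h v hv =>
    simp only [galP4, sigmaP4, Projectivization.map_mk]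
    congr 1
    ext i
    simp only [galLin_apply, sigmaLin, LinearMap.coe_mk, AddHom.coe_mk, map_mul]
    congr 1
    unfold sgn
    split_ifs <;> simp

instance (t : Triple) : MulAction GK0 (PtBt t) where
  smul g := Quotient.map (g • ·) (by
    rintro P Q (rfl | rfl)
    · exact Or.inl rfl
    · exact Or.inr (smul_sigma g P))
  one_smul x := by
    obtain ⟨P, rfl⟩ := f_surjective t x
    exact congrArg (f t) (one_smul _ P)
  mul_smul g h x := by
    obtain ⟨P, rfl⟩ := f_surjective t x
    exact congrArg (f t) (mul_smul g h P)

lemma smul_f {t : Triple} (g : GK0) (P : PtB t) : g • f t P = f t (g • P) := rfl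

lemma galPoly_idealB (g : GK0) (t : Triple) {F : Poly} (h : F ∈ idealB t) :
    galPoly g F ∈ idealB t := by
  have hle : idealB t ≤ (idealB t).comap (galPoly g) := by
    refine Ideal.span_le.2 ?_
    rintro F (rfl | rfl | rfl)
    · change galPoly g q1 ∈ idealB t
      rw [galPoly_q1]; exact Ideal.subset_span (by simp)
    · change galPoly g q2 ∈ idealB t
      rw [galPoly_q2]; exact Ideal.subset_span (by simp)
    · change galPoly g (q3 t) ∈ idealB t
      rw [galPoly_q3]; exact Ideal.subset_span (by simp)
  exact hle h

lemma galPoly_idealB_iff (g : GK0) (t : Triple) {F : Poly} :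
    galPoly g F ∈ idealB t ↔ F ∈ idealB t := by
  refine ⟨fun h => ?_, galPoly_idealB g t⟩
  have := galPoly_idealB g⁻¹ t h
  rwa [galPoly_inv'] at this

lemma galPoly_idealPt (g : GK0) (P : P4) :
    (idealPt P).map (galPoly g) ≤ idealPt (galP4 g P) := by
  rw [idealPt, Ideal.map_span]
  refine Ideal.span_le.2 ?_
  rintro _ ⟨F, hF, rfl⟩
  exact Ideal.subset_span (vanishes_gal g hF)

lemma vanishesToOrder_gal (g : GK0) {t : Triple} {P : PtB t} {n : ℕ} {F : Poly}
    (h : VanishesToOrder t P n F) : VanishesToOrder t (g • P) n (galPoly g F) := by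
  obtain ⟨e, H, hH, hP, hmem⟩ := h
  refine ⟨e, galPoly g H, hH.map _, ?_, ?_⟩
  · rwa [smul_val, vanishes_gal_iff]
  · have h1 := Ideal.mem_map_of_mem (galPoly g) hmem
    rw [map_mul, Ideal.map_sup, Ideal.map_pow] at h1
    refine sup_le_sup (Ideal.pow_right_mono (galPoly_idealPt g P.1) n) ?_ h1
    exact Ideal.map_le_iff_le_comap.2 fun _ => galPoly_idealB g t

lemma vanishesToOrder_gal_iff (g : GK0) {t : Triple} {P : PtB t} {n : ℕ} {F : Poly} :
    VanishesToOrder t (g • P) n (galPoly g F) ↔ VanishesToOrder t P n F := by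
  refine ⟨fun h => ?_, vanishesToOrder_gal g⟩
  have := vanishesToOrder_gal g⁻¹ h
  rwa [galPoly_inv', inv_smul_smul] at this

lemma hasOrderQuot_gal (g : GK0) {t : Triple} {P : PtB t} {F G : Poly} {m : ℤ}
    (h : HasOrderQuot t P F G m) : HasOrderQuot t (g • P) (galPoly g F) (galPoly g G) m := by
  simpa only [HasOrderQuot, HasOrder, vanishesToOrder_gal_iff] using h

lemma isRatFun_gal (g : GK0) {t : Triple} {F G : Poly} (h : IsRatFun t F G) :
    IsRatFun t (galPoly g F) (galPoly g G) := by
  obtain ⟨⟨n, hF, hG⟩, h1, h2⟩ := h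
  exact ⟨⟨n, hF.map _, hG.map _⟩, by rwa [galPoly_idealB_iff], by rwa [galPoly_idealB_iff]⟩

lemma galPoly_sigmaPoly (g : GK0) (F : Poly) :
    galPoly g (sigmaPoly F) = sigmaPoly (galPoly g F) := by
  have h : (galPoly g).comp (sigmaPoly : Poly →+* Poly) =
      (sigmaPoly : Poly →+* Poly).comp (galPoly g) := by
    refine MvPolynomial.ringHom_ext (fun r => ?_) fun i => ?_
    · simp [galPoly, sigmaPoly]
    · have hs : g (sgn i) = sgn i := by unfold sgn; split_ifs <;> simp
      simp [galPoly, sigmaPoly, hs]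
  exact congrArg (fun f => f F) h

lemma isSigmaInvariant_gal (g : GK0) {t : Triple} {F G : Poly} (h : IsSigmaInvariant t F G) :
    IsSigmaInvariant t (galPoly g F) (galPoly g G) := by
  have := galPoly_idealB g t h
  simpa only [IsSigmaInvariant, map_sub, map_mul, galPoly_sigmaPoly] using this

/-- The action of `g ∈ G_{K₀}` on divisors (`X` being the set of points of a curve). -/
def galDiv {X : Type*} [MulAction GK0 X] (g : GK0) : (X →₀ ℤ) →+ (X →₀ ℤ) :=
  Finsupp.mapDomain.addMonoidHom (g • ·)

lemma galDiv_apply {X : Type*} [MulAction GK0 X] (g : GK0) (D : X →₀ ℤ) (x : X) :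
    galDiv g D (g • x) = D x :=
  Finsupp.mapDomain_apply (MulAction.injective g) D x

lemma galDiv_one {X : Type*} [MulAction GK0 X] (D : X →₀ ℤ) : galDiv 1 D = D := by
  ext x
  simpa using galDiv_apply 1 D x

lemma galDiv_mul {X : Type*} [MulAction GK0 X] (g h : GK0) (D : X →₀ ℤ) :
    galDiv (g * h) D = galDiv g (galDiv h D) := by
  ext x
  obtain ⟨x, rfl⟩ := MulAction.surjective (g * h) x
  change galDiv (g * h) D ((g * h) • x) = galDiv g (galDiv h D) ((g * h) • x)
  rw [galDiv_apply, mul_smul, galDiv_apply, galDiv_apply]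

lemma deg_galDiv {X : Type*} [MulAction GK0 X] (g : GK0) (D : X →₀ ℤ) :
    deg (galDiv g D) = deg D := by
  have : (deg (X := X)).comp (galDiv g) = deg := by
    refine Finsupp.addHom_ext fun x n => ?_
    simp [deg, galDiv]
  exact DFunLike.congr_fun this D

lemma galDiv_princB (g : GK0) (t : Triple) :
    princB t ≤ (princB t).comap (galDiv (X := PtB t) g) := by
  refine (AddSubgroup.closure_le _).2 ?_
  rintro D ⟨F, G, h, hD⟩
  refine AddSubgroup.subset_closure ⟨galPoly g F, galPoly g G, isRatFun_gal g h, fun P => ?_⟩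
  have := hasOrderQuot_gal g (hD (g⁻¹ • P))
  rwa [← galDiv_apply g D, smul_inv_smul] at this

lemma galDiv_princBt (g : GK0) (t : Triple) :
    princBt t ≤ (princBt t).comap (galDiv (X := PtBt t) g) := by
  refine (AddSubgroup.closure_le _).2 ?_
  rintro D ⟨F, G, h, hs, hD⟩
  refine AddSubgroup.subset_closure ⟨galPoly g F, galPoly g G, isRatFun_gal g h,
    isSigmaInvariant_gal g hs, fun P => ?_⟩
  have := hasOrderQuot_gal g (hD (g⁻¹ • P))
  rwa [← galDiv_apply g D, smul_f, smul_inv_smul] at this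

/-- The action of `G_{K₀}` on `Pic B`. -/
instance (t : Triple) : DistribMulAction GK0 (PicB t) where
  smul g := QuotientAddGroup.map _ _ (galDiv g) (galDiv_princB g t)
  one_smul x := by
    obtain ⟨D, rfl⟩ := QuotientAddGroup.mk_surjective x
    exact congrArg (QuotientAddGroup.mk (s := princB t)) (galDiv_one D)
  mul_smul g h x := by
    obtain ⟨D, rfl⟩ := QuotientAddGroup.mk_surjective x
    exact congrArg (QuotientAddGroup.mk (s := princB t)) (galDiv_mul g h D)
  smul_zero g := map_zero (QuotientAddGroup.map _ _ (galDiv g) (galDiv_princB g t))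
  smul_add g := map_add (QuotientAddGroup.map _ _ (galDiv g) (galDiv_princB g t))

/-- The action of `G_{K₀}` on `Pic B̃`. -/
instance (t : Triple) : DistribMulAction GK0 (PicBt t) where
  smul g := QuotientAddGroup.map _ _ (galDiv g) (galDiv_princBt g t)
  one_smul x := by
    obtain ⟨D, rfl⟩ := QuotientAddGroup.mk_surjective x
    exact congrArg (QuotientAddGroup.mk (s := princBt t)) (galDiv_one D)
  mul_smul g h x := by
    obtain ⟨D, rfl⟩ := QuotientAddGroup.mk_surjective x
    exact congrArg (QuotientAddGroup.mk (s := princBt t)) (galDiv_mul g h D)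
  smul_zero g := map_zero (QuotientAddGroup.map _ _ (galDiv g) (galDiv_princBt g t))
  smul_add g := map_add (QuotientAddGroup.map _ _ (galDiv g) (galDiv_princBt g t))

lemma smul_mkB (t : Triple) (g : GK0) (D : DivB t) :
    g • (QuotientAddGroup.mk' (princB t) D) = QuotientAddGroup.mk' (princB t) (galDiv g D) := rfl

lemma smul_mkBt (t : Triple) (g : GK0) (D : DivBt t) :
    g • (QuotientAddGroup.mk' (princBt t) D) =
      QuotientAddGroup.mk' (princBt t) (galDiv g D) := rfl

lemma smul_mem_jacB2 (t : Triple) (g : GK0) {x : PicB t} (hx : x ∈ jacB2 t) :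
    g • x ∈ jacB2 t := by
  obtain ⟨⟨D, hD, rfl⟩, h2⟩ := hx
  refine ⟨⟨galDiv g D, ?_, rfl⟩, ?_⟩
  · exact (deg_galDiv g D).trans hD
  · have h2 : (2 : ℤ) • (QuotientAddGroup.mk' (princB t) D) = 0 := h2
    change (2 : ℤ) • (g • (QuotientAddGroup.mk' (princB t) D)) = 0
    rw [two_zsmul] at h2 ⊢
    rw [← smul_add, h2, smul_zero]

lemma smul_mem_jacBt2 (t : Triple) (g : GK0) {x : PicBt t} (hx : x ∈ jacBt2 t) :
    g • x ∈ jacBt2 t := by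
  obtain ⟨⟨D, hD, rfl⟩, h2⟩ := hx
  refine ⟨⟨galDiv g D, ?_, rfl⟩, ?_⟩
  · exact (deg_galDiv g D).trans hD
  · have h2 : (2 : ℤ) • (QuotientAddGroup.mk' (princBt t) D) = 0 := h2
    change (2 : ℤ) • (g • (QuotientAddGroup.mk' (princBt t) D)) = 0
    rw [two_zsmul] at h2 ⊢
    rw [← smul_add, h2, smul_zero]

lemma fstarPic_smul (t : Triple) (g : GK0) (x : PicBt t) :
    fstarPic t (g • x) = g • fstarPic t x := by
  obtain ⟨D, rfl⟩ := QuotientAddGroup.mk_surjective x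
  refine congrArg (QuotientAddGroup.mk (s := princB t)) ?_
  ext P
  obtain ⟨P, rfl⟩ := MulAction.surjective g P
  change pullDiv t (galDiv g D) (g • P) = galDiv g (pullDiv t D) (g • P)
  rw [galDiv_apply, pullDiv_apply, pullDiv_apply, ← smul_f, galDiv_apply]

/-- The action of `G_{K₀}` on `Jac(B)[2]`. -/
instance (t : Triple) : DistribMulAction GK0 (jacB2 t) where
  smul g x := ⟨g • x.1, smul_mem_jacB2 t g x.2⟩
  one_smul x := Subtype.ext (one_smul _ x.1)
  mul_smul g h x := Subtype.ext (mul_smul g h x.1)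
  smul_zero g := Subtype.ext (smul_zero g)
  smul_add g x y := Subtype.ext (smul_add g x.1 y.1)

/-- The action of `G_{K₀}` on `Jac(B̃)[2]`. -/
instance (t : Triple) : DistribMulAction GK0 (jacBt2 t) where
  smul g x := ⟨g • x.1, smul_mem_jacBt2 t g x.2⟩
  one_smul x := Subtype.ext (one_smul _ x.1)
  mul_smul g h x := Subtype.ext (mul_smul g h x.1)
  smul_zero g := Subtype.ext (smul_zero g)
  smul_add g x y := Subtype.ext (smul_add g x.1 y.1)

lemma fstar_smul (t : Triple) (g : GK0) (x : jacBt2 t) :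
    fstar t (g • x) = g • fstar t x :=
  Subtype.ext (fstarPic_smul t g x.1)

/-- The image of `f^* : Jac(B̃)[2] → Jac(B)[2]`. -/
abbrev imF (t : Triple) : AddSubgroup (jacB2 t) := (fstar t).range

/-- The action of `G_{K₀}` on the image of `f^*`. -/
instance (t : Triple) : DistribMulAction GK0 (imF t) where
  smul g x := ⟨g • x.1, by
    obtain ⟨y, hy⟩ := x.2
    exact ⟨g • y, by rw [fstar_smul, hy]⟩⟩
  one_smul x := Subtype.ext (one_smul _ x.1)
  mul_smul g h x := Subtype.ext (mul_smul g h x.1)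
  smul_zero g := Subtype.ext (smul_zero g)
  smul_add g x y := Subtype.ext (smul_add g x.1 y.1)

end EnriquesBranch

end

open scoped LinearAlgebra.Projectivization

noncomputable section

namespace EnriquesBranch

open MvPolynomial

/-! ### Square roots of power series -/

/-! Eliminating, `B` becomes v₂² = Q₀, w₀² = Q₁, w₁² = Q₂ over the line with coordinates v₀, v₁. The
nonvanishing hypotheses make the binary quadratic forms Q_j separable and pairwise coprime. The
eight sign changes of (v₂, w₀, w₁) act on `B` with the fibres over the line as orbits, and σ is, up
to the scalar -1, the simultaneous sign change of w₀ and w₁. Hence `B̃` is a double cover of the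
conic v₂² = Q₀, branched at the four points with w₀ = 0 and the four with w₁ = 0.

Divisor theory on `B` is obtained by expanding forms along explicit power series branches (`phi`). A
form vanishing along one branch lies in the ideal (`mem_idealB_of_phi_eq_zero`), the order of the
expansion is the order of vanishing (`vanishesToOrder_iff`), a form of degree d has 8d zeros
(`deg_dv`), and its divisor determines it up to a constant (`exists_const_of_dv_eq`).

Kernel: if the pullback of a divisor D on `B̃` is the divisor of a function h on `B`, then σ
multiplies h by ±1, and D is principal exactly when the sign is +1. So the kernel has order at most
two, and w₀ divided by a linear form in v₀, v₁, v₂ realises the sign -1 (`semiInv_edge`,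
`mem_ker_fstar_iff`).

Image: a Hilbert 90 argument for the hyperelliptic involution represents each 2-torsion class by a
degree-zero divisor on the Weierstrass points (`exists_weierDiv`). Its pullback is principal exactly
when its coefficients have constant parity on {P_i} and constant parity on {Q_j}
(`pullDiv_mem_princB_iff_even`). Thus the image consists of the parity functions of total sum zero
on the eight points, modulo the two indicator functions.

Galois action: each set of four points consists of the roots ±y₁, ±y₂ of a biquadratic equation, and
y₁y₂ is, up to a factor in `K0`, √(ab) for the P_i and √(4a² + b²) for the Q_j. The even subsets of
four points modulo complements form a Klein four-group, generated by the pair {y₁, y₂}, whose class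
is fixed exactly over that quadratic extension: this is the induced module. The map to ℤ/2ℤ is the
parity of the sum of the coefficients on {P_i}. A splitting would give an invariant class of odd
sum; modulo complements such a class singles out one P_i, which is then fixed by Galois, so c² -
100ab is a square in `K0` (`IsFrame.exists_fixed`, `exists_sqrt_of_fixed`). -/

lemma exists_powerSeries_sqrt {k : Type*} [Field k] [NeZero (2 : k)] (u : PowerSeries k) {c : k}
    (hc : c ≠ 0) (hu : PowerSeries.constantCoeff u = c ^ 2) :
    ∃ s : PowerSeries k, s ^ 2 = u ∧ PowerSeries.constantCoeff s = c := by
  have hmem : ∀ a : PowerSeries k, a ∈ Ideal.span {(PowerSeries.X : PowerSeries k)} ↔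
      PowerSeries.constantCoeff a = 0 := fun a => by
    rw [Ideal.mem_span_singleton, PowerSeries.X_dvd_iff]
  -- Hensel's lemma for Y² - u at the approximate root c; the derivative 2c is a unit modulo X.
  have h := HenselianRing.is_henselian (I := Ideal.span {(PowerSeries.X : PowerSeries k)})
    (Polynomial.X ^ 2 - Polynomial.C u) (Polynomial.monic_X_pow_sub_C u two_ne_zero)
    (PowerSeries.C c) (by rw [hmem]; simp [hu]) (by
      apply IsUnit.map
      rw [PowerSeries.isUnit_iff_constantCoeff]
      have h2 : PowerSeries.constantCoeff (2 : PowerSeries k) = 2 := map_ofNat _ 2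
      simp [one_add_one_eq_two, hc, h2, two_ne_zero])
  obtain ⟨s, hs, hsc⟩ := h
  refine ⟨s, ?_, ?_⟩
  · simpa [Polynomial.IsRoot, sub_eq_zero] using hs
  · simpa [hmem, sub_eq_zero] using hsc

/-! ### The equations of `B` as a tower of square roots -/

/-- The coefficients of the binary quadratic forms `Q_j` such that `B` is given by
`v₂² = Q₀(v₀, v₁)`, `w₀² = Q₁(v₀, v₁)`, `w₁² = Q₂(v₀, v₁)`. -/
def qcoef (t : Triple) : Fin 3 → Fin 3 → Qbar :=
  ![![-t.a / t.c, 0, -t.b / t.c],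
    ![-5 * t.a / t.c, 1, -5 * t.b / t.c],
    ![-t.a / t.c - 1 / 5, -2 / 5, -t.b / t.c - 2 / 5]]

/-- The binary quadratic forms `Q_j` over which the last three coordinates are square roots. -/
def qform (t : Triple) (j : Fin 3) : MvPolynomial (Fin 2) Qbar :=
  C (qcoef t j 0) * X 0 ^ 2 + C (qcoef t j 1) * (X 0 * X 1) + C (qcoef t j 2) * X 1 ^ 2

lemma isHomogeneous_qform (t : Triple) (j : Fin 3) : (qform t j).IsHomogeneous 2 := by
  have h0 : (X 0 ^ 2 : MvPolynomial (Fin 2) Qbar).IsHomogeneous 2 := isHomogeneous_X_pow _ _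
  have h1 : (X 1 ^ 2 : MvPolynomial (Fin 2) Qbar).IsHomogeneous 2 := isHomogeneous_X_pow _ _
  have h2 : (X 0 * X 1 : MvPolynomial (Fin 2) Qbar).IsHomogeneous 2 :=
    (isHomogeneous_X _ _).mul (isHomogeneous_X _ _)
  exact ((h0.C_mul _).add (h2.C_mul _)).add (h1.C_mul _)

lemma aeval_qform {S : Type*} [CommRing S] [Algebra Qbar S] (t : Triple) (j : Fin 3)
    (x : Fin 2 → S) : aeval x (qform t j) = algebraMap Qbar S (qcoef t j 0) * x 0 ^ 2 +
      algebraMap Qbar S (qcoef t j 1) * (x 0 * x 1) +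
      algebraMap Qbar S (qcoef t j 2) * x 1 ^ 2 := by
  simp [qform]

lemma Triple.ne_zero (t : Triple) : (t.a : Qbar) ≠ 0 ∧ (t.b : Qbar) ≠ 0 ∧ (t.c : Qbar) ≠ 0 ∧
    (5 * t.a + 5 * t.b + t.c : Qbar) ≠ 0 ∧ (20 * t.a + 5 * t.b + 2 * t.c : Qbar) ≠ 0 ∧
    (4 * t.a ^ 2 + t.b ^ 2 : Qbar) ≠ 0 ∧ (t.c ^ 2 - 100 * t.a * t.b : Qbar) ≠ 0 ∧
    (t.c ^ 2 + 5 * t.b * t.c + 10 * t.a * t.c + 25 * t.a * t.b : Qbar) ≠ 0 := by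
  have h := t.nonsing
  simp only [ne_eq, mul_eq_zero, not_or] at h
  obtain ⟨⟨⟨⟨⟨⟨⟨ha, hb⟩, hc⟩, h1⟩, h2⟩, h3⟩, h4⟩, h5⟩ := h
  refine ⟨?_, ?_, ?_, ?_, ?_, ?_, ?_, ?_⟩ <;> assumption_mod_cast

lemma qcoef_disc_ne_zero (t : Triple) (j : Fin 3) :
    qcoef t j 1 ^ 2 - 4 * qcoef t j 0 * qcoef t j 2 ≠ 0 := by
  obtain ⟨ha, hb, hc, -, -, -, h4, h5⟩ := t.ne_zero
  fin_cases j
  · have : qcoef t 0 1 ^ 2 - 4 * qcoef t 0 0 * qcoef t 0 2 = -4 * t.a * t.b / t.c ^ 2 := by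
      simp [qcoef]; field_simp
    simp [this, ha, hb, hc]
  · have : qcoef t 1 1 ^ 2 - 4 * qcoef t 1 0 * qcoef t 1 2 =
        (t.c ^ 2 - 100 * t.a * t.b) / t.c ^ 2 := by
      simp [qcoef]; field_simp; ring
    simp [this, h4, hc]
  · have : qcoef t 2 1 ^ 2 - 4 * qcoef t 2 0 * qcoef t 2 2 =
        -4 * (t.c ^ 2 + 5 * t.b * t.c + 10 * t.a * t.c + 25 * t.a * t.b) / (25 * t.c ^ 2) := by
      simp [qcoef]; field_simp; ring
    simp [this, h5, hc]

/-- The polar form of `Q_j` does not vanish at a zero of `Q_j`. -/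
lemma qform_polar_ne_zero (t : Triple) (j : Fin 3) {x d : Fin 2 → Qbar}
    (hx : aeval x (qform t j) = 0) (hd : x 0 * d 1 - x 1 * d 0 ≠ 0) :
    2 * qcoef t j 0 * (x 0 * d 0) + qcoef t j 1 * (x 0 * d 1 + x 1 * d 0) +
      2 * qcoef t j 2 * (x 1 * d 1) ≠ 0 := by
  intro h
  rw [aeval_qform] at hx
  simp only [Algebra.algebraMap_self, RingHom.id_apply] at hx
  -- Gram identity: polar(x, d)² - 4 Q(x) Q(d) = disc(Q) · det(x, d)².
  have : (qcoef t j 1 ^ 2 - 4 * qcoef t j 0 * qcoef t j 2) * (x 0 * d 1 - x 1 * d 0) ^ 2 = 0 := by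
    linear_combination (2 * qcoef t j 0 * (x 0 * d 0) + qcoef t j 1 * (x 0 * d 1 + x 1 * d 0) +
      2 * qcoef t j 2 * (x 1 * d 1)) * h - 4 * (qcoef t j 0 * d 0 ^ 2 +
      qcoef t j 1 * (d 0 * d 1) + qcoef t j 2 * d 1 ^ 2) * hx
  rcases mul_eq_zero.1 this with h' | h'
  · exact qcoef_disc_ne_zero t j h'
  · exact hd (pow_eq_zero_iff two_ne_zero |>.1 h')

/-- The forms `Q_j` have no common zeros. -/
lemma qform_coprime (t : Triple) {i j : Fin 3} (hij : i ≠ j) {x : Fin 2 → Qbar}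
    (hi : aeval x (qform t i) = 0) (hj : aeval x (qform t j) = 0) : x = 0 := by
  obtain ⟨ha, hb, hc, h1, h2, h3, -, -⟩ := t.ne_zero
  have key : ∀ i j : Fin 3, i < j → aeval x (qform t i) = 0 → aeval x (qform t j) = 0 → x = 0 := by
    intro i j hij hi hj
    rw [aeval_qform] at hi hj
    simp only [Algebra.algebraMap_self, RingHom.id_apply] at hi hj
    suffices x 1 = 0 ∧ x 0 = 0 by
      ext i; fin_cases i
      · exact this.2
      · exact this.1
    obtain ⟨rfl, rfl⟩ | ⟨rfl, rfl⟩ | ⟨rfl, rfl⟩ : (i = 0 ∧ j = 1) ∨ (i = 0 ∧ j = 2) ∨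
        (i = 1 ∧ j = 2) := by fin_cases i <;> fin_cases j <;> simp_all
    all_goals
      simp [qcoef] at hi hj
      field_simp at hi hj
    -- Each pair has a simple combination: Q₁ - 5Q₀ = v₀v₁, 5(Q₀ - Q₂) = v₀² + 2v₀v₁ + 2v₁², Q₁ -
    -- 5Q₂ = (v₀ + v₁)(v₀ + 2v₁). Comparing its zeros with the other equation produces the factors a
    -- and b, then 4a² + b², then 5a + 5b + c and 20a + 5b + 2c.
    · have e : x 0 * x 1 = 0 := by
        have : t.c * (x 0 * x 1) = 0 := by linear_combination hj - 5 * hi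
        exact (mul_eq_zero.1 this).resolve_left hc
      have e1 : x 1 = 0 := by
        rcases mul_eq_zero.1 e with h | h
        · rw [h] at hi
          have : t.b * x 1 ^ 2 = 0 := by linear_combination -hi
          simpa [hb] using this
        · exact h
      refine ⟨e1, ?_⟩
      rw [e1] at hi
      have : t.a * x 0 ^ 2 = 0 := by linear_combination -hi
      simpa [ha] using this
    · have e : x 0 ^ 2 + 2 * x 0 * x 1 + 2 * x 1 ^ 2 = 0 := by
        have : t.c * (x 0 ^ 2 + 2 * x 0 * x 1 + 2 * x 1 ^ 2) = 0 := by
          linear_combination 5 * hi - hj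
        exact (mul_eq_zero.1 this).resolve_left hc
      have e1 : x 1 = 0 := by
        have : (4 * t.a ^ 2 + t.b ^ 2) * x 1 ^ 4 = 0 := by
          have hi' : t.a * x 0 ^ 2 + t.b * x 1 ^ 2 = 0 := by linear_combination -hi
          have l : 2 * t.a * x 0 * x 1 = (t.b - 2 * t.a) * x 1 ^ 2 := by
            linear_combination t.a * e - hi'
          linear_combination 4 * t.a * x 1 ^ 2 * hi' -
            (2 * t.a * x 0 * x 1 + (t.b - 2 * t.a) * x 1 ^ 2) * l
        simpa [h3] using this
      refine ⟨e1, ?_⟩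
      rw [e1] at e
      simpa using e
    · have e : (x 0 + x 1) * (x 0 + 2 * x 1) = 0 := by
        have : t.c * ((x 0 + x 1) * (x 0 + 2 * x 1)) = 0 := by
          linear_combination hi - hj
        exact (mul_eq_zero.1 this).resolve_left hc
      have e1 : x 1 = 0 := by
        rcases mul_eq_zero.1 e with h | h
        · have h : x 0 = -x 1 := by linear_combination h
          rw [h] at hi
          have : (5 * t.a + 5 * t.b + t.c) * x 1 ^ 2 = 0 := by linear_combination -hi
          simpa [h1] using this
        · have h : x 0 = -2 * x 1 := by linear_combination h
          rw [h] at hi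
          have : (20 * t.a + 5 * t.b + 2 * t.c) * x 1 ^ 2 = 0 := by linear_combination -hi
          simpa [h2] using this
      refine ⟨e1, ?_⟩
      rw [e1] at e
      simpa using e
  rcases lt_or_gt_of_ne hij with h | h
  · exact key i j h hi hj
  · exact key j i h hj hi

/-- Binary forms as forms on `ℙ⁴`. -/
def bin : MvPolynomial (Fin 2) Qbar →ₐ[Qbar] Poly := rename (Fin.castLE (by norm_num))

lemma aeval_bin {S : Type*} [CommRing S] [Algebra Qbar S] (x : Fin 5 → S)
    (A : MvPolynomial (Fin 2) Qbar) :
    aeval x (bin A) = aeval (fun i => x (Fin.castLE (by norm_num) i)) A := by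
  rw [bin, aeval_rename]; rfl

lemma isHomogeneous_bin {A : MvPolynomial (Fin 2) Qbar} {n : ℕ} (hA : A.IsHomogeneous n) :
    (bin A).IsHomogeneous n := hA.rename_isHomogeneous

/-- The relation `y_j² - Q_j`. -/
def rel (t : Triple) (j : Fin 3) : Poly := X j.succ.succ ^ 2 - bin (qform t j)

lemma isHomogeneous_rel (t : Triple) (j : Fin 3) : (rel t j).IsHomogeneous 2 :=
  (isHomogeneous_X_pow _ _).sub (isHomogeneous_bin (isHomogeneous_qform t j))

/-- The two triples of quadrics differ by a linear change that is invertible because c and 5 are. -/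
lemma idealB_eq (t : Triple) : idealB t = Ideal.span (Set.range (rel t)) := by
  have hc := t.ne_zero.2.2.1
  have hC : (C (t.c : Qbar) : Poly) * C ((t.c : Qbar)⁻¹) = 1 := by
    rw [← C_mul, mul_inv_cancel₀ hc, C_1]
  have h5 : (5 : Poly) * C ((5 : Qbar)⁻¹) = 1 := by
    have : (5 : Poly) = C 5 := (map_ofNat C 5).symm
    rw [this, ← C_mul, mul_inv_cancel₀ (by norm_num), C_1]
  have r0 : rel t 0 = X 2 ^ 2 + C (t.c : Qbar)⁻¹ * (C (t.a : Qbar) * X 0 ^ 2 +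
      C (t.b : Qbar) * X 1 ^ 2) := by
    simp [rel, qform, bin, qcoef, div_eq_mul_inv]; ring
  have c5 : (C 5 : Poly) = 5 := map_ofNat C 5
  have c2 : (C 2 : Poly) = 2 := map_ofNat C 2
  have r1 : rel t 1 = X 3 ^ 2 - X 0 * X 1 + 5 * C (t.c : Qbar)⁻¹ * (C (t.a : Qbar) * X 0 ^ 2 +
      C (t.b : Qbar) * X 1 ^ 2) := by
    simp [rel, qform, bin, qcoef, div_eq_mul_inv, c5]; ring
  have r2 : rel t 2 = X 4 ^ 2 + C (t.c : Qbar)⁻¹ * (C (t.a : Qbar) * X 0 ^ 2 +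
      C (t.b : Qbar) * X 1 ^ 2) + C ((5 : Qbar)⁻¹) * (X 0 ^ 2 + 2 * X 0 * X 1 + 2 * X 1 ^ 2) := by
    simp [rel, qform, bin, qcoef, div_eq_mul_inv, c2]; ring
  have e3 : q3 t = C (t.c : Qbar) * rel t 0 := by
    rw [r0, q3]; linear_combination -(C (t.a : Qbar) * X 0 ^ 2 + C (t.b : Qbar) * X 1 ^ 2) * hC
  have e1 : q1 = 5 * rel t 0 - rel t 1 := by rw [r0, r1, q1]; ring
  have e2 : q2 = 5 * rel t 2 - rel t 1 := by
    rw [r2, r1, q2]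
    linear_combination -(X 0 ^ 2 + 2 * X 0 * X 1 + 2 * X 1 ^ 2) * h5
  apply le_antisymm
  · rw [idealB, Ideal.span_le]
    have h : ∀ j, rel t j ∈ Ideal.span (Set.range (rel t)) := fun j => Ideal.subset_span ⟨j, rfl⟩
    rintro F (rfl | rfl | rfl)
    · rw [e1]; exact sub_mem (Ideal.mul_mem_left _ _ (h _)) (h _)
    · rw [e2]; exact sub_mem (Ideal.mul_mem_left _ _ (h _)) (h _)
    · rw [e3]; exact Ideal.mul_mem_left _ _ (h _)
  · rw [Ideal.span_le]
    have g1 : q1 ∈ idealB t := Ideal.subset_span (by simp)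
    have g2 : q2 ∈ idealB t := Ideal.subset_span (by simp)
    have g3 : q3 t ∈ idealB t := Ideal.subset_span (by simp)
    have i0 : rel t 0 ∈ idealB t := by
      have : rel t 0 = C (t.c : Qbar)⁻¹ * q3 t := by rw [e3]; linear_combination -rel t 0 * hC
      rw [this]; exact Ideal.mul_mem_left _ _ g3
    have i1 : rel t 1 ∈ idealB t := by
      have : rel t 1 = 5 * rel t 0 - q1 := by rw [e1]; ring
      rw [this]; exact sub_mem (Ideal.mul_mem_left _ _ i0) g1
    have i2 : rel t 2 ∈ idealB t := by
      have : rel t 2 = C ((5 : Qbar)⁻¹) * (q2 + rel t 1) := by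
        rw [e2]; linear_combination -rel t 2 * h5
      rw [this]; exact Ideal.mul_mem_left _ _ (add_mem g2 i1)
    rintro _ ⟨j, rfl⟩
    match j with
    | 0 => exact i0
    | 1 => exact i1
    | 2 => exact i2

lemma rel_mem (t : Triple) (j : Fin 3) : rel t j ∈ idealB t := by
  rw [idealB_eq]; exact Ideal.subset_span ⟨j, rfl⟩

/-- The coordinates `γ` satisfy the equations of `B`. -/
def IsSol {S : Type*} [CommRing S] [Algebra Qbar S] (t : Triple) (γ : Fin 5 → S) : Prop :=
  ∀ j : Fin 3, γ j.succ.succ ^ 2 = aeval (fun i => γ (Fin.castLE (by norm_num) i)) (qform t j)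

lemma IsSol.aeval_eq_zero {S : Type*} [CommRing S] [Algebra Qbar S] {t : Triple} {γ : Fin 5 → S}
    (h : IsSol t γ) {F : Poly} (hF : F ∈ idealB t) : aeval γ F = 0 := by
  rw [idealB_eq] at hF
  have hle : Ideal.span (Set.range (rel t)) ≤ RingHom.ker (aeval γ : Poly →ₐ[Qbar] S) := by
    rw [Ideal.span_le]
    rintro _ ⟨j, rfl⟩
    simp [RingHom.mem_ker, rel, aeval_bin, h j]
  exact hle hF

lemma isHomogeneous_idealB (t : Triple) {F : Poly} (hF : F ∈ idealB t) (n : ℕ) :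
    homogeneousComponent n F ∈ idealB t := by
  rw [idealB_eq] at hF ⊢
  let _ := gradedAlgebra (σ := Fin 5) (R := Qbar)
  have := Ideal.homogeneous_span (homogeneousSubmodule (Fin 5) Qbar) (Set.range (rel t)) (by
    rintro _ ⟨j, rfl⟩; exact ⟨2, isHomogeneous_rel t j⟩)
  exact (mem_iff_homogeneousComponent_mem this F).1 hF n

/-! ### Splitting of binary forms -/

/-- The linear form with zero `(r₀ : r₁)`. -/
def lin (r : Fin 2 → Qbar) : MvPolynomial (Fin 2) Qbar := C (r 1) * X 0 - C (r 0) * X 1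

lemma isHomogeneous_lin (r : Fin 2 → Qbar) : (lin r).IsHomogeneous 1 :=
  ((isHomogeneous_X _ _).C_mul _).sub ((isHomogeneous_X _ _).C_mul _)

/-- Dehomogenise, split off roots over the algebraically closed field, homogenise back; a drop in
degree accounts for zeros at infinity. -/
lemma exists_eq_prod_lin {n : ℕ} {A : MvPolynomial (Fin 2) Qbar} (hA : A.IsHomogeneous n)
    (h0 : A ≠ 0) : ∃ (c : Qbar) (r : Fin n → Fin 2 → Qbar), c ≠ 0 ∧ (∀ i, r i ≠ 0) ∧
      A = C c * ∏ i, lin (r i) := by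
  have key : ∀ (n : ℕ) (p : Polynomial Qbar), p ≠ 0 → p.natDegree ≤ n →
      ∃ (c : Qbar) (r : Fin n → Fin 2 → Qbar), c ≠ 0 ∧ (∀ i, r i ≠ 0) ∧
      p.homogenize n = C c * ∏ i, lin (r i) := by
    intro n
    induction n with
    | zero =>
      intro p hp hn
      rw [Polynomial.eq_C_of_natDegree_le_zero hn] at hp ⊢
      exact ⟨p.coeff 0, Fin.elim0, by simpa using hp, fun i => i.elim0, by simp⟩
    | succ n ih =>
      intro p hp hn
      by_cases hd : p.natDegree ≤ n
      · obtain ⟨c, r, hc, hr, h⟩ := ih p hp hd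
        -- `lin ![-1, 0]` is `X 1`, the factor vanishing at infinity.
        refine ⟨c, Fin.cons ![-1, 0] r, hc, Fin.cases (by simp) fun i => hr i, ?_⟩
        have := Polynomial.homogenize_mul 1 p (m := 1) (n := n) (by simp) hd
        rw [one_mul, add_comm, h] at this
        rw [this, Fin.prod_univ_succ]
        simp [lin]; ring
      · obtain ⟨ρ, hρ⟩ := IsAlgClosed.exists_root p (by
          intro h; apply hd; exact (Polynomial.natDegree_eq_of_degree_eq_some h).trans_le n.zero_le)
        obtain ⟨p', rfl⟩ := Polynomial.dvd_iff_isRoot.2 hρ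
        have hp' : p' ≠ 0 := right_ne_zero_of_mul hp
        have hd' : p'.natDegree ≤ n := by
          rw [Polynomial.natDegree_mul (Polynomial.X_sub_C_ne_zero ρ) hp',
            Polynomial.natDegree_X_sub_C] at hn
          omega
        obtain ⟨c, r, hc, hr, h⟩ := ih p' hp' hd'
        refine ⟨c, Fin.cons ![ρ, 1] r, hc, Fin.cases (by simp) fun i => hr i, ?_⟩
        have := Polynomial.homogenize_mul (Polynomial.X - Polynomial.C ρ) p' (m := 1) (n := n)
          (by simp) hd'
        rw [add_comm, h] at this
        rw [this, Fin.prod_univ_succ]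
        simp [lin]; ring
  have hp := Polynomial.homogenize_eq_of_isHomogeneous hA rfl
  rw [← hp]
  refine key n _ (fun h => h0 ?_) ?_
  · rw [← hp, h, Polynomial.homogenize_zero]
  · have := MvPolynomial.aeval_natDegree_le A hA.totalDegree_le ![Polynomial.X, 1] (n := 1)
      (by intro i; fin_cases i <;> simp)
    simpa using this

/-! ### Sign changes of the last three coordinates -/

/-- The group of sign changes of the last three coordinates. -/
abbrev Signs : Type := Fin 3 → ℤˣ

/-- The factor by which a sign change multiplies a coordinate. -/
def eps (s : Signs) (i : Fin 5) : Qbar := (((Fin.cons 1 (Fin.cons 1 s) : Fin 5 → ℤˣ) i : ℤ) : Qbar)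

lemma eps_castLE (s : Signs) (i : Fin 2) : eps s (Fin.castLE (by norm_num) i) = 1 := by
  refine Fin.cases ?_ (Fin.cases ?_ fun j => j.elim0) i
  · simp [eps]
  · change eps s (Fin.succ 0) = 1
    simp [eps]

lemma eps_succ (s : Signs) (j : Fin 3) : eps s j.succ.succ = ((s j : ℤ) : Qbar) := by
  simp [eps]

lemma eps_mul (s s' : Signs) (i : Fin 5) : eps (s * s') i = eps s i * eps s' i := by
  refine Fin.cases ?_ (Fin.cases ?_ fun j => ?_) i
  · simp [eps]
  · simp [eps]
  · simp [eps]

lemma eps_one (i : Fin 5) : eps 1 i = 1 := by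
  refine Fin.cases ?_ (Fin.cases ?_ fun j => ?_) i
  · simp [eps]
  · simp [eps]
  · simp [eps]

lemma signs_mul_self (s : Signs) : s * s = 1 := by
  ext j; simp

lemma eps_mul_self (s : Signs) (i : Fin 5) : eps s i * eps s i = 1 := by
  rw [← eps_mul, signs_mul_self, eps_one]

/-- The action of a sign change on polynomials. -/
def flipPoly (s : Signs) : Poly →ₐ[Qbar] Poly := aeval fun i => C (eps s i) * X i

lemma flipPoly_X (s : Signs) (i : Fin 5) : flipPoly s (X i) = C (eps s i) * X i := by
  simp [flipPoly]

lemma flipPoly_mul (s s' : Signs) (F : Poly) :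
    flipPoly (s * s') F = flipPoly s (flipPoly s' F) := by
  have : flipPoly (s * s') = (flipPoly s).comp (flipPoly s') := by
    ext i
    rw [AlgHom.comp_apply, flipPoly_X, flipPoly_X, map_mul, flipPoly_X, algHom_C, algebraMap_eq, eps_mul, C_mul]
    ring_nf
  rw [this]; rfl

lemma flipPoly_one (F : Poly) : flipPoly 1 F = F := by
  have : flipPoly 1 = AlgHom.id Qbar Poly := by
    ext i
    simp [flipPoly_X, eps_one]
  rw [this]; rfl

lemma flipPoly_flipPoly (s : Signs) (F : Poly) : flipPoly s (flipPoly s F) = F := by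
  rw [← flipPoly_mul, signs_mul_self, flipPoly_one]

lemma flipPoly_bin (s : Signs) (A : MvPolynomial (Fin 2) Qbar) : flipPoly s (bin A) = bin A := by
  rw [flipPoly, aeval_bin, bin]
  simp_rw [eps_castLE, C_1, one_mul]
  exact ((aeval_X_left_apply _).symm.trans (aeval_rename _ _ _)).symm

lemma flipPoly_rel (s : Signs) (t : Triple) (j : Fin 3) : flipPoly s (rel t j) = rel t j := by
  rw [rel, map_sub, flipPoly_bin, map_pow, flipPoly_X, mul_pow, ← C_pow, pow_two (eps _ _),
    eps_mul_self, C_1, one_mul]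

lemma flipPoly_mem (s : Signs) {t : Triple} {F : Poly} (hF : F ∈ idealB t) :
    flipPoly s F ∈ idealB t := by
  rw [idealB_eq] at hF ⊢
  have : Ideal.span (Set.range (rel t)) ≤
      (Ideal.span (Set.range (rel t))).comap (flipPoly s) := by
    rw [Ideal.span_le]
    rintro _ ⟨j, rfl⟩
    simp only [Ideal.coe_comap, Set.mem_preimage, SetLike.mem_coe, flipPoly_rel]
    exact Ideal.subset_span ⟨j, rfl⟩
  exact this hF

lemma flipPoly_mem_iff (s : Signs) {t : Triple} {F : Poly} :
    flipPoly s F ∈ idealB t ↔ F ∈ idealB t :=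
  ⟨fun h => by simpa [flipPoly_flipPoly] using flipPoly_mem s h, flipPoly_mem s⟩

lemma isHomogeneous_flipPoly (s : Signs) {F : Poly} {n : ℕ} (hF : F.IsHomogeneous n) :
    (flipPoly s F).IsHomogeneous n := by
  have := hF.aeval (fun i => C (eps s i) * X i) (n := 1) fun i => (isHomogeneous_X _ _).C_mul _
  rwa [one_mul] at this

lemma aeval_flipPoly {S : Type*} [CommRing S] [Algebra Qbar S] (γ : Fin 5 → S) (s : Signs)
    (F : Poly) : aeval γ (flipPoly s F) = aeval (fun i => eps s i • γ i) F := by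
  have : (aeval γ).comp (flipPoly s) = aeval (fun i => eps s i • γ i) := by
    ext i
    simp [flipPoly_X, Algebra.smul_def]
  exact DFunLike.congr_fun this F

lemma aeval_eq_eval_apply {σ k : Type*} [CommRing k] (x : σ → k) (F : MvPolynomial σ k) :
    aeval x F = eval x F := by
  rw [← coe_aeval_eq_eval]; rfl

lemma eval_flipPoly (x : Fin 5 → Qbar) (s : Signs) (F : Poly) :
    eval x (flipPoly s F) = eval (fun i => eps s i * x i) F := by
  simpa only [aeval_eq_eval_apply, smul_eq_mul] using aeval_flipPoly x s F

/-! ### Reduction modulo the equations -/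

/-- The monomial `v₂^e₀ w₀^e₁ w₁^e₂`. -/
def ymon (e : Fin 3 → Fin 2) : Poly := ∏ j, X j.succ.succ ^ (e j : ℕ)

/-- Every form is, modulo the equations of `B`, a combination of the eight square-free monomials in
the last three coordinates, with binary forms as coefficients. -/
lemma exists_reduction (t : Triple) {F : Poly} {d : ℕ} (hF : F.IsHomogeneous d) :
    ∃ A : (Fin 3 → Fin 2) → MvPolynomial (Fin 2) Qbar,
      (∀ e, (A e).IsHomogeneous (d - ∑ j, (e j : ℕ))) ∧
      F - ∑ e, bin (A e) * ymon e ∈ idealB t := by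
  classical
  rw [F.as_sum]
  refine Finset.sum_induction (M := Poly) _ (fun F =>
    ∃ A : (Fin 3 → Fin 2) → MvPolynomial (Fin 2) Qbar,
      (∀ e, (A e).IsHomogeneous (d - ∑ j, (e j : ℕ))) ∧
      F - ∑ e, bin (A e) * ymon e ∈ idealB t) ?_ ?_ ?_
  · rintro F G ⟨A, hA, hA'⟩ ⟨B, hB, hB'⟩
    refine ⟨A + B, fun e => (hA e).add (hB e), ?_⟩
    have := add_mem hA' hB'
    simp only [Pi.add_apply, map_add, add_mul, Finset.sum_add_distrib]
    convert this using 1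
    ring
  · exact ⟨0, fun e => isHomogeneous_zero _ _ _, by simp⟩
  · intro m hm
    have hdeg : m 0 + (m 1 + ∑ j : Fin 3, m j.succ.succ) = d := by
      have : m.weight 1 = d := hF (by simpa using hm)
      rw [← this]
      simp [Finsupp.weight_apply, Finsupp.sum_fintype, Fin.sum_univ_succ]
    let e₀ : Fin 3 → Fin 2 := fun j => ⟨m j.succ.succ % 2, Nat.mod_lt _ (by norm_num)⟩
    have hsum : ∑ j : Fin 3, m j.succ.succ =
        ∑ j : Fin 3, 2 * (m j.succ.succ / 2) + ∑ j, (e₀ j : ℕ) := by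
      rw [← Finset.sum_add_distrib]
      exact Finset.sum_congr rfl fun j _ => (Nat.div_add_mod _ _).symm
    let A₀ : MvPolynomial (Fin 2) Qbar := C (coeff m F) * (X 0 ^ m 0 * (X 1 ^ m 1 *
      ∏ j : Fin 3, qform t j ^ (m j.succ.succ / 2)))
    have hA₀ : A₀.IsHomogeneous (d - ∑ j, (e₀ j : ℕ)) := by
      -- For the exponent e₀ of an occurring monomial the truncated subtraction is exact; all other
      -- coefficients are zero.
      have e1 : d - ∑ j, (e₀ j : ℕ) = m 0 + (m 1 + ∑ j : Fin 3, 2 * (m j.succ.succ / 2)) := by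
        omega
      rw [e1]
      refine IsHomogeneous.C_mul ?_ _
      exact (isHomogeneous_X_pow _ _).mul ((isHomogeneous_X_pow _ _).mul
        (IsHomogeneous.prod _ _ _ fun j _ => (isHomogeneous_qform t j).pow _))
    refine ⟨Pi.single e₀ A₀, fun e => ?_, ?_⟩
    · by_cases h : e = e₀
      · subst h; simpa using hA₀
      · simpa [h] using isHomogeneous_zero _ _ _
    · rw [Finset.sum_eq_single e₀ (fun e _ h => by simp [h]) (by simp), Pi.single_eq_same,
        ← Ideal.Quotient.eq, monomial_eq, Finsupp.prod_fintype _ _ (by simp)]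
      have hrel : ∀ j : Fin 3, Ideal.Quotient.mk (idealB t) (X j.succ.succ) ^ 2 =
          Ideal.Quotient.mk (idealB t) (bin (qform t j)) := fun j => by
        rw [← map_pow, Ideal.Quotient.eq]; exact rel_mem t j
      have hy : ∀ j : Fin 3, Ideal.Quotient.mk (idealB t) (X j.succ.succ) ^ m j.succ.succ =
          Ideal.Quotient.mk (idealB t) (bin (qform t j)) ^ (m j.succ.succ / 2) *
            Ideal.Quotient.mk (idealB t) (X j.succ.succ) ^ (e₀ j : ℕ) := fun j => by
        rw [← hrel, ← pow_mul, ← pow_add, Nat.div_add_mod]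
      have b0 : bin (X 0) = X 0 := by simp [bin]
      have b1 : bin (X 1) = X 1 := by simp [bin]
      rw [Fin.prod_univ_succ, Fin.prod_univ_succ]
      simp only [A₀, ymon, map_mul, map_prod, map_pow, hy, Finset.prod_mul_distrib, b0, b1,
        algHom_C]
      simp only [Fin.succ_zero_eq_one, MvPolynomial.algebraMap_eq]
      ring

/-! ### Points of `B` -/

lemma aeval_mul_of_isHomogeneous {σ k S : Type*} [CommRing k] [CommRing S] [Algebra k S] (z : S)
    (g : σ → S) {F : MvPolynomial σ k} {d : ℕ} (hF : F.IsHomogeneous d) :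
    aeval (fun i => z * g i) F = z ^ d * aeval g F := by
  conv_lhs => rw [F.as_sum]
  conv_rhs => rw [F.as_sum]
  rw [map_sum, map_sum, Finset.mul_sum]
  refine Finset.sum_congr rfl fun m hm => ?_
  have : m.weight 1 = d := hF (by simpa using hm)
  rw [aeval_monomial, aeval_monomial, Finsupp.prod, Finsupp.prod]
  simp_rw [mul_pow]
  rw [Finset.prod_mul_distrib, Finset.prod_pow_eq_pow_sum]
  have e : ∑ i ∈ m.support, m i = d := by
    rw [← this]; simp [Finsupp.weight_apply, Finsupp.sum]
  rw [e]; ring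

lemma eval_smul_of_isHomogeneous {F : Poly} {d : ℕ} (hF : F.IsHomogeneous d) (r : Qbar)
    (x : Fin 5 → Qbar) : eval (r • x) F = r ^ d * eval x F := by
  simpa only [aeval_eq_eval_apply] using! aeval_mul_of_isHomogeneous r x hF

lemma Vanishes.eval_rep {F : Poly} {P : P4} (h : Vanishes F P) : eval P.rep F = 0 :=
  h _ (by rw [Projectivization.submodule_eq]; exact Submodule.mem_span_singleton_self _)

lemma vanishes_iff {F : Poly} {d : ℕ} (hF : F.IsHomogeneous d) {P : P4} :
    Vanishes F P ↔ eval P.rep F = 0 := by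
  refine ⟨Vanishes.eval_rep, fun h x hx => ?_⟩
  rw [Projectivization.submodule_eq, Submodule.mem_span_singleton] at hx
  obtain ⟨r, rfl⟩ := hx
  rw [eval_smul_of_isHomogeneous hF, h, mul_zero]

lemma isSol_iff {t : Triple} {x : Fin 5 → Qbar} :
    IsSol t x ↔ eval x q1 = 0 ∧ eval x q2 = 0 ∧ eval x (q3 t) = 0 := by
  constructor
  · intro h
    simp only [← aeval_eq_eval_apply]
    exact ⟨h.aeval_eq_zero (Ideal.subset_span (by simp)),
      h.aeval_eq_zero (Ideal.subset_span (by simp)), h.aeval_eq_zero (Ideal.subset_span (by simp))⟩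
  · rintro ⟨h1, h2, h3⟩ j
    have hle : idealB t ≤ RingHom.ker (eval x) := by
      rw [idealB, Ideal.span_le]
      rintro F (rfl | rfl | rfl)
      · exact h1
      · exact h2
      · exact h3
    have := hle (rel_mem t j)
    rw [RingHom.mem_ker, ← aeval_eq_eval_apply, rel, map_sub, aeval_bin, sub_eq_zero, map_pow,
      aeval_X] at this
    exact this

/-- The representative of a point of `B`. -/
def PtB.rep {t : Triple} (P : PtB t) : Fin 5 → Qbar := P.1.rep

lemma PtB.rep_ne_zero {t : Triple} (P : PtB t) : P.rep ≠ 0 := Projectivization.rep_nonzero _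

lemma PtB.isSol {t : Triple} (P : PtB t) : IsSol t P.rep :=
  isSol_iff.2 ⟨P.2.1.eval_rep, P.2.2.1.eval_rep, P.2.2.2.eval_rep⟩

lemma IsSol.smul {t : Triple} {x : Fin 5 → Qbar} (h : IsSol t x) (r : Qbar) : IsSol t (r • x) := by
  intro j
  have := aeval_mul_of_isHomogeneous r (fun i => x (Fin.castLE (by norm_num) i))
    (isHomogeneous_qform t j)
  simp only [Pi.smul_apply, smul_eq_mul]
  rw [this, mul_pow, h j]

/-- The point of `B` with given coordinates. -/
def mkPt {t : Triple} (x : Fin 5 → Qbar) (hx : x ≠ 0) (h : IsSol t x) : PtB t :=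
  ⟨Projectivization.mk Qbar x hx, by
    simp only [vanishes_mk]
    have := fun r => isSol_iff.1 (h.smul r)
    exact ⟨fun r => (this r).1, fun r => (this r).2.1, fun r => (this r).2.2⟩⟩

lemma mkPt_rep {t : Triple} (x : Fin 5 → Qbar) (hx : x ≠ 0) (h : IsSol t x) :
    ∃ r : Qbar, r ≠ 0 ∧ (mkPt x hx h).rep = r • x := by
  obtain ⟨a, ha⟩ := Projectivization.exists_smul_eq_mk_rep Qbar x hx
  exact ⟨a, a.ne_zero, ha.symm⟩

lemma mk_rep {t : Triple} (P : PtB t) : mkPt P.rep P.rep_ne_zero P.isSol = P :=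
  Subtype.ext (Projectivization.mk_rep _)

lemma mkPt_eq_mkPt_iff {t : Triple} {x x' : Fin 5 → Qbar} {hx : x ≠ 0} {hx' : x' ≠ 0}
    {h : IsSol t x} {h' : IsSol t x'} :
    mkPt x hx h = mkPt x' hx' h' ↔ ∃ r : Qbar, r • x' = x := by
  rw [← Projectivization.mk_eq_mk_iff' Qbar _ _ hx hx']
  exact Subtype.ext_iff

lemma mkPt_eq_of_smul {t : Triple} {x : Fin 5 → Qbar} {hx : x ≠ 0} {h : IsSol t x} {P : PtB t}
    {r : Qbar} (hr : r • P.rep = x) : mkPt x hx h = P := by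
  rw [← mk_rep P, mkPt_eq_mkPt_iff]; exact ⟨r, hr⟩

/-- The image of a point under the projection to the line with coordinates `v₀, v₁`. -/
def PtB.base {t : Triple} (P : PtB t) : Fin 2 → Qbar := fun i => P.rep (Fin.castLE (by norm_num) i)

lemma PtB.sq_rep {t : Triple} (P : PtB t) (j : Fin 3) :
    P.rep j.succ.succ ^ 2 = aeval P.base (qform t j) := P.isSol j

lemma PtB.base_ne_zero {t : Triple} (P : PtB t) : P.base ≠ 0 := by
  intro h
  apply P.rep_ne_zero
  ext i
  refine Fin.cases (congrFun h 0) (Fin.cases (congrFun h 1) fun j => ?_) i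
  have := P.sq_rep j
  rw [h, aeval_qform] at this
  simpa using this

lemma exists_isSol (t : Triple) (r : Fin 2 → Qbar) : ∃ x : Fin 5 → Qbar, IsSol t x ∧
    (fun i => x (Fin.castLE (by norm_num) i)) = r := by
  choose y hy using fun j => IsAlgClosed.exists_pow_nat_eq (aeval r (qform t j)) zero_lt_two
  have : (fun i => (Fin.cons (r 0) (Fin.cons (r 1) y) : Fin 5 → Qbar)
      (Fin.castLE (by norm_num) i)) = r := by
    ext i
    exact Fin.cases rfl (Fin.cases rfl fun j => j.elim0) i
  refine ⟨Fin.cons (r 0) (Fin.cons (r 1) y), fun j => ?_, this⟩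
  rw [this, ← hy]
  simp

lemma exists_pt_base (t : Triple) {r : Fin 2 → Qbar} (hr : r ≠ 0) :
    ∃ (P : PtB t) (c : Qbar), c ≠ 0 ∧ P.base = c • r := by
  obtain ⟨x, hx, rfl⟩ := exists_isSol t r
  have hx0 : x ≠ 0 := by rintro rfl; exact hr rfl
  obtain ⟨c, hc, h⟩ := mkPt_rep x hx0 hx
  exact ⟨mkPt x hx0 hx, c, hc, by ext i; simp [PtB.base, h]⟩

lemma qform_ne_zero (t : Triple) (j : Fin 3) : qform t j ≠ 0 := by
  intro h
  have hd := qcoef_disc_ne_zero t j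
  have e : ∀ x : Fin 2 → Qbar, _ := fun x => (aeval_qform t j x).symm.trans (by rw [h, map_zero])
  have e0 := e ![1, 0]
  have e1 := e ![0, 1]
  have e2 := e ![1, 1]
  simp at e0 e1 e2
  simp [e0, e1] at e2 hd
  exact hd e2

/-- A point above a zero of Q_j. The ramification there is what later forces `B` to be irreducible.
-/
lemma exists_pt_eq_zero (t : Triple) (j : Fin 3) : ∃ P : PtB t, P.rep j.succ.succ = 0 := by
  obtain ⟨c, r, -, hr, h⟩ := exists_eq_prod_lin (isHomogeneous_qform t j) (qform_ne_zero t j)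
  obtain ⟨P, a, -, hP⟩ := exists_pt_base t (hr 0)
  refine ⟨P, ?_⟩
  have := P.sq_rep j
  rw [h, map_mul, map_prod, Fin.prod_univ_succ, hP] at this
  have e : aeval (a • r 0) (lin (r 0)) = 0 := by simp [lin]; ring
  rw [e] at this
  simpa using this

/-! ### Sign changes on points -/

lemma IsSol.eps {S : Type*} [CommRing S] [Algebra Qbar S] {t : Triple} {γ : Fin 5 → S}
    (h : IsSol t γ) (s : Signs) : IsSol t fun i => eps s i • γ i := by
  intro j
  simp only [eps_castLE, one_smul, smul_pow]
  rw [pow_two (EnriquesBranch.eps _ _), eps_mul_self, one_smul, h j]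

/-- The action of a sign change on coordinates. -/
def flipLin (s : Signs) : (Fin 5 → Qbar) →ₗ[Qbar] (Fin 5 → Qbar) where
  toFun x i := eps s i * x i
  map_add' x y := by ext i; simp [mul_add]
  map_smul' r x := by ext i; simp; ring

lemma flipLin_mul (s s' : Signs) (x : Fin 5 → Qbar) :
    flipLin (s * s') x = flipLin s (flipLin s' x) := by
  ext i; simp [flipLin, eps_mul, mul_assoc]

lemma flipLin_one (x : Fin 5 → Qbar) : flipLin 1 x = x := by
  ext i; simp [flipLin, eps_one]

lemma flipLin_injective (s : Signs) : Function.Injective (flipLin s) :=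
  Function.LeftInverse.injective (g := flipLin s) fun x => by
    rw [← flipLin_mul, signs_mul_self, flipLin_one]

/-- The action of a sign change on the points of `ℙ⁴`. -/
def flipP4 (s : Signs) : P4 → P4 := Projectivization.map (flipLin s) (flipLin_injective s)

lemma flipP4_mul (s s' : Signs) (P : P4) : flipP4 (s * s') P = flipP4 s (flipP4 s' P) := by
  induction P using Projectivization.ind with
  | h v hv => simp only [flipP4, Projectivization.map_mk, flipLin_mul]

lemma flipP4_one (P : P4) : flipP4 1 P = P := by
  induction P using Projectivization.ind with
  | h v hv => simp only [flipP4, Projectivization.map_mk, flipLin_one]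

lemma vanishes_flip (s : Signs) {F : Poly} {P : P4} (h : Vanishes F P) :
    Vanishes (flipPoly s F) (flipP4 s P) := by
  induction P using Projectivization.ind with
  | h v hv =>
    rw [flipP4, Projectivization.map_mk, vanishes_mk]
    rw [vanishes_mk] at h
    intro r
    have e : (fun i => eps s i * (r • flipLin s v) i) = r • v := by
      ext i
      have := eps_mul_self s i
      simp only [flipLin, Pi.smul_apply, LinearMap.coe_mk, AddHom.coe_mk, smul_eq_mul]
      linear_combination r * v i * this
    rw [eval_flipPoly, e, h]

lemma flipPoly_mem_span (s : Signs) (t : Triple) :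
    flipPoly s q1 = q1 ∧ flipPoly s q2 = q2 ∧ flipPoly s (q3 t) = q3 t := by
  have h2 := pow_two (eps s 2) ▸ eps_mul_self s 2
  have h3 := pow_two (eps s 3) ▸ eps_mul_self s 3
  have h4 := pow_two (eps s 4) ▸ eps_mul_self s 4
  have h0 : eps s 0 = 1 := eps_castLE s 0
  have h1 : eps s 1 = 1 := eps_castLE s 1
  have e5 : flipPoly s 5 = 5 := map_ofNat _ 5
  have e2 : flipPoly s 2 = 2 := map_ofNat _ 2
  refine ⟨?_, ?_, ?_⟩
  · simp only [q1, map_sub, map_add, map_mul, map_pow, flipPoly_X, h0, h1, mul_pow, ← C_pow, h2, h3,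
      e5, C_1, one_mul]
  · simp only [q2, map_sub, map_add, map_mul, map_pow, flipPoly_X, h0, h1, mul_pow, ← C_pow, h3, h4,
      e5, e2, C_1, one_mul]
  · simp only [q3, map_add, map_mul, map_pow, flipPoly_X, h0, h1, mul_pow, ← C_pow, h2,
      C_1, one_mul, algHom_C, algebraMap_eq]

instance (t : Triple) : MulAction Signs (PtB t) where
  smul s P := ⟨flipP4 s P.1, by
    obtain ⟨h1, h2, h3⟩ := P.2
    obtain ⟨e1, e2, e3⟩ := flipPoly_mem_span s t
    have h1 := vanishes_flip s h1
    have h2 := vanishes_flip s h2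
    have h3 := vanishes_flip s h3
    rw [e1] at h1
    rw [e2] at h2
    rw [e3] at h3
    exact ⟨h1, h2, h3⟩⟩
  one_smul P := Subtype.ext (flipP4_one P.1)
  mul_smul s s' P := Subtype.ext (flipP4_mul s s' P.1)

lemma flip_val {t : Triple} (s : Signs) (P : PtB t) : (s • P).1 = flipP4 s P.1 := rfl

lemma flip_mkPt {t : Triple} (s : Signs) {x : Fin 5 → Qbar} (hx : x ≠ 0) (h : IsSol t x)
    (hx' : (fun i => eps s i * x i) ≠ 0) :
    s • mkPt x hx h = mkPt (fun i => eps s i * x i) hx' (h.eps s) := rfl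

lemma flip_rep {t : Triple} (s : Signs) (P : PtB t) :
    ∃ r : Qbar, r ≠ 0 ∧ ∀ i, (s • P).rep i = r * (eps s i * P.rep i) := by
  have hx : (fun i => eps s i * P.rep i) ≠ 0 := fun h =>
    P.rep_ne_zero (flipLin_injective s (h.trans (map_zero _).symm))
  obtain ⟨r, hr, h⟩ := mkPt_rep _ hx (P.isSol.eps s)
  rw [← flip_mkPt s P.rep_ne_zero P.isSol, mk_rep] at h
  exact ⟨r, hr, fun i => congrFun h i⟩

/-- The sign change which is the involution `σ` of `B`. -/
def sigmaSign : Signs := ![1, -1, -1]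

lemma sgn_eq (i : Fin 5) : sgn i = -1 * eps sigmaSign i := by
  refine Fin.cases ?_ (Fin.cases ?_ fun j => ?_) i
  · simp [sgn, eps]
  · simp [sgn, eps]
  · rw [eps_succ]
    fin_cases j <;> simp [sgn, sigmaSign]

lemma sigma_eq {t : Triple} (P : PtB t) : sigma t P = sigmaSign • P := by
  apply Subtype.ext
  change sigmaP4 P.1 = flipP4 sigmaSign P.1
  obtain ⟨P, -⟩ := P
  induction P using Projectivization.ind with
  | h v hv =>
    simp only [sigmaP4, flipP4, Projectivization.map_mk]
    rw [Projectivization.mk_eq_mk_iff']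
    refine ⟨-1, ?_⟩
    ext i
    simp [sigmaLin, flipLin, sgn_eq]

lemma sigmaPoly_eq {F : Poly} {d : ℕ} (hF : F.IsHomogeneous d) :
    sigmaPoly F = (-1) ^ d * flipPoly sigmaSign F := by
  rw [sigmaPoly, flipPoly, ← aeval_mul_of_isHomogeneous _ _ hF]
  congr 2
  ext1 i
  rw [sgn_eq, C_mul]
  simp

lemma vanishesToOrder_flip (s : Signs) {t : Triple} {P : PtB t} {n : ℕ} {F : Poly}
    (h : VanishesToOrder t P n F) : VanishesToOrder t (s • P) n (flipPoly s F) := by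
  obtain ⟨e, H, hH, hP, hmem⟩ := h
  refine ⟨e, flipPoly s H, isHomogeneous_flipPoly s hH, fun h => hP ?_, ?_⟩
  · have := vanishes_flip s h
    rwa [flipPoly_flipPoly, flip_val, ← flipP4_mul, signs_mul_self, flipP4_one] at this
  · have h1 : flipPoly s (H * F) ∈ Ideal.map (flipPoly s : Poly →+* Poly) _ :=
      Ideal.mem_map_of_mem _ hmem
    rw [map_mul, Ideal.map_sup, Ideal.map_pow] at h1
    have hle : (idealPt P.1).map (flipPoly s : Poly →+* Poly) ^ n ⊔
        (idealB t).map (flipPoly s : Poly →+* Poly) ≤ idealPt (s • P).1 ^ n ⊔ idealB t := by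
      refine sup_le_sup (Ideal.pow_right_mono ?_ n) ?_
      · rw [idealPt, Ideal.map_span]
        refine Ideal.span_le.2 ?_
        rintro _ ⟨F, hF, rfl⟩
        exact Ideal.subset_span (vanishes_flip s hF)
      · exact Ideal.map_le_iff_le_comap.2 fun _ => flipPoly_mem s
    exact hle h1

lemma hasOrder_flip (s : Signs) {t : Triple} {P : PtB t} {n : ℕ} {F : Poly}
    (h : HasOrder t P F n) : HasOrder t (s • P) (flipPoly s F) n := by
  refine ⟨vanishesToOrder_flip s h.1, fun m hm => h.2 ?_⟩
  have := vanishesToOrder_flip s hm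
  rwa [flipPoly_flipPoly, ← mul_smul, signs_mul_self, one_smul] at this

/-! ### Branches -/

open PowerSeries (evalNegHom)

lemma constantCoeff_evalNegHom {k : Type*} [CommRing k] (u : PowerSeries k) :
    PowerSeries.constantCoeff (evalNegHom u) = PowerSeries.constantCoeff u := by
  rw [← PowerSeries.coeff_zero_eq_constantCoeff_apply, evalNegHom, PowerSeries.coeff_rescale]
  simp

lemma evalNegHom_C {k : Type*} [CommRing k] (a : k) :
    evalNegHom (PowerSeries.C a) = PowerSeries.C a := by
  ext n
  rw [evalNegHom, PowerSeries.coeff_rescale, PowerSeries.coeff_C]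
  split_ifs with h <;> simp [h]

/-- A square root of an even power series with nonzero constant coefficient is even. -/
lemma evalNegHom_sqrt {k : Type*} [Field k] [NeZero (2 : k)] {u v : PowerSeries k}
    (h : u ^ 2 = v) (hv : evalNegHom v = v) (hu : PowerSeries.constantCoeff u ≠ 0) : evalNegHom u = u := by
  have h1 : evalNegHom u ^ 2 = u ^ 2 := by rw [← map_pow, h, hv]
  rcases sq_eq_sq_iff_eq_or_eq_neg.1 h1 with h2 | h2
  · exact h2
  · exfalso
    have := congrArg PowerSeries.constantCoeff h2
    rw [constantCoeff_evalNegHom, map_neg] at this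
    have h3 : 2 * PowerSeries.constantCoeff u = 0 := by linear_combination this
    exact hu ((mul_eq_zero.1 h3).resolve_left two_ne_zero)

/-- The ramification index at `P` of the projection to the line with coordinates `v₀, v₁`. -/
def ram {t : Triple} (P : PtB t) : ℕ :=
  open scoped Classical in if ∃ j : Fin 3, P.rep j.succ.succ = 0 then 2 else 1

lemma ram_eq_two {t : Triple} {P : PtB t} {j : Fin 3} (h : P.rep j.succ.succ = 0) : ram P = 2 := by
  rw [ram, if_pos ⟨j, h⟩]

lemma ram_eq_one {t : Triple} {P : PtB t} (h : ∀ j : Fin 3, P.rep j.succ.succ ≠ 0) : ram P = 1 := by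
  rw [ram, if_neg (not_exists.2 h)]

lemma rep_ne_zero_of_ne {t : Triple} {P : PtB t} {i j : Fin 3} (hi : P.rep i.succ.succ = 0)
    (hij : i ≠ j) : P.rep j.succ.succ ≠ 0 := by
  intro hj
  have h1 := P.sq_rep i
  have h2 := P.sq_rep j
  rw [hi, zero_pow two_ne_zero] at h1
  rw [hj, zero_pow two_ne_zero] at h2
  exact P.base_ne_zero (qform_coprime t hij h1.symm h2.symm)

/-- The sign change of a single coordinate. -/
def flipOne (j : Fin 3) : Signs := Pi.mulSingle j (-1)

/-- Every point of `B` is the centre of a parametrized branch, which is even or odd in each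
coordinate if the point is a ramification point of the projection to the line. -/
lemma exists_branch {t : Triple} (P : PtB t) :
    ∃ (γ : Fin 5 → PowerSeries Qbar) (d : Fin 2 → Qbar), IsSol t γ ∧
      (∀ i, PowerSeries.constantCoeff (γ i) = P.rep i) ∧ P.base 0 * d 1 - P.base 1 * d 0 ≠ 0 ∧
      (∀ i : Fin 2, γ (Fin.castLE (by norm_num) i) =
        PowerSeries.C (P.base i) + PowerSeries.C (d i) * PowerSeries.X ^ ram P) ∧
      (∀ j : Fin 3, P.rep j.succ.succ = 0 →
        ∃ u, PowerSeries.constantCoeff u ≠ 0 ∧ γ j.succ.succ = PowerSeries.X * u) ∧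
      (∀ j : Fin 3, P.rep j.succ.succ = 0 → ∀ i, evalNegHom (γ i) = eps (flipOne j) i • γ i) := by
  obtain ⟨d, hd⟩ : ∃ d : Fin 2 → Qbar, P.base 0 * d 1 - P.base 1 * d 0 ≠ 0 := by
    by_cases h0 : P.base 0 = 0
    · refine ⟨![1, 0], fun h => P.base_ne_zero ?_⟩
      ext i; fin_cases i
      · exact h0
      · simpa using h
    · exact ⟨![0, 1], by simpa using h0⟩
  -- Move away from the base point in the independent direction d. At a ramification point the
  -- parameter enters through its square, so the vanishing Q_j becomes X² times a unit and has a
  -- square root.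
  let x : Fin 2 → PowerSeries Qbar := fun i =>
    PowerSeries.C (P.base i) + PowerSeries.C (d i) * PowerSeries.X ^ ram P
  let B : Fin 3 → Qbar := fun j => 2 * qcoef t j 0 * (P.base 0 * d 0) +
    qcoef t j 1 * (P.base 0 * d 1 + P.base 1 * d 0) + 2 * qcoef t j 2 * (P.base 1 * d 1)
  have hx : ∀ j, aeval x (qform t j) = PowerSeries.C (aeval P.base (qform t j)) +
      PowerSeries.X ^ ram P * (PowerSeries.C (B j) +
        PowerSeries.C (aeval d (qform t j)) * PowerSeries.X ^ ram P) := by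
    intro j
    simp only [aeval_qform, x, B, PowerSeries.algebraMap_eq, map_add, map_mul, map_pow, map_ofNat,
      Algebra.algebraMap_self, RingHom.id_apply]
    ring
  have hX2 : evalNegHom (PowerSeries.X ^ 2 : PowerSeries Qbar) = PowerSeries.X ^ 2 := by
    rw [map_pow, PowerSeries.evalNegHom_X, neg_sq]
  have hy : ∀ j : Fin 3, ∃ y : PowerSeries Qbar, y ^ 2 = aeval x (qform t j) ∧
      PowerSeries.constantCoeff y = P.rep j.succ.succ ∧
      (P.rep j.succ.succ = 0 → (∃ u, PowerSeries.constantCoeff u ≠ 0 ∧ y = PowerSeries.X * u) ∧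
        evalNegHom y = -y) ∧
      (P.rep j.succ.succ ≠ 0 → ram P = 2 → evalNegHom y = y) := by
    intro j
    have hsq := P.sq_rep j
    by_cases h0 : P.rep j.succ.succ = 0
    · rw [h0, zero_pow two_ne_zero] at hsq
      have hr := ram_eq_two h0
      have hB : B j ≠ 0 := qform_polar_ne_zero t j hsq.symm hd
      obtain ⟨p, hp⟩ := IsAlgClosed.exists_pow_nat_eq (B j) zero_lt_two
      have hp0 : p ≠ 0 := by rintro rfl; exact hB (by rw [← hp]; simp)
      have hxj := hx j
      rw [hr, ← hsq] at hxj
      set U := PowerSeries.C (B j) + PowerSeries.C (aeval d (qform t j)) * PowerSeries.X ^ 2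
      obtain ⟨u, hu, hu0⟩ := exists_powerSeries_sqrt U hp0 (by simp [U, hp])
      -- U is a series in X², so u is even and X · u is odd: this sign is the one of `flipOne j`.
      have hun : evalNegHom u = u := evalNegHom_sqrt hu
        (by simp [U, evalNegHom_C, hX2]) (by rwa [hu0])
      refine ⟨PowerSeries.X * u, ?_, by simp [h0], fun _ => ⟨⟨u, by rwa [hu0], rfl⟩, ?_⟩,
        fun h => (h h0).elim⟩
      · rw [mul_pow, hu, hxj]; simp
      · rw [map_mul, hun, PowerSeries.evalNegHom_X, neg_mul]
    · obtain ⟨y, hy, hy0⟩ := exists_powerSeries_sqrt (aeval x (qform t j)) h0 (by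
        rw [hx, hsq]
        have : ram P ≠ 0 := by unfold ram; split_ifs <;> norm_num
        simp [this])
      refine ⟨y, hy, hy0, fun h => (h0 h).elim, fun _ hr => ?_⟩
      refine evalNegHom_sqrt hy ?_ (by rwa [hy0])
      rw [hx, hr]
      simp [evalNegHom_C, hX2]
  choose y hy1 hy2 hy3 hy4 using hy
  have hγ : (fun i => (Fin.cons (x 0) (Fin.cons (x 1) y) : Fin 5 → PowerSeries Qbar)
      (Fin.castLE (by norm_num) i)) = x := by
    ext1 i
    exact Fin.cases rfl (Fin.cases rfl fun j => j.elim0) i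
  have hram : ram P ≠ 0 := by unfold ram; split_ifs <;> norm_num
  refine ⟨Fin.cons (x 0) (Fin.cons (x 1) y), d, ?_, ?_, hd, fun i => congrFun hγ i, ?_, ?_⟩
  · intro j
    rw [hγ]
    simpa using hy1 j
  · intro i
    refine Fin.cases ?_ (Fin.cases ?_ fun j => ?_) i
    · simp [x, hram, PtB.base]
    · simp [x, hram, PtB.base]
    · simpa using hy2 j
  · intro j hj
    simpa using (hy3 j hj).1
  · intro j hj i
    have hr := ram_eq_two hj
    have hxe : ∀ i, evalNegHom (x i) = x i := fun i => by simp [x, hr, evalNegHom_C, hX2]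
    refine Fin.cases ?_ (Fin.cases ?_ fun i => ?_) i
    · simp [hxe, eps]
    · simp [hxe, eps]
    · rw [eps_succ]
      by_cases hij : i = j
      · subst hij
        simp [flipOne, (hy3 i hj).2]
      · simp [flipOne, hij, hy4 i (rep_ne_zero_of_ne hj (Ne.symm hij)) hr]

/-- A branch of `B` at `P`. -/
def branch {t : Triple} (P : PtB t) : Fin 5 → PowerSeries Qbar := (exists_branch P).choose

/-- Expansion of polynomials along a branch of `B` at `P`. -/
def phi {t : Triple} (P : PtB t) : Poly →ₐ[Qbar] PowerSeries Qbar := aeval (branch P)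

section
variable {t : Triple} (P : PtB t)

lemma branch_spec : ∃ d : Fin 2 → Qbar, IsSol t (branch P) ∧
    (∀ i, PowerSeries.constantCoeff (branch P i) = P.rep i) ∧
    P.base 0 * d 1 - P.base 1 * d 0 ≠ 0 ∧
    (∀ i : Fin 2, branch P (Fin.castLE (by norm_num) i) =
      PowerSeries.C (P.base i) + PowerSeries.C (d i) * PowerSeries.X ^ ram P) ∧
    (∀ j : Fin 3, P.rep j.succ.succ = 0 →
      ∃ u, PowerSeries.constantCoeff u ≠ 0 ∧ branch P j.succ.succ = PowerSeries.X * u) ∧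
    (∀ j : Fin 3, P.rep j.succ.succ = 0 →
      ∀ i, evalNegHom (branch P i) = eps (flipOne j) i • branch P i) :=
  (exists_branch P).choose_spec

lemma phi_eq_zero_of_mem {F : Poly} (hF : F ∈ idealB t) : phi P F = 0 :=
  (branch_spec P).choose_spec.1.aeval_eq_zero hF

lemma phi_congr {F G : Poly} (h : F - G ∈ idealB t) : phi P F = phi P G := by
  have := phi_eq_zero_of_mem P h
  rwa [map_sub, sub_eq_zero] at this

lemma constantCoeff_phi (F : Poly) : PowerSeries.constantCoeff (phi P F) = eval P.rep F := by
  have h := (branch_spec P).choose_spec.2.1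
  have : (PowerSeries.constantCoeff (R := Qbar)).comp (phi P : Poly →+* PowerSeries Qbar) = eval P.rep := by
    refine MvPolynomial.ringHom_ext (fun r => ?_) fun i => ?_
    · simp [phi, PowerSeries.algebraMap_eq]
    · simpa [phi] using h i
  exact congrArg (fun f => f F) this

lemma phi_lin : ∃ d : Fin 2 → Qbar, P.base 0 * d 1 - P.base 1 * d 0 ≠ 0 ∧
    ∀ r : Fin 2 → Qbar, phi P (bin (lin r)) = PowerSeries.C (r 1 * P.base 0 - r 0 * P.base 1) +
      PowerSeries.C (r 1 * d 0 - r 0 * d 1) * PowerSeries.X ^ ram P := by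
  obtain ⟨d, -, -, hd, h, -, -⟩ := branch_spec P
  refine ⟨d, hd, fun r => ?_⟩
  rw [phi, aeval_bin]
  simp only [lin, map_sub, map_mul, aeval_X, algHom_C, PowerSeries.algebraMap_eq]
  rw [h 0, h 1]
  ring

lemma exists_phi_eq_X_mul {j : Fin 3} (h : P.rep j.succ.succ = 0) :
    ∃ u, PowerSeries.constantCoeff u ≠ 0 ∧ phi P (X j.succ.succ) = PowerSeries.X * u := by
  obtain ⟨u, hu, h'⟩ := (branch_spec P).choose_spec.2.2.2.2.1 j h
  exact ⟨u, hu, by simpa [phi] using h'⟩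

lemma evalNegHom_phi {j : Fin 3} (h : P.rep j.succ.succ = 0) (F : Poly) :
    evalNegHom (phi P F) = phi P (flipPoly (flipOne j) F) := by
  have hγ := (branch_spec P).choose_spec.2.2.2.2.2 j h
  rw [phi, aeval_flipPoly]
  have : (evalNegHom (A := Qbar)).comp ((aeval (branch P) : Poly →ₐ[Qbar] PowerSeries Qbar) :
      Poly →+* PowerSeries Qbar) =
      ((aeval (fun i => eps (flipOne j) i • branch P i) : Poly →ₐ[Qbar] PowerSeries Qbar) :
        Poly →+* PowerSeries Qbar) := by
    refine MvPolynomial.ringHom_ext (fun r => ?_) fun i => ?_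
    · simp [PowerSeries.algebraMap_eq, evalNegHom_C]
    · simpa using hγ i
  exact congrArg (fun f => f F) this

/-- Both coefficients of the expansion vanish only if r is proportional to the base point and to the
direction d, which are independent. -/
lemma phi_lin_ne_zero {r : Fin 2 → Qbar} (hr : r ≠ 0) : phi P (bin (lin r)) ≠ 0 := by
  obtain ⟨d, hd, h⟩ := phi_lin P
  rw [h]
  intro h0
  have hram : ram P ≠ 0 := by unfold ram; split_ifs <;> norm_num
  have e0 := congrArg PowerSeries.constantCoeff h0
  simp [hram] at e0
  rw [e0] at h0
  simp at h0
  have h0 : r 1 * d 0 - r 0 * d 1 = 0 := by simpa [← map_mul, ← map_sub] using h0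
  apply hr
  ext i
  fin_cases i
  · have : r 0 * (P.base 0 * d 1 - P.base 1 * d 0) = 0 := by
      linear_combination d 0 * e0 - P.base 0 * h0
    exact (mul_eq_zero.1 this).resolve_right hd
  · have : r 1 * (P.base 0 * d 1 - P.base 1 * d 0) = 0 := by
      linear_combination d 1 * e0 - P.base 1 * h0
    exact (mul_eq_zero.1 this).resolve_right hd

lemma phi_bin_ne_zero {A : MvPolynomial (Fin 2) Qbar} {n : ℕ} (hA : A.IsHomogeneous n)
    (h0 : A ≠ 0) : phi P (bin A) ≠ 0 := by
  obtain ⟨c, r, hc, hr, rfl⟩ := exists_eq_prod_lin hA h0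
  rw [map_mul, map_mul, map_prod, map_prod]
  refine mul_ne_zero ?_ (Finset.prod_ne_zero_iff.2 fun i _ => phi_lin_ne_zero P (hr i))
  simpa [bin, PowerSeries.algebraMap_eq] using hc

lemma phi_X_ne_zero (j : Fin 3) : phi P (X j.succ.succ) ≠ 0 := by
  intro h
  apply phi_bin_ne_zero P (isHomogeneous_qform t j) (qform_ne_zero t j)
  rw [← phi_congr P (rel_mem t j), map_pow, h, zero_pow two_ne_zero]

end

/-! ### Norms, and the ideal of `B` -/

/-- The product of the conjugates of a polynomial under all sign changes. -/
def nrm (F : Poly) : Poly := ∏ s : Signs, flipPoly s F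

lemma flipPoly_nrm (s : Signs) (F : Poly) : flipPoly s (nrm F) = nrm F := by
  rw [nrm, map_prod]
  simp_rw [← flipPoly_mul]
  exact Fintype.prod_equiv (Equiv.mulLeft s) _ _ fun _ => rfl

lemma card_signs : Fintype.card Signs = 8 := by simp [Signs]

lemma isHomogeneous_nrm {F : Poly} {d : ℕ} (hF : F.IsHomogeneous d) :
    (nrm F).IsHomogeneous (8 * d) := by
  have := IsHomogeneous.prod Finset.univ (fun s : Signs => flipPoly s F) (fun _ => d)
    fun s _ => isHomogeneous_flipPoly s hF
  simpa [card_signs] using! this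

/-- The character of the group of sign changes attached to `e`. -/
def chr (e : Fin 3 → Fin 2) (s : Signs) : ℤ := ∏ j, (s j : ℤ) ^ (e j : ℕ)

lemma flipPoly_ymon (s : Signs) (e : Fin 3 → Fin 2) :
    flipPoly s (ymon e) = C (chr e s : Qbar) * ymon e := by
  have h : ∀ j : Fin 3, flipPoly s (X j.succ.succ ^ (e j : ℕ)) =
      C (((s j : ℤ) : Qbar) ^ (e j : ℕ)) * X j.succ.succ ^ (e j : ℕ) := fun j => by
    rw [map_pow, flipPoly_X, eps_succ, mul_pow, C_pow]
  rw [ymon, map_prod, Finset.prod_congr rfl fun j _ => h j, Finset.prod_mul_distrib, ← map_prod,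
    chr]
  push_cast
  rfl

lemma sum_chr (e : Fin 3 → Fin 2) : ∑ s, chr e s = if e = 0 then 8 else 0 := by
  revert e; decide

lemma chr_flipOne (e : Fin 3 → Fin 2) (j : Fin 3) : chr e (flipOne j) = (-1) ^ (e j : ℕ) := by
  rw [chr, Finset.prod_eq_single j]
  · simp [flipOne]
  · intro i _ hi; simp [flipOne, hi]
  · simp

lemma chr_eq_one_or (e : Fin 3 → Fin 2) (s : Signs) : chr e s = 1 ∨ chr e s = -1 := by
  revert e s; decide

/-- A form invariant under all sign changes is a binary form modulo the equations of `B`. -/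
lemma exists_bin_of_invariant (t : Triple) {F : Poly} {d : ℕ} (hF : F.IsHomogeneous d)
    (hinv : ∀ s, flipPoly s F = F) :
    ∃ A : MvPolynomial (Fin 2) Qbar, A.IsHomogeneous d ∧ F - bin A ∈ idealB t := by
  obtain ⟨A, hA, hmem⟩ := exists_reduction t hF
  refine ⟨A 0, by simpa using hA 0, ?_⟩
  have h1 : ∑ s : Signs, flipPoly s (F - ∑ e, bin (A e) * ymon e) ∈ idealB t :=
    sum_mem fun s _ => flipPoly_mem s hmem
  have h2 : ∑ s : Signs, flipPoly s (F - ∑ e, bin (A e) * ymon e) = C 8 * (F - bin (A 0)) := by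
    have c8 : (C 8 : Poly) = 8 := map_ofNat C 8
    simp only [map_sub, map_sum, map_mul, hinv, flipPoly_bin, flipPoly_ymon, Finset.sum_sub_distrib]
    rw [Finset.sum_comm]
    have : ∀ e, ∑ s : Signs, bin (A e) * (C (chr e s : Qbar) * ymon e) =
        if e = 0 then 8 * bin (A 0) else 0 := by
      intro e
      rw [← Finset.mul_sum, ← Finset.sum_mul, ← map_sum, ← Int.cast_sum, sum_chr]
      split_ifs with h
      · subst h; simp [ymon, c8]; ring
      · simp
    simp only [this, Finset.sum_ite_eq', Finset.mem_univ, if_true, Finset.sum_const,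
      Finset.card_univ, card_signs, c8]
    simp; ring
  rw [h2] at h1
  have := Ideal.mul_mem_left _ (C (8 : Qbar)⁻¹) h1
  rwa [← mul_assoc, ← C_mul, inv_mul_cancel₀ (by norm_num), C_1, one_mul] at this

lemma exists_bin_nrm (t : Triple) {F : Poly} {d : ℕ} (hF : F.IsHomogeneous d) :
    ∃ A : MvPolynomial (Fin 2) Qbar, A.IsHomogeneous (8 * d) ∧ nrm F - bin A ∈ idealB t :=
  exists_bin_of_invariant t (isHomogeneous_nrm hF) fun s => flipPoly_nrm s F

/-- The norm is a binary form modulo the equations, and a nonzero binary form has nonzero expansion.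
Vanishing of one conjugate along one branch is thereby turned into a statement independent of the
branch. -/
lemma nrm_mem_of_phi_eq_zero {t : Triple} {P : PtB t} {s : Signs} {F : Poly} {d : ℕ}
    (hF : F.IsHomogeneous d) (h : phi P (flipPoly s F) = 0) : nrm F ∈ idealB t := by
  obtain ⟨A, hA, hmem⟩ := exists_bin_nrm t hF
  have h1 : phi P (nrm F) = 0 := by
    rw [nrm, map_prod]
    exact Finset.prod_eq_zero (Finset.mem_univ s) h
  rw [phi_congr P hmem] at h1
  have hA0 : A = 0 := by
    by_contra h0
    exact phi_bin_ne_zero P hA h0 h1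
  simpa [hA0] using hmem

/-- Converse of the preceding lemma at an arbitrary point. Vanishing is transported between branches
at the cost of an unknown sign change. -/
lemma exists_phi_eq_zero_of_nrm_mem {t : Triple} {F : Poly} (h : nrm F ∈ idealB t) (P : PtB t) :
    ∃ s, phi P (flipPoly s F) = 0 := by
  have h1 := phi_eq_zero_of_mem P h
  rw [nrm, map_prod, Finset.prod_eq_zero_iff] at h1
  obtain ⟨s, -, hs⟩ := h1
  exact ⟨s, hs⟩

/-- At a point ramified in the j-th coordinate, X ↦ -X realises `flipOne j` on expansions. So if a
conjugate of F vanishes along that branch, its `flipOne j`-conjugate vanishes too, and so does every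
combination of the two. -/
lemma nrm_add_flip_mem {t : Triple} {F : Poly} {d : ℕ} (hF : F.IsHomogeneous d)
    (h : nrm F ∈ idealB t) (j : Fin 3) (c : Qbar) :
    nrm (F + C c * flipPoly (flipOne j) F) ∈ idealB t := by
  obtain ⟨P, hP⟩ := exists_pt_eq_zero t j
  obtain ⟨s, hs⟩ := exists_phi_eq_zero_of_nrm_mem h P
  have hs' := evalNegHom_phi P hP (flipPoly s F)
  rw [hs, map_zero, ← flipPoly_mul, mul_comm, flipPoly_mul] at hs'
  refine nrm_mem_of_phi_eq_zero (P := P) (s := s)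
    (hF.add ((isHomogeneous_flipPoly _ hF).C_mul c)) ?_
  rw [map_add, map_mul, map_add, map_mul, hs, ← hs']
  simp

/-- A form which vanishes along one branch of `B` lies in the ideal of `B`. -/
theorem mem_idealB_of_phi_eq_zero {t : Triple} {P : PtB t} {F : Poly} {d : ℕ}
    (hF : F.IsHomogeneous d) (h : phi P F = 0) : F ∈ idealB t := by
  have h0 : nrm F ∈ idealB t := nrm_mem_of_phi_eq_zero (s := 1) hF (by rwa [flipPoly_one])
  obtain ⟨A, hA, hmem⟩ := exists_reduction t hF
  suffices ∀ e, A e = 0 by simpa [this] using hmem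
  intro e
  by_contra hAe
  -- With this sign, `op j` is twice the projection to the monomials whose parity in the j-th
  -- coordinate agrees with e. The three together isolate 8 times the e-th term.
  let c : Fin 3 → Qbar := fun j => (-1) ^ (e j : ℕ)
  let op : Fin 3 → Poly → Poly := fun j G => G + C (c j) * flipPoly (flipOne j) G
  have hop : ∀ j G, G.IsHomogeneous d → (op j G).IsHomogeneous d := fun j G hG =>
    hG.add ((isHomogeneous_flipPoly _ hG).C_mul _)
  have hmem' : ∀ j (G : Poly) (a : (Fin 3 → Fin 2) → Qbar),
      G - ∑ e', C (a e') * (bin (A e') * ymon e') ∈ idealB t →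
      op j G - ∑ e', C ((1 + (-1) ^ (e j : ℕ) * (-1) ^ (e' j : ℕ)) * a e') *
        (bin (A e') * ymon e') ∈ idealB t := by
    intro j G a h
    have h1 := add_mem h (Ideal.mul_mem_left _ (C (c j)) (flipPoly_mem (flipOne j) h))
    convert h1 using 1
    simp only [op, c, map_sub, map_sum, map_mul, flipPoly_bin, flipPoly_ymon, chr_flipOne, mul_sub,
      Finset.mul_sum, add_mul, one_mul, map_add, Finset.sum_add_distrib, algHom_C, algebraMap_eq,
      Int.cast_pow, Int.cast_neg, Int.cast_one]
    have : ∀ e' : Fin 3 → Fin 2, C ((-1 : Qbar) ^ (e j : ℕ)) * C ((-1 : Qbar) ^ (e' j : ℕ)) *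
        C (a e') * (bin (A e') * ymon e') = C ((-1 : Qbar) ^ (e j : ℕ)) * (C (a e') *
        (bin (A e') * (C ((-1 : Qbar) ^ (e' j : ℕ)) * ymon e'))) := fun e' => by ring
    simp only [this]
    ring
  have m0 := hmem' 0 F (fun _ => 1) (by simpa using hmem)
  have m1 := hmem' 1 _ _ m0
  have m2 := hmem' 2 _ _ m1
  have hsum : ∀ e' : Fin 3 → Fin 2, (1 + (-1 : Qbar) ^ (e 2 : ℕ) * (-1) ^ (e' 2 : ℕ)) *
      ((1 + (-1) ^ (e 1 : ℕ) * (-1) ^ (e' 1 : ℕ)) * ((1 + (-1) ^ (e 0 : ℕ) * (-1) ^ (e' 0 : ℕ)) *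
        1)) = if e' = e then 8 else 0 := by
    intro e'
    have key : ∀ e e' : Fin 3 → Fin 2, (1 + (-1 : ℤ) ^ (e 2 : ℕ) * (-1) ^ (e' 2 : ℕ)) *
      ((1 + (-1) ^ (e 1 : ℕ) * (-1) ^ (e' 1 : ℕ)) * ((1 + (-1) ^ (e 0 : ℕ) * (-1) ^ (e' 0 : ℕ)) *
        1)) = if e' = e then 8 else 0 := by decide
    have := congrArg (Int.cast : ℤ → Qbar) (key e e')
    push_cast at this
    exact this
  simp only [hsum] at m2
  rw [Finset.sum_eq_single e (fun e' _ h => by simp [h]) (by simp), if_pos rfl] at m2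
  -- The projections preserve the property that the norm lies in the ideal, so a conjugate of the
  -- isolated term vanishes along the branch at P; each of its factors has nonzero expansion unless
  -- A e = 0.
  have n2 : nrm (op 2 (op 1 (op 0 F))) ∈ idealB t :=
    nrm_add_flip_mem (hop _ _ (hop _ _ hF)) (nrm_add_flip_mem (hop _ _ hF)
      (nrm_add_flip_mem hF h0 _ _) _ _) _ _
  obtain ⟨s, hs⟩ := exists_phi_eq_zero_of_nrm_mem n2 P
  have m3 := flipPoly_mem s m2
  rw [map_sub] at m3
  rw [phi_congr P m3, map_mul (flipPoly s), map_mul (flipPoly s), flipPoly_bin,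
    flipPoly_ymon] at hs
  simp only [map_mul, algHom_C, algebraMap_eq, mul_eq_zero, PowerSeries.algebraMap_eq] at hs
  have hchr : PowerSeries.C (chr e s : Qbar) ≠ 0 := by
    rcases chr_eq_one_or e s with h | h <;> simp [h]
  have h8 : (PowerSeries.C (8 : Qbar)) ≠ 0 := by simp
  have hy : phi P (ymon e) ≠ 0 := by
    rw [ymon, map_prod]
    refine Finset.prod_ne_zero_iff.2 fun j _ => ?_
    rw [map_pow]
    exact pow_ne_zero _ (phi_X_ne_zero P j)
  rcases hs with h | h | h | h
  · exact h8 h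
  · exact phi_bin_ne_zero P (hA e) hAe h
  · exact hchr h
  · exact hy h

lemma phi_eq_zero_iff {t : Triple} (P : PtB t) {F : Poly} {d : ℕ} (hF : F.IsHomogeneous d) :
    phi P F = 0 ↔ F ∈ idealB t :=
  ⟨mem_idealB_of_phi_eq_zero hF, phi_eq_zero_of_mem P⟩

lemma exists_ptB (t : Triple) : ∃ _ : PtB t, True := ⟨(exists_pt_eq_zero t 0).choose, trivial⟩

/-- The ideal of `B` is prime. -/
lemma mul_mem_idealB {t : Triple} {F G : Poly} {m n : ℕ} (hF : F.IsHomogeneous m)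
    (hG : G.IsHomogeneous n) (h : F * G ∈ idealB t) : F ∈ idealB t ∨ G ∈ idealB t := by
  obtain ⟨P, -⟩ := exists_ptB t
  have := phi_eq_zero_of_mem P h
  rw [map_mul, mul_eq_zero] at this
  exact this.imp (mem_idealB_of_phi_eq_zero hF) (mem_idealB_of_phi_eq_zero hG)

/-! ### The order of a form at a point -/

section
variable {t : Triple}

/-- Taylor expansion of `Q_j` at a point of the line. -/
lemma qform_taylor (t : Triple) (j : Fin 3) (b h : Fin 2 → Qbar) (hb : h 0 * b 0 + h 1 * b 1 = 1) :
    qform t j = C (aeval b (qform t j)) * (C (h 0) * X 0 + C (h 1) * X 1) ^ 2 +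
      lin b * (C (2 * qcoef t j 0 * (b 0 * h 1) + qcoef t j 1 * (b 0 * -h 0 + b 1 * h 1) +
        2 * qcoef t j 2 * (b 1 * -h 0)) * (C (h 0) * X 0 + C (h 1) * X 1) +
        C (aeval ![h 1, -h 0] (qform t j)) * lin b) := by
  have hC : (C (h 0) * C (b 0) + C (h 1) * C (b 1) : MvPolynomial (Fin 2) Qbar) = 1 := by
    rw [← C_mul, ← C_mul, ← C_add, hb, C_1]
  -- With ℓ = h₀X₀ + h₁X₁, the vector (X₀, X₁) equals ℓ · b + lin b · (h₁, -h₀); the expansion of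
  -- Q_j is in this basis.
  have e0 : (X 0 : MvPolynomial (Fin 2) Qbar) =
      (C (h 0) * X 0 + C (h 1) * X 1) * C (b 0) + lin b * C (h 1) := by
    rw [lin]; linear_combination -X 0 * hC
  have e1 : (X 1 : MvPolynomial (Fin 2) Qbar) =
      (C (h 0) * X 0 + C (h 1) * X 1) * C (b 1) - lin b * C (h 0) := by
    rw [lin]; linear_combination -X 1 * hC
  have e : qform t j = C (qcoef t j 0) *
        ((C (h 0) * X 0 + C (h 1) * X 1) * C (b 0) + lin b * C (h 1)) ^ 2 +
      C (qcoef t j 1) * (((C (h 0) * X 0 + C (h 1) * X 1) * C (b 0) + lin b * C (h 1)) *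
        ((C (h 0) * X 0 + C (h 1) * X 1) * C (b 1) - lin b * C (h 0))) +
      C (qcoef t j 2) * ((C (h 0) * X 0 + C (h 1) * X 1) * C (b 1) - lin b * C (h 0)) ^ 2 := by
    rw [← e0, ← e1, qform]
  refine e.trans ?_
  have c2 : (C 2 : MvPolynomial (Fin 2) Qbar) = 2 := map_ofNat C 2
  simp only [aeval_qform, Algebra.algebraMap_self, RingHom.id_apply, C_add, C_mul, C_pow, C_neg,
    Matrix.cons_val_zero, Matrix.cons_val_one, c2]
  ring

/-- The ideal of polynomials whose germ at `P` is divisible by the germ of `u`. -/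
def germIdeal (P : PtB t) (u : Poly) : Ideal Poly where
  carrier := {F | ∃ (e : ℕ) (H : Poly), H.IsHomogeneous e ∧ eval P.rep H ≠ 0 ∧
    ∃ G, H * F - u * G ∈ idealB t}
  zero_mem' := ⟨0, 1, isHomogeneous_one _ _, by simp, 0, by simp⟩
  add_mem' := by
    rintro F₁ F₂ ⟨e₁, H₁, h₁, h₁', G₁, m₁⟩ ⟨e₂, H₂, h₂, h₂', G₂, m₂⟩
    refine ⟨e₁ + e₂, H₁ * H₂, h₁.mul h₂, by simp [h₁', h₂'], H₂ * G₁ + H₁ * G₂, ?_⟩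
    have := add_mem (Ideal.mul_mem_left _ H₂ m₁) (Ideal.mul_mem_left _ H₁ m₂)
    convert this using 1
    ring
  smul_mem' := by
    rintro A F ⟨e, H, h, h', G, m⟩
    refine ⟨e, H, h, h', A * G, ?_⟩
    have := Ideal.mul_mem_left _ A m
    convert this using 1
    rw [smul_eq_mul]; ring

lemma idealB_le_germIdeal (P : PtB t) (u : Poly) : idealB t ≤ germIdeal P u := fun F hF =>
  ⟨0, 1, isHomogeneous_one _ _, by simp, 0, by simpa using hF⟩

lemma self_mem_germIdeal (P : PtB t) (u : Poly) : u ∈ germIdeal P u :=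
  ⟨0, 1, isHomogeneous_one _ _, by simp, 1, by simp⟩

lemma mem_germIdeal_of_mul {P : PtB t} {u H F : Poly} {e : ℕ} (hH : H.IsHomogeneous e)
    (h0 : eval P.rep H ≠ 0) (h : H * F ∈ germIdeal P u) : F ∈ germIdeal P u := by
  obtain ⟨e', H', h', h0', G, m⟩ := h
  exact ⟨e' + e, H' * H, h'.mul hH, by simp [h0, h0'], G, by rwa [mul_assoc]⟩

/-- A linear form in `v₀, v₁` which does not vanish at `P`. -/
lemma exists_dual (P : PtB t) : ∃ h : Fin 2 → Qbar, h 0 * P.base 0 + h 1 * P.base 1 = 1 := by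
  by_cases h0 : P.base 0 = 0
  · have h1 : P.base 1 ≠ 0 := fun h1 => P.base_ne_zero (by ext i; fin_cases i <;> assumption)
    exact ⟨![0, (P.base 1)⁻¹], by simp [h1]⟩
  · exact ⟨![(P.base 0)⁻¹, 0], by simp [h0]⟩

lemma eval_bin (P : PtB t) (A : MvPolynomial (Fin 2) Qbar) :
    eval P.rep (bin A) = aeval P.base A := by
  rw [← aeval_eq_eval_apply, aeval_bin]; rfl

lemma bin_C (c : Qbar) : bin (C c) = C c := by simp [bin]

lemma bin_X_zero : bin (X 0) = X 0 := by simp [bin]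

lemma bin_X_one : bin (X 1) = X 1 := by simp [bin]

/-- A form vanishing at `P` is in the ideal generated by linear forms vanishing at `P`. -/
lemma mem_of_eval_rep_eq_zero (P : PtB t) {J : Ideal Poly} {h : Fin 2 → Qbar}
    (hh : h 0 * P.base 0 + h 1 * P.base 1 = 1) (h1 : bin (lin P.base) ∈ J)
    (h2 : ∀ j : Fin 3, X j.succ.succ - C (P.rep j.succ.succ) *
      bin (C (h 0) * X 0 + C (h 1) * X 1) ∈ J)
    {F : Poly} {d : ℕ} (hF : F.IsHomogeneous d) (h0 : eval P.rep F = 0) : F ∈ J := by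
  set ℓ : Poly := bin (C (h 0) * X 0 + C (h 1) * X 1) with hℓ
  have hC : (C (h 0) * C (P.base 0) + C (h 1) * C (P.base 1) : Poly) = 1 := by
    rw [← C_mul, ← C_mul, ← C_add, hh, C_1]
  -- Modulo J every coordinate is its value at P times ℓ, hence F becomes ℓ^d times its value at P.
  have h3 : ∀ i : Fin 5, X i - C (P.rep i) * ℓ ∈ J := by
    refine Fin.cases ?_ (Fin.cases ?_ h2)
    · have : X 0 - C (P.rep 0) * ℓ = C (h 1) * bin (lin P.base) := by
        change X 0 - C (P.base 0) * ℓ = _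
        simp only [hℓ, lin, map_add, map_sub, map_mul, bin_C, bin_X_zero, bin_X_one]
        linear_combination -X 0 * hC
      rw [this]
      exact Ideal.mul_mem_left _ _ h1
    · have : X 1 - C (P.rep 1) * ℓ = -C (h 0) * bin (lin P.base) := by
        change X 1 - C (P.base 1) * ℓ = _
        simp only [hℓ, lin, map_add, map_sub, map_mul, bin_C, bin_X_zero, bin_X_one]
        linear_combination -X 1 * hC
      change X 1 - C (P.rep 1) * ℓ ∈ J
      rw [this]
      exact Ideal.mul_mem_left _ _ h1
  have e1 : Ideal.Quotient.mk J F =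
      aeval (fun i => Ideal.Quotient.mk J ℓ * algebraMap Qbar (Poly ⧸ J) (P.rep i)) F := by
    have : Ideal.Quotient.mkₐ Qbar J =
        aeval (fun i => Ideal.Quotient.mk J ℓ * algebraMap Qbar (Poly ⧸ J) (P.rep i)) := by
      refine algHom_ext fun i => ?_
      rw [aeval_X, Ideal.Quotient.mkₐ_eq_mk, Ideal.Quotient.eq.2 (h3 i), map_mul, mul_comm]
      rfl
    exact DFunLike.congr_fun this F
  rw [← Ideal.Quotient.eq_zero_iff_mem, e1, aeval_mul_of_isHomogeneous _ _ hF]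
  have e2 : aeval (fun i => algebraMap Qbar (Poly ⧸ J) (P.rep i)) F =
      algebraMap Qbar (Poly ⧸ J) (eval P.rep F) := by
    rw [← aeval_eq_eval_apply]
    exact aeval_algebraMap_apply (Poly ⧸ J) P.rep F
  rw [e2, h0, map_zero, mul_zero]

/-- Existence of a linear form which is a local parameter at `P`. -/
lemma exists_parameter (P : PtB t) : ∃ u : Poly, u.IsHomogeneous 1 ∧ eval P.rep u = 0 ∧
    (∃ w, PowerSeries.constantCoeff w ≠ 0 ∧ phi P u = PowerSeries.X * w) ∧
    ∀ (F : Poly) (d : ℕ), F.IsHomogeneous d → eval P.rep F = 0 → F ∈ germIdeal P u := by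
  obtain ⟨h, hh⟩ := exists_dual P
  set ℓ : MvPolynomial (Fin 2) Qbar := C (h 0) * X 0 + C (h 1) * X 1 with hℓ
  have hℓ1 : ℓ.IsHomogeneous 1 :=
    ((isHomogeneous_X _ _).C_mul _).add ((isHomogeneous_X _ _).C_mul _)
  have hℓe : eval P.rep (bin ℓ) = 1 := by rw [eval_bin]; simpa [hℓ] using hh
  -- By the Taylor formula, y_j² - y_j(P)²ℓ² lies in the germ ideal once `lin P.base` does. The
  -- factor y_j + y_j(P)ℓ takes the value 2y_j(P) ≠ 0 at P and can be cancelled.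
  have hy : ∀ (u : Poly) (j : Fin 3), P.rep j.succ.succ ≠ 0 →
      bin (lin P.base) ∈ germIdeal P u →
      X j.succ.succ - C (P.rep j.succ.succ) * bin ℓ ∈ germIdeal P u := by
    intro u j hj hu
    refine mem_germIdeal_of_mul (H := X j.succ.succ + C (P.rep j.succ.succ) * bin ℓ) (e := 1)
      ((isHomogeneous_X _ _).add ((isHomogeneous_bin hℓ1).C_mul _)) ?_ ?_
    · simp only [map_add, map_mul, eval_X, eval_C, hℓe, mul_one]
      rw [← two_mul]
      exact mul_ne_zero two_ne_zero hj
    · have h1 := congrArg bin (qform_taylor t j P.base h hh)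
      rw [← hℓ, map_add, map_mul, map_mul, map_pow, bin_C, ← P.sq_rep j, C_pow] at h1
      generalize bin (_ * ℓ + _) = G at h1
      have h2 := idealB_le_germIdeal P u (rel_mem t j)
      rw [rel, h1] at h2
      have h3 := add_mem h2 (Ideal.mul_mem_right G _ hu)
      convert h3 using 1
      ring
  by_cases hP : ∃ i : Fin 3, P.rep i.succ.succ = 0
  -- Ramified case: the vanishing coordinate is the parameter. Since P lies over a simple zero of
  -- Q_i, the relation y_i² = Q_i reads y_i² = lin · (form nonzero at P), which puts the linear form
  -- in the ideal.
  · obtain ⟨i, hi⟩ := hP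
    refine ⟨X i.succ.succ, isHomogeneous_X _ _, by simpa using hi, exists_phi_eq_X_mul P hi, ?_⟩
    have hlin : bin (lin P.base) ∈ germIdeal P (X i.succ.succ) := by
      have h1 := congrArg bin (qform_taylor t i P.base h hh)
      have hsq := P.sq_rep i
      rw [hi, zero_pow two_ne_zero] at hsq
      rw [← hℓ, ← hsq, C_0, zero_mul, zero_add, map_mul, mul_comm] at h1
      refine mem_germIdeal_of_mul (e := 1) (isHomogeneous_bin ((hℓ1.C_mul _).add
        ((isHomogeneous_lin _).C_mul _))) ?_ (Eq.mp (congrArg (· ∈ germIdeal P _) h1) ?_)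
      · rw [eval_bin]
        have e1 : aeval P.base ℓ = 1 := by rw [← eval_bin, hℓe]
        have e2 : aeval P.base (lin P.base) = 0 := by simp [lin]; ring
        simp only [map_add, map_mul, e1, e2, mul_one, mul_zero, add_zero, algHom_C,
          Algebra.algebraMap_self, RingHom.id_apply]
        exact qform_polar_ne_zero t i (d := ![h 1, -h 0]) hsq.symm (by
          simp only [Matrix.cons_val_zero, Matrix.cons_val_one]
          intro h0
          exact one_ne_zero (hh.symm.trans (by linear_combination -h0)))
      · have h2 := idealB_le_germIdeal P (X i.succ.succ) (rel_mem t i)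
        have h3 := sub_mem (Ideal.pow_mem_of_mem _ (self_mem_germIdeal P _) 2 two_pos) h2
        rwa [rel, sub_sub_cancel] at h3
    intro F d hF h0
    refine mem_of_eval_rep_eq_zero P hh hlin (fun j => ?_) hF h0
    by_cases hj : P.rep j.succ.succ = 0
    · by_cases hij : i = j
      · subst hij
        simpa [hi] using self_mem_germIdeal P (X i.succ.succ)
      · exact (rep_ne_zero_of_ne hi hij hj).elim
    · exact hy _ j hj hlin
  · rw [not_exists] at hP
    refine ⟨bin (lin P.base), isHomogeneous_bin (isHomogeneous_lin _), ?_, ?_, ?_⟩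
    · rw [eval_bin]; simp [lin]; ring
    · obtain ⟨d, hd, h⟩ := phi_lin P
      refine ⟨PowerSeries.C (P.base 1 * d 0 - P.base 0 * d 1), ?_, ?_⟩
      · rw [PowerSeries.constantCoeff_C, ← neg_ne_zero, neg_sub]; exact hd
      · rw [h, ram_eq_one hP, pow_one, mul_comm (P.base 1), sub_self, map_zero, zero_add, mul_comm]
    · intro F d hF h0
      exact mem_of_eval_rep_eq_zero P hh (self_mem_germIdeal P _)
        (fun j => hy _ j (hP j) (self_mem_germIdeal P _)) hF h0

lemma homogeneousComponent_mul_of_isHomogeneous_one {u : Poly} (hu : u.IsHomogeneous 1) (G : Poly)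
    (n : ℕ) : homogeneousComponent (n + 1) (u * G) = u * homogeneousComponent n G := by
  conv_lhs => rw [← sum_homogeneousComponent G, Finset.mul_sum, map_sum]
  have : ∀ i, homogeneousComponent (n + 1) (u * homogeneousComponent i G) =
      if i = n then u * homogeneousComponent i G else 0 := by
    intro i
    rw [homogeneousComponent_of_mem (n := i + 1) (by
      rw [mem_homogeneousSubmodule, add_comm]
      exact hu.mul (homogeneousComponent_isHomogeneous i G))]
    simp [eq_comm]
  simp only [this, Finset.sum_ite_eq']
  split_ifs with h
  · rfl
  · rw [Finset.mem_range, not_lt] at h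
    rw [homogeneousComponent_eq_zero _ _ (by omega), mul_zero]

/-- A form vanishes to order at least `n` at `P` when its expansion along the branch at `P` does. -/
theorem vanishesToOrder_iff (P : PtB t) {F : Poly} {d : ℕ} (hF : F.IsHomogeneous d) (n : ℕ) :
    VanishesToOrder t P n F ↔ PowerSeries.X ^ n ∣ phi P F := by
  constructor
  · rintro ⟨e, H, hH, hP, hmem⟩
    have hX : (idealPt P.1).map (phi P : Poly →+* PowerSeries Qbar) ≤
        Ideal.span {PowerSeries.X} := by
      rw [idealPt, Ideal.map_span, Ideal.span_le]
      rintro _ ⟨G, hG, rfl⟩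
      rw [SetLike.mem_coe, Ideal.mem_span_singleton, PowerSeries.X_dvd_iff]
      exact (constantCoeff_phi P G).trans (Vanishes.eval_rep hG)
    have h1 : phi P (H * F) ∈ Ideal.map (phi P : Poly →+* PowerSeries Qbar)
        (idealPt P.1 ^ n ⊔ idealB t) := Ideal.mem_map_of_mem _ hmem
    have hle : Ideal.map (phi P : Poly →+* PowerSeries Qbar) (idealPt P.1 ^ n ⊔ idealB t) ≤
        Ideal.span {PowerSeries.X ^ n} := by
      rw [Ideal.map_sup, Ideal.map_pow, ← Ideal.span_singleton_pow]
      refine sup_le (Ideal.pow_right_mono hX n) (Ideal.map_le_iff_le_comap.2 fun G hG => ?_)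
      rw [Ideal.mem_comap]
      change phi P G ∈ _
      rw [phi_eq_zero_of_mem P hG]
      exact zero_mem _
    have h2 := Ideal.mem_span_singleton.1 (hle h1)
    rw [map_mul] at h2
    refine (IsUnit.dvd_mul_left ?_).1 h2
    rw [PowerSeries.isUnit_iff_constantCoeff, constantCoeff_phi, isUnit_iff_ne_zero]
    rwa [vanishes_iff hH] at hP
  -- Induction on n: write F locally as u times a form G', whose expansion has lost exactly one
  -- factor X.
  · obtain ⟨u, hu1, hu0, ⟨w, hw, hwu⟩, hloc⟩ := exists_parameter P
    obtain ⟨h, hh⟩ := exists_dual P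
    have hℓ1 : (bin (C (h 0) * X 0 + C (h 1) * X 1)).IsHomogeneous 1 :=
      isHomogeneous_bin (((isHomogeneous_X _ _).C_mul _).add ((isHomogeneous_X _ _).C_mul _))
    have hℓe : eval P.rep (bin (C (h 0) * X 0 + C (h 1) * X 1)) = 1 := by
      rw [eval_bin]; simpa using hh
    set ℓ := bin (C (h 0) * X 0 + C (h 1) * X 1)
    have hupt : u ∈ idealPt P.1 := Ideal.subset_span ((vanishes_iff hu1).2 hu0)
    intro hdvd
    induction n generalizing F d with
    | zero =>
      exact ⟨0, 1, isHomogeneous_one _ _, by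
        rw [vanishes_iff (isHomogeneous_one _ _)]; simp, by simp⟩
    | succ n ih =>
      have hF0 : eval P.rep F = 0 := by
        rw [← constantCoeff_phi, ← PowerSeries.X_dvd_iff]
        exact (Dvd.intro_left _ (pow_succ _ n).symm).trans hdvd
      obtain ⟨e, H, hH, hH0, G, hG⟩ := hloc F d hF hF0
      -- Taking a homogeneous component makes the quotient by u a form again. The factor ℓ, equal to
      -- 1 at P, makes the degree a successor even when e + d = 0.
      have h1 := isHomogeneous_idealB t (Ideal.mul_mem_left _ ℓ hG) (1 + (e + d))
      have h2 : homogeneousComponent (1 + (e + d)) (ℓ * (H * F - u * G)) =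
          ℓ * H * F - u * homogeneousComponent (e + d) (ℓ * G) := by
        have e1 : ℓ * (H * F - u * G) = ℓ * H * F - u * (ℓ * G) := by ring
        rw [e1, map_sub, add_comm 1, homogeneousComponent_mul_of_isHomogeneous_one hu1,
          homogeneousComponent_of_mem (n := 1 + e + d) (by
            rw [mem_homogeneousSubmodule]; exact (hℓ1.mul hH).mul hF), if_pos (by ring)]
      rw [h2] at h1
      set G' := homogeneousComponent (e + d) (ℓ * G)
      have hG' : G'.IsHomogeneous (e + d) := homogeneousComponent_isHomogeneous _ _
      have h3 : phi P (ℓ * H) * phi P F = phi P u * phi P G' := by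
        have := phi_congr P h1
        rwa [map_mul, map_mul (phi P) u] at this
      have h4 : PowerSeries.X ^ n ∣ phi P G' := by
        have h5 : PowerSeries.X * PowerSeries.X ^ n ∣ PowerSeries.X * (w * phi P G') := by
          rw [← mul_assoc, ← hwu, ← h3, ← pow_succ']
          exact hdvd.mul_left _
        have h6 := (mul_dvd_mul_iff_left PowerSeries.X_ne_zero).1 h5
        refine (IsUnit.dvd_mul_left ?_).1 h6
        rwa [PowerSeries.isUnit_iff_constantCoeff, isUnit_iff_ne_zero]
      obtain ⟨e', H', hH', hH0', hm⟩ := ih hG' h4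
      rw [vanishes_iff hH'] at hH0'
      refine ⟨e' + (1 + e), H' * (ℓ * H), hH'.mul (hℓ1.mul hH), ?_, ?_⟩
      · rw [vanishes_iff (hH'.mul (hℓ1.mul hH)), map_mul, map_mul]
        exact mul_ne_zero hH0' (mul_ne_zero (by rw [show P.1.rep = P.rep from rfl, hℓe]; simp) hH0)
      · have e2 : H' * (ℓ * H) * F = H' * (ℓ * H * F - u * G') + u * (H' * G') := by ring
        rw [e2]
        refine add_mem (Ideal.mem_sup_right (Ideal.mul_mem_left _ _ h1)) ?_
        have h7 := Ideal.mul_mem_mul hupt hm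
        rw [Ideal.mul_sup, ← pow_succ'] at h7
        have hle : idealPt P.1 ^ (n + 1) ⊔ idealPt P.1 * idealB t ≤
            idealPt P.1 ^ (n + 1) ⊔ idealB t := sup_le_sup le_rfl Ideal.mul_le_right
        exact hle h7

/-- The order of a form at a point of `B` (with value `0` at forms vanishing on `B`). -/
def ord (P : PtB t) (F : Poly) : ℕ := (phi P F).order.toNat

lemma hasOrder_iff (P : PtB t) {F : Poly} {d : ℕ} (hF : F.IsHomogeneous d) (h0 : F ∉ idealB t)
    {m : ℕ} : HasOrder t P F m ↔ m = ord P F := by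
  have hphi : phi P F ≠ 0 := fun h => h0 ((phi_eq_zero_iff P hF).1 h)
  have h : HasOrder t P F (ord P F) := by
    refine ⟨(vanishesToOrder_iff P hF _).2 PowerSeries.X_pow_order_dvd, fun n hn => ?_⟩
    have hn := (vanishesToOrder_iff P hF n).1 hn
    by_contra! hlt
    exact PowerSeries.coeff_order hphi (PowerSeries.X_pow_dvd_iff.1 hn _ hlt)
  exact ⟨fun h' => h'.unique h, fun h' => h' ▸ h⟩

end

/-! ### Degrees of divisors -/

lemma deg_single {X : Type*} (x : X) (n : ℤ) : deg (Finsupp.single x n) = n := by simp [deg]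

lemma deg_pos {X : Type*} {D : X →₀ ℤ} (h : ∀ x, 0 ≤ D x) (h0 : D ≠ 0) : 0 < deg D := by
  have e : deg D = ∑ x ∈ D.support, D x := by simp [deg, Finsupp.sum]
  rw [e]
  exact Finset.sum_pos (fun x hx => lt_of_le_of_ne (h x) (Ne.symm (Finsupp.mem_support_iff.1 hx)))
    (Finsupp.support_nonempty_iff.2 h0)

lemma eq_of_le_of_deg_le {X : Type*} {D E : X →₀ ℤ} (h : ∀ x, D x ≤ E x) (hd : deg E ≤ deg D) :
    D = E := by
  by_contra hne
  have := deg_pos (D := E - D) (fun x => by simpa using h x) (sub_ne_zero.2 (Ne.symm hne))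
  rw [map_sub] at this
  omega

section
variable {t : Triple}

/-! ### Fibres of the projection to the line -/

/-- The fibres of the projection to the line are orbits of sign changes: proportional base points
have values of Q_j differing by the square of the ratio c, so the remaining coordinates agree up to
c and signs. -/
lemma exists_flip_eq {P P₀ : PtB t} (h : P₀.base 1 * P.base 0 - P₀.base 0 * P.base 1 = 0) :
    ∃ s : Signs, P = s • P₀ := by
  obtain ⟨c, hc⟩ : ∃ c : Qbar, P.base = c • P₀.base := by
    obtain ⟨a, ha⟩ := exists_dual P₀
    refine ⟨a 0 * P.base 0 + a 1 * P.base 1, ?_⟩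
    ext i
    fin_cases i
    · simp only [Fin.zero_eta, Pi.smul_apply, smul_eq_mul]
      linear_combination -P.base 0 * ha + a 1 * h
    · simp only [Fin.mk_one, Pi.smul_apply, smul_eq_mul]
      linear_combination -P.base 1 * ha - a 0 * h
  have hs : ∀ j : Fin 3, ∃ s : ℤˣ, P.rep j.succ.succ = c * (((s : ℤ) : Qbar) * P₀.rep j.succ.succ) := by
    intro j
    have h1 := P.sq_rep j
    have h2 : aeval (c • P₀.base) (qform t j) = c ^ 2 * aeval P₀.base (qform t j) :=
      aeval_mul_of_isHomogeneous c P₀.base (isHomogeneous_qform t j)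
    rw [hc, h2, ← P₀.sq_rep j, ← mul_pow] at h1
    rcases sq_eq_sq_iff_eq_or_eq_neg.1 h1 with h | h
    · exact ⟨1, by simpa using h⟩
    · exact ⟨-1, by simpa using h⟩
  choose s hs using hs
  refine ⟨s, ?_⟩
  obtain ⟨r, hr, hsr⟩ := flip_rep s P₀
  have hc' : ∀ i, P.rep i = c * (eps s i * P₀.rep i) := by
    refine Fin.cases ?_ (Fin.cases ?_ fun j => ?_)
    · have : eps s 0 = 1 := eps_castLE s 0
      rw [this, one_mul]; exact congrFun hc 0
    · have : eps s (Fin.succ 0) = 1 := eps_castLE s 1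
      rw [this, one_mul]; exact congrFun hc 1
    · rw [eps_succ]; exact hs j
  rw [← mk_rep P]
  refine mkPt_eq_of_smul (r := c / r) ?_
  ext i
  rw [Pi.smul_apply, smul_eq_mul, hsr, hc']
  field_simp

/-- A scalar comparing the two representatives must be 1, since v₀, v₁ are unaffected and not both
zero. -/
lemma flip_eq_self_iff {s : Signs} {P : PtB t} :
    s • P = P ↔ ∀ j : Fin 3, P.rep j.succ.succ ≠ 0 → s j = 1 := by
  have hx : (fun i => eps s i * P.rep i) ≠ 0 := fun h =>
    P.rep_ne_zero (flipLin_injective s (h.trans (map_zero _).symm))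
  have e : s • P = P ↔ ∃ r : Qbar, r • P.rep = fun i => eps s i * P.rep i := by
    have := mkPt_eq_mkPt_iff (hx := hx) (hx' := P.rep_ne_zero) (h := P.isSol.eps s) (h' := P.isSol)
    rw [← flip_mkPt s P.rep_ne_zero P.isSol, mk_rep] at this
    exact this
  rw [e]
  constructor
  · rintro ⟨r, hr⟩ j hj
    have hb : ∀ i : Fin 2, r * P.base i = P.base i := fun i => by
      have := congrFun hr (Fin.castLE (by norm_num) i)
      rwa [eps_castLE, one_mul] at this
    have hr1 : r = 1 := by
      by_contra h1
      apply P.base_ne_zero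
      ext i
      have : (r - 1) * P.base i = 0 := by linear_combination hb i
      exact (mul_eq_zero.1 this).resolve_left (sub_ne_zero.2 h1)
    have := congrFun hr j.succ.succ
    rw [hr1, one_smul, eps_succ] at this
    have h1 : ((s j : ℤ) : Qbar) = 1 := mul_right_cancel₀ hj (by rw [one_mul]; exact this.symm)
    exact Units.ext (Int.cast_injective (α := Qbar) (by simpa using h1))
  · intro h
    refine ⟨1, ?_⟩
    rw [one_smul]
    ext i
    refine Fin.cases ?_ (Fin.cases ?_ fun j => ?_) i
    · have : eps s 0 = 1 := eps_castLE s 0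
      rw [this, one_mul]
    · have : eps s (Fin.succ 0) = 1 := eps_castLE s 1
      rw [this, one_mul]
    · by_cases hj : P.rep j.succ.succ = 0
      · simp [hj]
      · rw [eps_succ, h j hj]; simp

lemma flipOne_smul_eq {P : PtB t} {j : Fin 3} (h : P.rep j.succ.succ = 0) : flipOne j • P = P := by
  rw [flip_eq_self_iff]
  intro i hi
  have : i ≠ j := by rintro rfl; exact hi h
  simp [flipOne, this]

-- At most one of the last three coordinates vanishes, by coprimality of the Q_j, so the stabiliser
-- is trivial or generated by one `flipOne i`. This makes the multiplicities in a fibre add up to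
-- the group order 8.
open scoped Classical in
lemma card_stabilizer (P : PtB t) : (Finset.univ.filter fun s : Signs => s • P = P).card = ram P := by
  by_cases hP : ∃ i : Fin 3, P.rep i.succ.succ = 0
  · obtain ⟨i, hi⟩ := hP
    have : (Finset.univ.filter fun s : Signs => s • P = P) = {1, flipOne i} := by
      ext s
      simp only [Finset.mem_filter_univ, Finset.mem_insert, Finset.mem_singleton]
      constructor
      · intro h
        rw [flip_eq_self_iff] at h
        have h' : ∀ j, j ≠ i → s j = 1 := fun j hj => h j (rep_ne_zero_of_ne hi (Ne.symm hj))
        rcases Int.units_eq_one_or (s i) with h1 | h1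
        · left; ext j
          by_cases hj : j = i
          · subst hj; simp [h1]
          · simp [h' j hj]
        · right; ext j
          by_cases hj : j = i
          · subst hj; simp [h1, flipOne]
          · simp [h' j hj, flipOne, hj]
      · rintro (rfl | rfl)
        · exact one_smul _ _
        · exact flipOne_smul_eq hi
    rw [this, ram_eq_two hi, Finset.card_pair]
    intro h
    have := congrFun h i
    simp [flipOne] at this
  · rw [not_exists] at hP
    have : (Finset.univ.filter fun s : Signs => s • P = P) = {1} := by
      ext s
      simp only [Finset.mem_filter_univ, Finset.mem_singleton]
      constructor
      · intro h
        rw [flip_eq_self_iff] at h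
        ext j
        simp [h j (hP j)]
      · rintro rfl
        exact one_smul _ _
    rw [this, ram_eq_one hP, Finset.card_singleton]

/-! ### Divisors of forms -/

/-- `F` is a form of degree `d` which does not vanish identically on `B`. -/
def IsForm (t : Triple) (d : ℕ) (F : Poly) : Prop := F.IsHomogeneous d ∧ F ∉ idealB t

lemma IsForm.mul {m n : ℕ} {F G : Poly} (hF : IsForm t m F) (hG : IsForm t n G) :
    IsForm t (m + n) (F * G) :=
  ⟨hF.1.mul hG.1, fun h => (mul_mem_idealB hF.1 hG.1 h).elim hF.2 hG.2⟩

lemma IsForm.flip {d : ℕ} {F : Poly} (hF : IsForm t d F) (s : Signs) :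
    IsForm t d (flipPoly s F) :=
  ⟨isHomogeneous_flipPoly s hF.1, by rw [flipPoly_mem_iff]; exact hF.2⟩

lemma IsForm.phi_ne_zero {d : ℕ} {F : Poly} (hF : IsForm t d F) (P : PtB t) : phi P F ≠ 0 :=
  fun h => hF.2 ((phi_eq_zero_iff P hF.1).1 h)

lemma isForm_iff (P : PtB t) {d : ℕ} {F : Poly} : IsForm t d F ↔ F.IsHomogeneous d ∧ phi P F ≠ 0 :=
  ⟨fun h => ⟨h.1, h.phi_ne_zero P⟩, fun h => ⟨h.1, fun h' => h.2 (phi_eq_zero_of_mem P h')⟩⟩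

lemma isForm_C {c : Qbar} (hc : c ≠ 0) : IsForm t 0 (C c) := by
  obtain ⟨P, -⟩ := exists_ptB t
  exact (isForm_iff P).2 ⟨isHomogeneous_C _ _, by simpa [PowerSeries.algebraMap_eq] using hc⟩

lemma isForm_X (j : Fin 3) : IsForm t 1 (X j.succ.succ) := by
  obtain ⟨P, -⟩ := exists_ptB t
  exact (isForm_iff P).2 ⟨isHomogeneous_X _ _, phi_X_ne_zero P j⟩

lemma isForm_lin {r : Fin 2 → Qbar} (hr : r ≠ 0) : IsForm t 1 (bin (lin r)) := by
  obtain ⟨P, -⟩ := exists_ptB t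
  exact (isForm_iff P).2 ⟨isHomogeneous_bin (isHomogeneous_lin r), phi_lin_ne_zero P hr⟩

lemma IsForm.nrm {d : ℕ} {F : Poly} (hF : IsForm t d F) : IsForm t (8 * d) (nrm F) := by
  obtain ⟨P, -⟩ := exists_ptB t
  refine (isForm_iff P).2 ⟨isHomogeneous_nrm hF.1, ?_⟩
  rw [EnriquesBranch.nrm, map_prod]
  exact Finset.prod_ne_zero_iff.2 fun s _ => (hF.flip s).phi_ne_zero P

lemma IsForm.hasOrder {d : ℕ} {F : Poly} (hF : IsForm t d F) (P : PtB t) {m : ℕ} :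
    HasOrder t P F m ↔ m = ord P F := hasOrder_iff P hF.1 hF.2

lemma ord_mul {m n : ℕ} {F G : Poly} (hF : IsForm t m F) (hG : IsForm t n G) (P : PtB t) :
    ord P (F * G) = ord P F + ord P G := by
  have h1 := PowerSeries.order_eq_top.not.2 (hF.phi_ne_zero P)
  have h2 := PowerSeries.order_eq_top.not.2 (hG.phi_ne_zero P)
  rw [ord, map_mul, PowerSeries.order_mul, ENat.toNat_add h1 h2]
  rfl

lemma ord_congr {F G : Poly} (h : F - G ∈ idealB t) (P : PtB t) : ord P F = ord P G := by
  rw [ord, phi_congr P h, ord]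

lemma ord_flip {d : ℕ} {F : Poly} (hF : IsForm t d F) (s : Signs) (P : PtB t) :
    ord (s • P) (flipPoly s F) = ord P F :=
  (((hF.flip s).hasOrder _).1 (hasOrder_flip s ((hF.hasOrder P).2 rfl))).symm

lemma ord_eq_zero_iff {d : ℕ} {F : Poly} (hF : IsForm t d F) (P : PtB t) :
    ord P F = 0 ↔ eval P.rep F ≠ 0 := by
  rw [ord, ENat.toNat_eq_zero, or_iff_left (PowerSeries.order_eq_top.not.2 (hF.phi_ne_zero P)),
    ← constantCoeff_phi, ← not_iff_not, not_not]
  exact PowerSeries.order_ne_zero_iff_constCoeff_eq_zero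

lemma le_ord {d : ℕ} {F : Poly} (hF : IsForm t d F) (P : PtB t) {n : ℕ} :
    n ≤ ord P F ↔ PowerSeries.X ^ n ∣ phi P F := by
  rw [← vanishesToOrder_iff P hF.1]
  have h := (hF.hasOrder P).2 rfl
  refine ⟨fun hn => ?_, fun hn => h.2 hn⟩
  rw [vanishesToOrder_iff P hF.1]
  exact (pow_dvd_pow _ hn).trans ((vanishesToOrder_iff P hF.1 _).1 h.1)

lemma ord_eq_of_phi {P : PtB t} {F : Poly} {n : ℕ} {u : PowerSeries Qbar}
    (hu : PowerSeries.constantCoeff u ≠ 0) (h : phi P F = PowerSeries.X ^ n * u) : ord P F = n := by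
  have : u.order = 0 := by
    by_contra h0
    exact hu (PowerSeries.order_ne_zero_iff_constCoeff_eq_zero.1 h0)
  rw [ord, h, PowerSeries.order_mul, PowerSeries.order_X_pow, this, add_zero, ENat.toNat_natCast]

lemma ord_X {P : PtB t} {j : Fin 3} (h : P.rep j.succ.succ = 0) : ord P (X j.succ.succ) = 1 := by
  obtain ⟨u, hu, hX⟩ := exists_phi_eq_X_mul P h
  exact ord_eq_of_phi hu (by rw [pow_one]; exact hX)

lemma ord_lin (P : PtB t) : ord P (bin (lin P.base)) = ram P := by
  obtain ⟨d, hd, h⟩ := phi_lin P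
  refine ord_eq_of_phi (u := PowerSeries.C (P.base 1 * d 0 - P.base 0 * d 1)) ?_ ?_
  · rw [PowerSeries.constantCoeff_C, ← neg_ne_zero, neg_sub]; exact hd
  · rw [h, mul_comm (P.base 1), sub_self, map_zero, zero_add, mul_comm]

lemma eval_lin (r : Fin 2 → Qbar) (P : PtB t) :
    eval P.rep (bin (lin r)) = r 1 * P.base 0 - r 0 * P.base 1 := by
  rw [eval_bin]; simp [lin]

lemma finite_fibre {r : Fin 2 → Qbar} (hr : r ≠ 0) :
    {P : PtB t | eval P.rep (bin (lin r)) = 0}.Finite := by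
  obtain ⟨P₀, c, hc, hP₀⟩ := exists_pt_base t hr
  refine (Set.finite_range fun s : Signs => s • P₀).subset fun P hP => ?_
  rw [Set.mem_ofPred_eq, eval_lin] at hP
  obtain ⟨s, rfl⟩ := exists_flip_eq (P := P) (P₀ := P₀) (by
    rw [hP₀]; simp only [Pi.smul_apply, smul_eq_mul]; linear_combination c * hP)
  exact ⟨s, rfl⟩

/-- The zeros of F are among those of its norm, hence in finitely many fibres over the line. -/
lemma IsForm.finite_support {d : ℕ} {F : Poly} (hF : IsForm t d F) :
    (Function.support fun P : PtB t => (ord P F : ℤ)).Finite := by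
  obtain ⟨A, hA, hmem⟩ := exists_bin_nrm t hF.1
  have hA0 : A ≠ 0 := by
    rintro rfl
    exact hF.nrm.2 (by simpa using hmem)
  obtain ⟨c, r, hc, hr, rfl⟩ := exists_eq_prod_lin hA hA0
  refine (Set.finite_iUnion fun i => finite_fibre (t := t) (hr i)).subset fun P hP => ?_
  rw [Function.mem_support, Nat.cast_ne_zero, ne_eq, ord_eq_zero_iff hF, not_not] at hP
  have h1 : eval P.rep (EnriquesBranch.nrm F) = 0 := by
    rw [EnriquesBranch.nrm, map_prod]
    exact Finset.prod_eq_zero (Finset.mem_univ 1) (by rw [flipPoly_one, hP])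
  rw [← constantCoeff_phi, phi_congr P hmem, constantCoeff_phi, map_mul, map_mul, map_prod,
    map_prod, mul_eq_zero, Finset.prod_eq_zero_iff] at h1
  rcases h1 with h1 | ⟨i, -, hi⟩
  · rw [bin_C, eval_C] at h1; exact (hc h1).elim
  · exact Set.mem_iUnion.2 ⟨i, hi⟩

open scoped Classical in
/-- The finitely supported function with given values, if there is one, and `0` otherwise. -/
def toFinsupp {X : Type*} (D : X → ℤ) : X →₀ ℤ :=
  if h : (Function.support D).Finite then Finsupp.ofSupportFinite D h else 0

/-- The divisor of zeros on `B` of a form. -/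
def dv (t : Triple) (F : Poly) : DivB t := toFinsupp fun P : PtB t => (ord P F : ℤ)

lemma dv_apply {d : ℕ} {F : Poly} (hF : IsForm t d F) (P : PtB t) : dv t F P = ord P F := by
  rw [dv, toFinsupp, dif_pos hF.finite_support]; rfl

lemma dv_mul {m n : ℕ} {F G : Poly} (hF : IsForm t m F) (hG : IsForm t n G) :
    dv t (F * G) = dv t F + dv t G := by
  ext P
  rw [dv_apply (hF.mul hG), Finsupp.add_apply, dv_apply hF, dv_apply hG, ord_mul hF hG]
  push_cast; rfl

lemma dv_congr {F G : Poly} (h : F - G ∈ idealB t) : dv t F = dv t G :=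
  congrArg toFinsupp (funext fun P => by rw [ord_congr h])

lemma dv_C {c : Qbar} (hc : c ≠ 0) : dv t (C c) = 0 := by
  ext P
  rw [dv_apply (isForm_C hc), (ord_eq_zero_iff (isForm_C hc) P).2 (by simpa using hc)]
  rfl

/-- The action of a sign change on divisors. -/
def flipDiv (s : Signs) : DivB t →+ DivB t := Finsupp.mapDomain.addMonoidHom (s • ·)

lemma flipDiv_apply (s : Signs) (D : DivB t) (P : PtB t) : flipDiv s D (s • P) = D P :=
  Finsupp.mapDomain_apply (MulAction.injective s) D P

lemma flipDiv_apply' (s : Signs) (D : DivB t) (P : PtB t) : flipDiv s D P = D (s • P) := by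
  rw [← flipDiv_apply s D, smul_smul, signs_mul_self, one_smul]

lemma deg_flipDiv (s : Signs) (D : DivB t) : deg (flipDiv s D) = deg D := by
  have : (deg (X := PtB t)).comp (flipDiv s) = deg := by
    refine Finsupp.addHom_ext fun x n => ?_
    simp [deg, flipDiv]
  exact DFunLike.congr_fun this D

lemma dv_flip {d : ℕ} {F : Poly} (hF : IsForm t d F) (s : Signs) :
    dv t (flipPoly s F) = flipDiv s (dv t F) := by
  ext P
  rw [flipDiv_apply', dv_apply hF, dv_apply (hF.flip s), ← ord_flip (hF.flip s) s,
    flipPoly_flipPoly]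

/-- The zeros form one orbit. Summing s • P₀ over all eight signs counts each point as often as its
stabiliser has elements, which is its multiplicity. -/
lemma deg_dv_lin {r : Fin 2 → Qbar} (hr : r ≠ 0) : deg (dv t (bin (lin r))) = 8 := by
  classical
  obtain ⟨P₀, c, hc, hP₀⟩ := exists_pt_base t hr
  have h0 : ∀ P : PtB t, eval P.rep (bin (lin r)) = 0 → ∃ s : Signs, s • P₀ = P := fun P hP => by
    rw [eval_lin] at hP
    obtain ⟨s, hs⟩ := exists_flip_eq (P := P) (P₀ := P₀) (by
      rw [hP₀]; simp only [Pi.smul_apply, smul_eq_mul]; linear_combination c * hP)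
    exact ⟨s, hs.symm⟩
  have hlin : bin (lin P₀.base) = C c * bin (lin r) := by
    rw [hP₀]
    simp only [lin, Pi.smul_apply, smul_eq_mul, map_sub, map_mul, bin_C]
    ring
  have hord : ord P₀ (bin (lin r)) = ram P₀ := by
    rw [← ord_lin, hlin, ord_mul (isForm_C hc) (isForm_lin hr),
      (ord_eq_zero_iff (isForm_C hc) _).2 (by simpa using hc), zero_add]
  have : dv t (bin (lin r)) = ∑ s : Signs, Finsupp.single (s • P₀) 1 := by
    ext P
    rw [dv_apply (isForm_lin hr), Finsupp.finsetSum_apply]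
    simp only [Finsupp.single_apply, Finset.sum_boole]
    congr 1
    by_cases hP : eval P.rep (bin (lin r)) = 0
    · obtain ⟨s, rfl⟩ := h0 P hP
      have e1 : ord (s • P₀) (bin (lin r)) = ram P₀ := by
        rw [← flipPoly_bin s, ord_flip (isForm_lin hr), hord]
      rw [e1, ← card_stabilizer]
      refine Finset.card_bij (fun s' _ => s * s') (fun s' hs' => ?_) (fun _ _ _ _ h => by simpa using h)
        fun s' hs' => ⟨s * s', ?_, ?_⟩
      · rw [Finset.mem_filter_univ] at hs' ⊢
        rw [mul_smul, hs']
      · rw [Finset.mem_filter_univ] at hs' ⊢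
        rw [mul_smul, hs', smul_smul, signs_mul_self, one_smul]
      · rw [← mul_assoc, signs_mul_self, one_mul]
    · rw [(ord_eq_zero_iff (isForm_lin hr) P).2 hP, eq_comm, Finset.card_eq_zero,
        Finset.filter_eq_empty_iff]
      rintro s - rfl
      apply hP
      have h1 : eval P₀.rep (bin (lin r)) = 0 := by
        by_contra h
        rw [← ne_eq, ← ord_eq_zero_iff (isForm_lin hr), hord] at h
        unfold ram at h
        split_ifs at h
      by_contra h
      rw [← ne_eq, ← ord_eq_zero_iff (isForm_lin hr), ← flipPoly_bin s, ord_flip (isForm_lin hr),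
        ord_eq_zero_iff (isForm_lin hr)] at h
      exact h h1
  rw [this, map_sum]
  simp [deg_single]

lemma deg_dv_bin {n : ℕ} {A : MvPolynomial (Fin 2) Qbar} (hA : A.IsHomogeneous n) (h0 : A ≠ 0) :
    deg (dv t (bin A)) = 8 * n := by
  obtain ⟨c, r, hc, hr, rfl⟩ := exists_eq_prod_lin hA h0
  have key : ∀ (n : ℕ) (r : Fin n → Fin 2 → Qbar), (∀ i, r i ≠ 0) →
      IsForm t n (∏ i, bin (lin (r i))) ∧ deg (dv t (∏ i, bin (lin (r i)))) = 8 * n := by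
    intro n
    induction n with
    | zero =>
      intro r _
      have h1 := isForm_C (t := t) (one_ne_zero (α := Qbar))
      have h2 := dv_C (t := t) (one_ne_zero (α := Qbar))
      rw [C_1] at h1 h2
      simp only [Finset.univ_eq_empty, Finset.prod_empty]
      exact ⟨h1, by rw [h2]; simp⟩
    | succ n ih =>
      intro r hr
      obtain ⟨h1, h2⟩ := ih (fun i => r i.succ) fun i => hr i.succ
      rw [Fin.prod_univ_succ]
      have h3 := (isForm_lin (t := t) (hr 0)).mul h1
      rw [add_comm 1 n] at h3
      refine ⟨h3, ?_⟩
      rw [dv_mul (isForm_lin (hr 0)) h1, map_add, h2, deg_dv_lin (hr 0)]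
      push_cast; ring
  obtain ⟨h1, h2⟩ := key n r hr
  rw [map_mul, bin_C, map_prod, dv_mul (isForm_C hc) h1, dv_C hc, zero_add, h2]

/-- `B` has degree 8. -/
theorem deg_dv {d : ℕ} {F : Poly} (hF : IsForm t d F) : deg (dv t F) = 8 * d := by
  obtain ⟨A, hA, hmem⟩ := exists_bin_nrm t hF.1
  have hA0 : A ≠ 0 := by
    rintro rfl
    exact hF.nrm.2 (by simpa using hmem)
  have h1 := deg_dv_bin (t := t) hA hA0
  rw [← dv_congr hmem] at h1
  -- The norm has eight conjugate factors whose divisors have equal degrees, so 8 · deg equals the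
  -- degree 8 · 8d of a binary form of degree 8d.
  have h2 : dv t (EnriquesBranch.nrm F) = ∑ s : Signs, flipDiv s (dv t F) := by
    ext P
    have e : ∀ S : Finset Signs, phi P (∏ s ∈ S, flipPoly s F) ≠ 0 ∧
        ord P (∏ s ∈ S, flipPoly s F) = ∑ s ∈ S, ord P (flipPoly s F) := by
      intro S
      have h0 : ∀ s ∈ S, phi P (flipPoly s F) ≠ 0 := fun s _ => (hF.flip s).phi_ne_zero P
      refine ⟨by rw [map_prod]; exact Finset.prod_ne_zero_iff.2 h0, ?_⟩
      rw [ord, map_prod, PowerSeries.order_prod, ENat.toNat_sum]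
      · rfl
      · exact fun s hs => PowerSeries.order_eq_top.not.2 (h0 s hs)
    rw [dv_apply hF.nrm, EnriquesBranch.nrm, (e _).2, Finsupp.finsetSum_apply]
    push_cast
    exact Finset.sum_congr rfl fun s _ => by rw [← dv_flip hF, dv_apply (hF.flip s)]
  rw [h2, map_sum] at h1
  simp only [deg_flipDiv, Finset.sum_const, Finset.card_univ, card_signs] at h1
  simp only [nsmul_eq_mul] at h1
  push_cast at h1
  linarith

/-- A form on `B` is determined by its divisor, up to a constant. -/
theorem exists_const_of_dv_eq {d : ℕ} {F G : Poly} (hF : IsForm t d F) (hG : IsForm t d G)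
    (h : dv t F = dv t G) : ∃ c : Qbar, c ≠ 0 ∧ F - C c * G ∈ idealB t := by
  have hord : ∀ P, ord P F = ord P G := fun P => by
    have := DFunLike.congr_fun h P
    rw [dv_apply hF, dv_apply hG] at this
    exact_mod_cast this
  obtain ⟨P, -⟩ := exists_ptB t
  set m := ord P G with hm
  have hF0 : PowerSeries.coeff m (phi P F) ≠ 0 := by
    rw [hm, ← hord P]; exact PowerSeries.coeff_order (hF.phi_ne_zero P)
  have hG0 : PowerSeries.coeff m (phi P G) ≠ 0 := PowerSeries.coeff_order (hG.phi_ne_zero P)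
  -- The ratio of leading coefficients at one point P. If F - cG were nonzero, its divisor would be
  -- at least that of G, strictly at P, against the equality of degrees.
  refine ⟨PowerSeries.coeff m (phi P F) / PowerSeries.coeff m (phi P G), div_ne_zero hF0 hG0, ?_⟩
  set c := PowerSeries.coeff m (phi P F) / PowerSeries.coeff m (phi P G)
  by_contra hE
  have hE' : IsForm t d (F - C c * G) := ⟨hF.1.sub (hG.1.C_mul c), hE⟩
  have hphi : ∀ P : PtB t, phi P (F - C c * G) = phi P F - PowerSeries.C c * phi P G := fun P => by
    rw [map_sub, map_mul, algHom_C, PowerSeries.algebraMap_eq]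
  have hle : ∀ P : PtB t, ord P G ≤ ord P (F - C c * G) := fun P => by
    rw [le_ord hE', hphi]
    exact dvd_sub ((le_ord hF P).1 (hord P).ge) (((le_ord hG P).1 le_rfl).mul_left _)
  have hlt : m + 1 ≤ ord P (F - C c * G) := by
    rw [le_ord hE', hphi, PowerSeries.X_pow_dvd_iff]
    intro k hk
    rw [map_sub, PowerSeries.coeff_C_mul]
    rcases Nat.lt_succ_iff_lt_or_eq.1 hk with hk | rfl
    · rw [PowerSeries.X_pow_dvd_iff.1 ((le_ord hF P).1 (hord P).ge) k hk,
        PowerSeries.X_pow_dvd_iff.1 ((le_ord hG P).1 le_rfl) k hk, mul_zero, sub_zero]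
    · rw [div_mul_cancel₀ _ hG0, sub_self]
  have heq := eq_of_le_of_deg_le (D := dv t G) (E := dv t (F - C c * G)) (fun P => by
    rw [dv_apply hG, dv_apply hE']; exact_mod_cast hle P) (by rw [deg_dv hG, deg_dv hE'])
  have := DFunLike.congr_fun heq P
  rw [dv_apply hG, dv_apply hE'] at this
  have : ord P G = ord P (F - C c * G) := by exact_mod_cast this
  omega

end

section
variable {t : Triple}

/-! ### Principal divisors -/

lemma phi_C (P : PtB t) (c : Qbar) : phi P (C c) = PowerSeries.C c := by
  rw [algHom_C, PowerSeries.algebraMap_eq]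

lemma flipPoly_C (s : Signs) (c : Qbar) : flipPoly s (C c) = C c := by
  rw [algHom_C, algebraMap_eq]

/-- Divisors of quotients of forms are closed under sums and negatives, so the subgroup generated by
them adds nothing. -/
lemma mem_princB_iff {D : DivB t} : D ∈ princB t ↔
    ∃ (d : ℕ) (F G : Poly), IsForm t d F ∧ IsForm t d G ∧ D = dv t F - dv t G := by
  constructor
  · intro h
    refine AddSubgroup.closure_induction (p := fun D _ => ∃ (d : ℕ) (F G : Poly), IsForm t d F ∧
      IsForm t d G ∧ D = dv t F - dv t G) ?_ ?_ ?_ ?_ h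
    · rintro D ⟨F, G, ⟨⟨n, hF, hG⟩, hF', hG'⟩, hD⟩
      refine ⟨n, F, G, ⟨hF, hF'⟩, ⟨hG, hG'⟩, ?_⟩
      ext P
      obtain ⟨m₁, m₂, h1, h2, e⟩ := hD P
      rw [Finsupp.sub_apply, dv_apply ⟨hF, hF'⟩, dv_apply ⟨hG, hG'⟩, e,
        (IsForm.hasOrder ⟨hF, hF'⟩ P).1 h1, (IsForm.hasOrder ⟨hG, hG'⟩ P).1 h2]
    · exact ⟨0, C 1, C 1, isForm_C one_ne_zero, isForm_C one_ne_zero, (sub_self _).symm⟩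
    · rintro D D' - - ⟨d, F, G, hF, hG, rfl⟩ ⟨d', F', G', hF', hG', rfl⟩
      refine ⟨_, F * F', G * G', hF.mul hF', hG.mul hG', ?_⟩
      rw [dv_mul hF hF', dv_mul hG hG']; abel
    · rintro D - ⟨d, F, G, hF, hG, rfl⟩
      exact ⟨d, G, F, hG, hF, neg_sub _ _⟩
  · rintro ⟨d, F, G, hF, hG, rfl⟩
    refine AddSubgroup.subset_closure ⟨F, G, ⟨⟨d, hF.1, hG.1⟩, hF.2, hG.2⟩, fun P => ?_⟩
    exact ⟨_, _, (hF.hasOrder P).2 rfl, (hG.hasOrder P).2 rfl, by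
      rw [Finsupp.sub_apply, dv_apply hF, dv_apply hG]⟩

/-- `D` is the divisor of a rational function which a sign change divides by `c`. -/
def SemiInv (t : Triple) (s : Signs) (c : Qbar) (D : DivB t) : Prop :=
  ∃ (d : ℕ) (F G : Poly), IsForm t d F ∧ IsForm t d G ∧ D = dv t F - dv t G ∧
    F * flipPoly s G - C c * (flipPoly s F * G) ∈ idealB t

variable {s : Signs} {c c' : Qbar} {D D' : DivB t}

lemma SemiInv.zero (s : Signs) : SemiInv t s 1 0 :=
  ⟨0, C 1, C 1, isForm_C one_ne_zero, isForm_C one_ne_zero, (sub_self _).symm, by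
    simp⟩

lemma SemiInv.add (h : SemiInv t s c D) (h' : SemiInv t s c' D') :
    SemiInv t s (c * c') (D + D') := by
  obtain ⟨d, F, G, hF, hG, rfl, e⟩ := h
  obtain ⟨d', F', G', hF', hG', rfl, e'⟩ := h'
  refine ⟨_, F * F', G * G', hF.mul hF', hG.mul hG', ?_, ?_⟩
  · rw [dv_mul hF hF', dv_mul hG hG']; abel
  · rw [map_mul, map_mul, map_mul]
    have := add_mem ((idealB t).mul_mem_right (F' * flipPoly s G') e)
      ((idealB t).mul_mem_right (C c * (flipPoly s F * G)) e')
    convert this using 1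
    ring

lemma SemiInv.neg (h : SemiInv t s c D) (hc : c * c = 1) : SemiInv t s c (-D) := by
  obtain ⟨d, F, G, hF, hG, rfl, e⟩ := h
  refine ⟨d, G, F, hG, hF, neg_sub _ _, ?_⟩
  have := (idealB t).mul_mem_left (-C c) e
  convert this using 1
  have hc : (C c * C c : Poly) = 1 := by rw [← C_mul, hc, C_1]
  linear_combination -(flipPoly s F * G) * hc

/-- A function is determined by its divisor up to a constant, and the constant cancels in the
comparison with its conjugate. -/
lemma SemiInv.unique (h : SemiInv t s c D) (h' : SemiInv t s c' D) : c = c' := by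
  obtain ⟨d, F, G, hF, hG, rfl, e⟩ := h
  obtain ⟨d', F', G', hF', hG', hD, e'⟩ := h'
  obtain ⟨P, -⟩ := exists_ptB t
  have h1 : dv t (F * G') = dv t (F' * G) := by
    rw [dv_mul hF hG', dv_mul hF' hG]
    exact sub_eq_sub_iff_add_eq_add.1 hD
  obtain ⟨k, hk, hm⟩ := exists_const_of_dv_eq (hF.mul hG') (add_comm d' d ▸ hF'.mul hG) h1
  have hm' := flipPoly_mem s hm
  have e1 := phi_congr P e
  have e2 := phi_congr P e'
  have e3 := phi_congr P hm
  have e4 : phi P (flipPoly s F * flipPoly s G') = phi P (C k * (flipPoly s F' * flipPoly s G)) :=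
    phi_congr P (by simpa only [map_sub, map_mul, flipPoly_C] using hm')
  simp only [map_mul, phi_C] at e1 e2 e3 e4
  have n1 := hF.phi_ne_zero P
  have n2 := hG.phi_ne_zero P
  have n3 := hF'.phi_ne_zero P
  have n4 := hG'.phi_ne_zero P
  have m1 := (hF.flip s).phi_ne_zero P
  have m3 := (hF'.flip s).phi_ne_zero P
  have key : (PowerSeries.C c - PowerSeries.C c') *
      (phi P (flipPoly s F) * phi P G * (phi P (flipPoly s F') * phi P G')) = 0 := by
    linear_combination -(phi P (flipPoly s F') * phi P G') * e1 +
      (phi P (flipPoly s F) * phi P G) * e2 + (phi P (flipPoly s F') * phi P (flipPoly s G)) * e3 -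
      (phi P F' * phi P G) * e4
  have := (mul_eq_zero.1 key).resolve_right
    (mul_ne_zero (mul_ne_zero m1 n2) (mul_ne_zero m3 n4))
  exact PowerSeries.C_injective (sub_eq_zero.1 this)

lemma SemiInv.mem_princB (h : SemiInv t s c D) : D ∈ princB t := by
  obtain ⟨d, F, G, hF, hG, hD, -⟩ := h
  exact mem_princB_iff.2 ⟨d, F, G, hF, hG, hD⟩

/-- A function with divisor invariant under a sign change is an eigenfunction for it. -/
lemma exists_semiInv (h : D ∈ princB t) (hs : flipDiv s D = D) :
    SemiInv t s 1 D ∨ SemiInv t s (-1) D := by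
  obtain ⟨d, F, G, hF, hG, rfl⟩ := mem_princB_iff.1 h
  obtain ⟨P, -⟩ := exists_ptB t
  rw [map_sub, ← dv_flip hF, ← dv_flip hG] at hs
  obtain ⟨c, hc, hm⟩ := exists_const_of_dv_eq (hF.mul (hG.flip s)) ((hF.flip s).mul hG) (by
    rw [dv_mul hF (hG.flip s), dv_mul (hF.flip s) hG]
    exact (sub_eq_sub_iff_add_eq_add.1 hs).symm)
  have e1 := phi_congr P hm
  have e2 : phi P (flipPoly s F * G) = phi P (C c * (F * flipPoly s G)) := phi_congr P (by
    simpa only [map_sub, map_mul, flipPoly_C, flipPoly_flipPoly] using flipPoly_mem s hm)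
  simp only [map_mul, phi_C] at e1 e2
  -- The sign change is an involution, so applying the relation twice gives c² = 1.
  have key : (PowerSeries.C c * PowerSeries.C c - 1) * (phi P F * phi P (flipPoly s G)) = 0 := by
    linear_combination -e1 - PowerSeries.C c * e2
  have := (mul_eq_zero.1 key).resolve_right
    (mul_ne_zero (hF.phi_ne_zero P) ((hG.flip s).phi_ne_zero P))
  rw [← PowerSeries.C.map_mul, ← map_one PowerSeries.C, sub_eq_zero] at this
  rcases mul_self_eq_one_iff.1 (PowerSeries.C_injective this) with rfl | rfl
  · exact Or.inl ⟨d, F, G, hF, hG, rfl, hm⟩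
  · exact Or.inr ⟨d, F, G, hF, hG, rfl, hm⟩

lemma SemiInv.flipDiv_eq (h : SemiInv t s c D) (hc : c ≠ 0) : flipDiv s D = D := by
  obtain ⟨d, F, G, hF, hG, rfl, e⟩ := h
  have h1 := dv_congr e
  rw [dv_mul (isForm_C hc) ((hF.flip s).mul hG), dv_C hc, zero_add, dv_mul hF (hG.flip s),
    dv_mul (hF.flip s) hG, dv_flip hF, dv_flip hG] at h1
  rw [map_sub]
  exact sub_eq_sub_iff_add_eq_add.2 h1.symm

/-- On the branch at P the sign change is X ↦ -X; compare leading coefficients. -/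
lemma neg_one_pow_ord {P : PtB t} {j : Fin 3} (h : P.rep j.succ.succ = 0) {d : ℕ} {E : Poly}
    (hE : IsForm t d E) (hc : E - C c * flipPoly (flipOne j) E ∈ idealB t) :
    c = (-1) ^ ord P E := by
  have h1 := phi_congr P hc
  rw [map_mul, phi_C, ← evalNegHom_phi P h] at h1
  have h2 := congrArg (PowerSeries.coeff (ord P E)) h1
  rw [PowerSeries.coeff_C_mul, PowerSeries.evalNegHom, PowerSeries.coeff_rescale] at h2
  have h3 : PowerSeries.coeff (ord P E) (phi P E) ≠ 0 :=
    PowerSeries.coeff_order (hE.phi_ne_zero P)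
  have h4 : (c * (-1) ^ ord P E - 1) * PowerSeries.coeff (ord P E) (phi P E) = 0 := by
    linear_combination -h2
  have h5 := (mul_eq_zero.1 h4).resolve_right h3
  have h6 : ((-1 : Qbar) ^ ord P E) * (-1) ^ ord P E = 1 := by
    rw [← mul_pow]; norm_num
  linear_combination (-1) ^ ord P E * h5 - c * h6

/-- The sign by which a function is multiplied under a sign change fixing a point is the parity of
its order at this point. -/
lemma SemiInv.parity {j : Fin 3} (h : SemiInv t (flipOne j) c D) {P : PtB t}
    (hP : P.rep j.succ.succ = 0) : c = (-1) ^ D P := by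
  obtain ⟨d, F, G, hF, hG, rfl, e⟩ := h
  have h1 := neg_one_pow_ord hP (c := c) (hF.mul (hG.flip (flipOne j))) (by
    rwa [map_mul, flipPoly_flipPoly])
  have h2 : ord P (flipPoly (flipOne j) G) = ord P G := by
    conv_lhs => rw [← flipOne_smul_eq hP]
    exact ord_flip hG _ _
  rw [ord_mul hF (hG.flip _), h2] at h1
  rw [h1, Finsupp.sub_apply, dv_apply hF, dv_apply hG, zpow_sub₀ (by norm_num), pow_add]
  have : ((-1 : Qbar) ^ (ord P G : ℤ))⁻¹ = (-1) ^ ord P G := by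
    rw [zpow_natCast, ← inv_pow]; norm_num
  rw [div_eq_mul_inv, this, zpow_natCast]

lemma even_sub_of_neg_one_zpow_eq {k : Type*} [Field k] [NeZero (2 : k)] {m n : ℤ}
    (h : (-1 : k) ^ m = (-1) ^ n) : Even (m - n) := by
  by_contra ho
  rw [Int.not_even_iff_odd] at ho
  have h1 : (-1 : k) ^ (m - n) = 1 := by
    rw [zpow_sub₀ (by simp), h, div_self (zpow_ne_zero _ (by simp))]
  rw [ho.neg_one_zpow] at h1
  have : (2 : k) = 0 := by linear_combination -h1
  exact two_ne_zero this

/-! ### Principal divisors on the quotient -/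

/-- `sigmaPoly` and the sign change differ by (-1)^d on forms of degree d, and this factor cancels
in a quotient of forms of equal degree. -/
lemma isSigmaInvariant_iff {d : ℕ} {F G : Poly} (hF : F.IsHomogeneous d) (hG : G.IsHomogeneous d) :
    IsSigmaInvariant t F G ↔
      F * flipPoly sigmaSign G - C 1 * (flipPoly sigmaSign F * G) ∈ idealB t := by
  rw [IsSigmaInvariant, sigmaPoly_eq hF, sigmaPoly_eq hG]
  have e : (-1) ^ d * flipPoly sigmaSign F * G - F * ((-1) ^ d * flipPoly sigmaSign G) =
      (-1) ^ (d + 1) * (F * flipPoly sigmaSign G - C 1 * (flipPoly sigmaSign F * G)) := by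
    rw [C_1, pow_succ]; ring
  rw [e, Ideal.unit_mul_mem_iff_mem]
  exact (isUnit_one.neg).pow _

lemma pullDiv_injective (t : Triple) : Function.Injective (pullDiv t) := fun D D' h => by
  ext x
  obtain ⟨P, rfl⟩ := f_surjective t x
  exact DFunLike.congr_fun h P

lemma flipDiv_pullDiv (D : DivBt t) : flipDiv sigmaSign (pullDiv t D) = pullDiv t D := by
  ext P
  rw [flipDiv_apply', pullDiv_apply, pullDiv_apply, ← sigma_eq]
  exact congrArg D (f_eq_f.2 (Or.inr (sigma_sigma t P).symm))

/-- Functions on the quotient are the σ-invariant functions on `B`, that is, those with eigenvalue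
1. -/
lemma mem_princBt_iff {D : DivBt t} : D ∈ princBt t ↔ SemiInv t sigmaSign 1 (pullDiv t D) := by
  constructor
  · intro h
    refine AddSubgroup.closure_induction
      (p := fun D _ => SemiInv t sigmaSign 1 (pullDiv t D)) ?_ ?_ ?_ ?_ h
    · rintro D ⟨F, G, ⟨⟨n, hF, hG⟩, hF', hG'⟩, hs, hD⟩
      refine ⟨n, F, G, ⟨hF, hF'⟩, ⟨hG, hG'⟩, ?_, (isSigmaInvariant_iff hF hG).1 hs⟩
      ext P
      obtain ⟨m₁, m₂, h1, h2, e⟩ := hD P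
      rw [Finsupp.sub_apply, dv_apply ⟨hF, hF'⟩, dv_apply ⟨hG, hG'⟩, pullDiv_apply, e,
        (IsForm.hasOrder ⟨hF, hF'⟩ P).1 h1, (IsForm.hasOrder ⟨hG, hG'⟩ P).1 h2]
    · rw [map_zero]; exact .zero _
    · intro D D' _ _ h h'
      rw [map_add]; simpa using h.add h'
    · intro D _ h
      rw [map_neg]; exact h.neg (one_mul 1)
  · rintro ⟨d, F, G, hF, hG, hD, hs⟩
    refine AddSubgroup.subset_closure ⟨F, G, ⟨⟨d, hF.1, hG.1⟩, hF.2, hG.2⟩,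
      (isSigmaInvariant_iff hF.1 hG.1).2 hs, fun P => ?_⟩
    exact ⟨_, _, (hF.hasOrder P).2 rfl, (hG.hasOrder P).2 rfl, by
      rw [← pullDiv_apply, hD, Finsupp.sub_apply, dv_apply hF, dv_apply hG]⟩

/-- A pulled-back divisor is σ-invariant, so a function with this divisor is a σ-eigenfunction. The
second alternative is the only source of a kernel of f^*. -/
lemma pullDiv_mem_princB_iff {D : DivBt t} : pullDiv t D ∈ princB t ↔
    SemiInv t sigmaSign 1 (pullDiv t D) ∨ SemiInv t sigmaSign (-1) (pullDiv t D) :=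
  ⟨fun h => exists_semiInv h (flipDiv_pullDiv D), fun h => h.elim (·.mem_princB) (·.mem_princB)⟩

lemma deg_eq_zero_of_mem_princBt {D : DivBt t} (h : D ∈ princBt t) : deg D = 0 := by
  obtain ⟨d, F, G, hF, hG, hD, -⟩ := mem_princBt_iff.1 h
  have := deg_pullDiv t D
  rw [hD, map_sub, deg_dv hF, deg_dv hG, sub_self] at this
  omega

lemma exists_pullDiv_eq {E : DivB t} (h : flipDiv sigmaSign E = E) : ∃ D, pullDiv t D = E := by
  have h' : ∀ P, E (sigma t P) = E P := fun P => by
    rw [sigma_eq, ← flipDiv_apply', h]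
  let D : PtBt t → ℤ := Quotient.lift (s := orbitSetoid t) E (by
    rintro P Q (rfl | rfl)
    · rfl
    · exact (h' P).symm)
  have hD : ∀ P, D (f t P) = E P := fun P => rfl
  have hfin : (Function.support D).Finite := by
    refine (E.hasFiniteSupport.image (f t)).subset fun x hx => ?_
    obtain ⟨P, rfl⟩ := f_surjective t x
    exact ⟨P, hx, rfl⟩
  exact ⟨Finsupp.ofSupportFinite D hfin, by ext P; exact hD P⟩

end

section
variable {t : Triple}

/-! ### The image of a coordinate hyperplane in the quotient -/

lemma flip_rep_eq_zero_iff (s : Signs) (P : PtB t) (j : Fin 3) :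
    (s • P).rep j.succ.succ = 0 ↔ P.rep j.succ.succ = 0 := by
  obtain ⟨r, hr, h⟩ := flip_rep s P
  have : eps s j.succ.succ ≠ 0 := fun h0 => by simpa [h0] using eps_mul_self s j.succ.succ
  rw [h, mul_eq_zero, mul_eq_zero, or_iff_right hr, or_iff_right this]

/-- The image in the quotient of the points of `B` where a coordinate vanishes. -/
def wSet (t : Triple) (j : Fin 3) : Set (PtBt t) := f t '' {P | P.rep j.succ.succ = 0}

lemma f_mem_wSet {P : PtB t} {j : Fin 3} : f t P ∈ wSet t j ↔ P.rep j.succ.succ = 0 := by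
  constructor
  · rintro ⟨Q, hQ, h⟩
    rcases f_eq_f.1 h with rfl | rfl
    · exact hQ
    · rw [sigma_eq, flip_rep_eq_zero_iff]; exact hQ
  · exact fun h => ⟨P, h, rfl⟩

lemma wSet_eq (j : Fin 3) : f t '' {P | Vanishes (X j.succ.succ) P.1} = wSet t j := by
  congr 1
  ext P
  exact (vanishes_iff (isHomogeneous_X _ _)).trans (by rw [eval_X]; rfl)

lemma fVw0_eq : fVw0 t = wSet t 1 := wSet_eq 1

lemma fVw1_eq : fVw1 t = wSet t 2 := wSet_eq 2

lemma disjoint_wSet {i j : Fin 3} (h : i ≠ j) : Disjoint (wSet t i) (wSet t j) := by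
  refine Set.disjoint_left.2 fun x hi hj => ?_
  obtain ⟨P, rfl⟩ := f_surjective t x
  exact rep_ne_zero_of_ne (f_mem_wSet.1 hi) h (f_mem_wSet.1 hj)

open scoped Classical in
lemma dv_X_apply (j : Fin 3) (P : PtB t) :
    dv t (X j.succ.succ) P = if P.rep j.succ.succ = 0 then 1 else 0 := by
  rw [dv_apply (isForm_X j)]
  split_ifs with h
  · rw [ord_X h]; rfl
  · rw [(ord_eq_zero_iff (isForm_X j) P).2 (by simpa using h)]; rfl

lemma finite_wSet (t : Triple) (j : Fin 3) : (wSet t j).Finite := by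
  refine ((dv t (X j.succ.succ)).hasFiniteSupport.subset fun P hP => ?_).image _
  rw [Function.mem_support, dv_X_apply, if_pos (show P.rep j.succ.succ = 0 from hP)]
  exact one_ne_zero

/-- The sum of the points where a coordinate vanishes. -/
def edge (t : Triple) (j : Fin 3) : DivBt t := ∑ x ∈ (finite_wSet t j).toFinset, Finsupp.single x 1

open scoped Classical in
lemma edge_apply (j : Fin 3) (x : PtBt t) : edge t j x = if x ∈ wSet t j then 1 else 0 := by
  rw [edge, Finsupp.finsetSum_apply]
  simp [Finsupp.single_apply]

lemma pullDiv_edge (j : Fin 3) : pullDiv t (edge t j) = dv t (X j.succ.succ) := by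
  classical
  ext P
  rw [pullDiv_apply, edge_apply, dv_X_apply]
  simp only [f_mem_wSet]

/-- The j-th coordinate has eight simple zeros on `B`, and pulling back doubles degrees. -/
lemma deg_edge (j : Fin 3) : deg (edge t j) = 4 := by
  have := deg_pullDiv t (edge t j)
  rw [pullDiv_edge, deg_dv (isForm_X j)] at this
  push_cast at this
  omega

lemma card_wSet (t : Triple) (j : Fin 3) : (finite_wSet t j).toFinset.card = 4 := by
  have h := deg_edge (t := t) j
  rw [edge, map_sum] at h
  simp only [deg_single, Finset.sum_const, nsmul_eq_mul, mul_one] at h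
  exact_mod_cast h

/-! ### Lines through two points of the conic -/

lemma bin_lin (r : Fin 2 → Qbar) : bin (lin r) = C (r 1) * X 0 - C (r 0) * X 1 := by
  simp only [lin, bin, map_sub, map_mul, rename_X, rename_C]
  rfl

/-- A linear form in the first three coordinates vanishing at two points. -/
lemma exists_line {P Q : PtB t} (h : ∀ s : Signs, s 0 = 1 → Q ≠ s • P) :
    ∃ L : Poly, IsForm t 1 L ∧ (∀ s : Signs, s 0 = 1 → flipPoly s L = L) ∧
      eval P.rep L = 0 ∧ eval Q.rep L = 0 := by
  let p := P.rep
  let q := Q.rep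
  let L : Poly := C (p 0 * q 1 - p 1 * q 0) * X 2 +
    bin (lin ![-(p 2 * q 0 - p 0 * q 2), p 1 * q 2 - p 2 * q 1])
  have hL : L = C (p 0 * q 1 - p 1 * q 0) * X 2 + (C (p 1 * q 2 - p 2 * q 1) * X 0 -
    C (-(p 2 * q 0 - p 0 * q 2)) * X 1) := by
    simp only [L, bin_lin]
    rfl
  have hhom : L.IsHomogeneous 1 :=
    ((isHomogeneous_X _ _).C_mul _).add (isHomogeneous_bin (isHomogeneous_lin _))
  refine ⟨L, ⟨hhom, fun hmem => ?_⟩, fun s hs => ?_, ?_, ?_⟩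
  -- L is the determinant of the coordinate vector with p and q. If it vanished on `B`, subtracting
  -- its image under v₂ ↦ -v₂ would kill the coefficient of v₂, and then the binary part would
  -- vanish too, so p and q would be proportional.
  · have hm2 : p 0 * q 1 - p 1 * q 0 = 0 := by
      by_contra h0
      have h1 := flipPoly_mem (flipOne 0) hmem
      have e2 : eps (flipOne 0) (2 : Fin 5) = -1 := by
        have := eps_succ (flipOne 0) 0
        simpa [flipOne] using this
      have h2 : L - flipPoly (flipOne 0) L = C (2 * (p 0 * q 1 - p 1 * q 0)) * X 2 := by
        simp only [L, map_add, map_mul, flipPoly_bin, flipPoly_C, flipPoly_X, e2, C_neg, C_1]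
        have : (C (2 : Qbar) : Poly) = 2 := map_ofNat C 2
        rw [this]
        ring
      have h3 := sub_mem hmem h1
      rw [h2] at h3
      exact ((isForm_C (t := t) (mul_ne_zero two_ne_zero h0)).mul (isForm_X 0)).2 h3
    have hr : (![-(p 2 * q 0 - p 0 * q 2), p 1 * q 2 - p 2 * q 1] : Fin 2 → Qbar) = 0 := by
      by_contra hr
      have := (isForm_lin (t := t) hr).2
      simp only [L, hm2, C_0, zero_mul, zero_add] at hmem
      exact this hmem
    have r0 : p 2 * q 0 - p 0 * q 2 = 0 := neg_eq_zero.1 (congrFun hr 0)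
    have r1 : p 1 * q 2 - p 2 * q 1 = 0 := congrFun hr 1
    obtain ⟨s, hs⟩ := exists_flip_eq (P := Q) (P₀ := P) (by
      change p 1 * q 0 - p 0 * q 1 = 0
      linear_combination -hm2)
    rcases Int.units_eq_one_or (s 0) with h1 | h1
    · exact h s h1 hs
    · obtain ⟨r, hr0, hr⟩ := flip_rep s P
      have c0 : q 0 = r * p 0 := by
        have := hr 0
        rw [← hs] at this
        rw [show eps s 0 = 1 from eps_castLE s 0, one_mul] at this
        exact this
      have c1 : q 1 = r * p 1 := by
        have := hr 1
        rw [← hs] at this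
        rw [show eps s 1 = 1 from eps_castLE s 1, one_mul] at this
        exact this
      have c2 : q 2 = -r * p 2 := by
        have := hr 2
        rw [← hs] at this
        rw [show eps s 2 = -1 from (eps_succ s 0).trans (by simp [h1])] at this
        linear_combination this
      -- Proportionality of (v₀, v₁, v₂) together with the sign -1 on v₂ forces v₂(P) = 0. Then
      -- `flipOne 0` fixes P and the sign can be corrected, against the hypothesis.
      have hp2 : p 2 = 0 := by
        by_contra h2
        apply P.base_ne_zero
        rw [c0, c2] at r0
        rw [c1, c2] at r1
        ext i
        fin_cases i
        · change p 0 = 0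
          have : (2 * r * p 2) * p 0 = 0 := by linear_combination r0
          exact (mul_eq_zero.1 this).resolve_left
            (mul_ne_zero (mul_ne_zero two_ne_zero hr0) h2)
        · change p 1 = 0
          have : (2 * r * p 2) * p 1 = 0 := by linear_combination -r1
          exact (mul_eq_zero.1 this).resolve_left
            (mul_ne_zero (mul_ne_zero two_ne_zero hr0) h2)
      refine h (s * flipOne 0) (by simp [h1, flipOne]) ?_
      rw [mul_smul, flipOne_smul_eq (j := 0) hp2, ← hs]
  · have e2 : eps s (2 : Fin 5) = 1 := (eps_succ s 0).trans (by simp [hs])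
    simp only [L, map_add, map_mul, flipPoly_bin, flipPoly_C, flipPoly_X, e2, C_1, one_mul]
  · rw [hL]
    simp only [map_add, map_sub, map_mul, eval_C, eval_X]
    change (p 0 * q 1 - p 1 * q 0) * p 2 + ((p 1 * q 2 - p 2 * q 1) * p 0 -
      -(p 2 * q 0 - p 0 * q 2) * p 1) = 0
    ring
  · rw [hL]
    simp only [map_add, map_sub, map_mul, eval_C, eval_X]
    change (p 0 * q 1 - p 1 * q 0) * q 2 + ((p 1 * q 2 - p 2 * q 1) * q 0 -
      -(p 2 * q 0 - p 0 * q 2) * q 1) = 0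
    ring

/-! ### The hyperelliptic involution -/

/-- The Weierstrass points. -/
def weier (t : Triple) : Set (PtBt t) := wSet t 1 ∪ wSet t 2

lemma sigma_flip (s : Signs) (P : PtB t) : sigma t (s • P) = s • sigma t P := by
  rw [sigma_eq, sigma_eq, smul_smul, smul_smul, mul_comm]

/-- The action of sign changes on the quotient. -/
instance (t : Triple) : MulAction Signs (PtBt t) where
  smul s := Quotient.map (s • ·) (by
    rintro P Q (rfl | rfl)
    · exact Or.inl rfl
    · exact Or.inr (sigma_flip s P).symm)
  one_smul x := by
    obtain ⟨P, rfl⟩ := f_surjective t x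
    exact congrArg (f t) (one_smul _ P)
  mul_smul s s' x := by
    obtain ⟨P, rfl⟩ := f_surjective t x
    exact congrArg (f t) (mul_smul s s' P)

lemma flip_f (s : Signs) (P : PtB t) : s • f t P = f t (s • P) := rfl

lemma flipOne_mul_flipOne : (flipOne 1 * flipOne 2 : Signs) = sigmaSign := by
  ext j
  fin_cases j <;> simp [flipOne, sigmaSign]

lemma sigmaSign_smul (x : PtBt t) : sigmaSign • x = x := by
  obtain ⟨P, rfl⟩ := f_surjective t x
  rw [flip_f, ← sigma_eq]
  exact f_eq_f.2 (Or.inr (sigma_sigma t P).symm)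

/-- The sign changes of w₀ and of w₁ differ by σ, so on the quotient they induce one involution, the
hyperelliptic one. -/
lemma flipOne_two_smul (x : PtBt t) : (flipOne 2 : Signs) • x = (flipOne 1 : Signs) • x := by
  conv_rhs => rw [← sigmaSign_smul x, ← flipOne_mul_flipOne, smul_smul, ← mul_assoc,
    signs_mul_self, one_mul]

lemma signs_cases {s : Signs} (hs : s 0 = 1) :
    s = 1 ∨ s = flipOne 1 ∨ s = flipOne 2 ∨ s = sigmaSign := by
  rcases Int.units_eq_one_or (s 1) with h1 | h1 <;> rcases Int.units_eq_one_or (s 2) with h2 | h2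
  · left; ext j; fin_cases j <;> simp [hs, h1, h2]
  · right; right; left; ext j; fin_cases j <;> simp [hs, h1, h2, flipOne]
  · right; left; ext j; fin_cases j <;> simp [hs, h1, h2, flipOne]
  · right; right; right; ext j; fin_cases j <;> simp [hs, h1, h2, sigmaSign]

lemma smul_eq_or {s : Signs} (hs : s 0 = 1) (x : PtBt t) :
    s • x = x ∨ s • x = (flipOne 1 : Signs) • x := by
  rcases signs_cases hs with rfl | rfl | rfl | rfl
  · exact Or.inl (one_smul _ _)
  · exact Or.inr rfl
  · exact Or.inr (flipOne_two_smul x)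
  · exact Or.inl (sigmaSign_smul x)

/-- A fixed point on the quotient lifts to a point fixed by `flipOne 1` or sent by it to its
σ-conjugate, hence fixed by `flipOne 2`; these have w₀ = 0 and w₁ = 0 respectively. -/
lemma flipOne_smul_eq_iff {x : PtBt t} : (flipOne 1 : Signs) • x = x ↔ x ∈ weier t := by
  obtain ⟨P, rfl⟩ := f_surjective t x
  rw [weier, Set.mem_union, f_mem_wSet, f_mem_wSet, flip_f, f_eq_f]
  constructor
  · rintro (h | h)
    · left
      by_contra h1
      have := flip_eq_self_iff.1 h.symm 1 h1
      simp [flipOne] at this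
    · right
      by_contra h1
      rw [sigma_eq, ← flipOne_mul_flipOne, mul_comm] at h
      have h2 : (flipOne 2 : Signs) • P = P := by
        conv_rhs => rw [h, smul_smul, mul_assoc, signs_mul_self, mul_one]
      have := flip_eq_self_iff.1 h2 2 h1
      simp [flipOne] at this
  · rintro (h | h)
    · exact Or.inl (flipOne_smul_eq h).symm
    · right
      rw [sigma_eq, ← flipOne_mul_flipOne, smul_smul, mul_comm (flipOne 1), mul_assoc,
        signs_mul_self, mul_one, flipOne_smul_eq h]

lemma weier_smul (x : PtBt t) (s : Signs) : s • x ∈ weier t ↔ x ∈ weier t := by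
  obtain ⟨P, rfl⟩ := f_surjective t x
  rw [flip_f, weier, Set.mem_union, Set.mem_union, f_mem_wSet, f_mem_wSet, f_mem_wSet, f_mem_wSet,
    flip_rep_eq_zero_iff, flip_rep_eq_zero_iff]

/-- Over a Weierstrass point some `flipOne j` with j ≠ 0 acts on the branch by X ↦ -X, and L is
invariant under it. -/
lemma even_ord_of_flip_eq {P : PtB t} (hP : f t P ∈ weier t) {d : ℕ} {L : Poly}
    (hL : IsForm t d L) (hs : ∀ s : Signs, s 0 = 1 → flipPoly s L = L) : Even (ord P L) := by
  obtain ⟨j, hj, hj0⟩ : ∃ j : Fin 3, P.rep j.succ.succ = 0 ∧ j ≠ 0 := by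
    rw [weier, Set.mem_union, f_mem_wSet, f_mem_wSet] at hP
    rcases hP with h | h
    · exact ⟨1, h, by decide⟩
    · exact ⟨2, h, by decide⟩
  have := neg_one_pow_ord (c := 1) hj hL (by rw [hs _ (by simp [flipOne, hj0.symm])]; simp)
  by_contra ho
  rw [Nat.not_even_iff_odd] at ho
  rw [ho.neg_one_pow] at this
  norm_num at this

/-- The divisor of a line through the images of `x` and `y` in the conic. -/
lemma exists_dv_line {x y : PtBt t} (hx : x ≠ y) (hx' : x ≠ (flipOne 1 : Signs) • y) :
    ∃ L : Poly, IsForm t 1 L ∧ flipPoly sigmaSign L = L ∧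
      dv t L = pullDiv t (Finsupp.single x 1 + Finsupp.single ((flipOne 1 : Signs) • x) 1 +
        (Finsupp.single y 1 + Finsupp.single ((flipOne 1 : Signs) • y) 1)) := by
  classical
  obtain ⟨P, rfl⟩ := f_surjective t x
  obtain ⟨Q, rfl⟩ := f_surjective t y
  have hPQ : ∀ s : Signs, s 0 = 1 → P ≠ s • Q := by
    rintro s hs rfl
    rw [← flip_f] at hx hx'
    rcases smul_eq_or hs (f t Q) with h | h
    · exact hx h
    · exact hx' h
  obtain ⟨L, hL, hs, hQ0, hP0⟩ := exists_line hPQ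
  -- Both divisors have degree 8, so a pointwise inequality suffices.
  refine ⟨L, hL, hs _ rfl, (eq_of_le_of_deg_le (fun R => ?_) ?_).symm⟩
  · rw [dv_apply hL, pullDiv_apply]
    have hpos : ∀ S : PtB t, eval S.rep L = 0 → ∀ s : Signs, s 0 = 1 → 1 ≤ ord (s • S) L := by
      intro S hS s hs0
      have h1 := ord_flip hL s S
      rw [hs s hs0] at h1
      rw [h1, Nat.one_le_iff_ne_zero, ne_eq, ord_eq_zero_iff hL, not_not]
      exact hS
    have h2 : ∀ S : PtB t, eval S.rep L = 0 →
        Finsupp.single (f t S) 1 (f t R) +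
          Finsupp.single ((flipOne 1 : Signs) • f t S) 1 (f t R) ≤ (ord R L : ℤ) := by
      intro S hS
      have hR : ∀ s : Signs, s 0 = 1 → f t R = s • f t S → 1 ≤ ord R L := by
        intro s hs0 h
        rw [flip_f, f_eq_f] at h
        rcases h with h | h
        · rw [← h]; exact hpos S hS s hs0
        · have : R = (sigmaSign * s) • S := by
            rw [mul_smul, h, ← sigma_eq, sigma_sigma]
          rw [this]
          exact hpos S hS _ (by simp [sigmaSign, hs0])
      -- At a Weierstrass point the pencil counts the point twice, and evenness raises the order of
      -- L from at least 1 to at least 2.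
      by_cases hw : f t S ∈ weier t
      · rw [flipOne_smul_eq_iff.2 hw]
        by_cases hRS : f t S = f t R
        · have h1 := hR 1 rfl (by rw [one_smul, hRS])
          have h2 := even_ord_of_flip_eq (hRS ▸ hw) hL hs
          rw [hRS, Finsupp.single_eq_same]
          obtain ⟨k, hk⟩ := h2
          omega
        · simp [Finsupp.single_eq_of_ne (Ne.symm hRS)]
      · have hne : (flipOne 1 : Signs) • f t S ≠ f t S := fun h => hw (flipOne_smul_eq_iff.1 h)
        by_cases h1 : f t S = f t R
        · have := hR 1 rfl (by rw [one_smul, h1])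
          rw [← h1, Finsupp.single_eq_same, Finsupp.single_eq_of_ne hne.symm]
          omega
        · rw [Finsupp.single_eq_of_ne (Ne.symm h1)]
          by_cases h3 : (flipOne 1 : Signs) • f t S = f t R
          · have := hR (flipOne 1) rfl h3.symm
            rw [h3, Finsupp.single_eq_same]
            omega
          · rw [Finsupp.single_eq_of_ne (Ne.symm h3)]
            simp
    have hP2 := h2 P hP0
    have hQ2 := h2 Q hQ0
    simp only [Finsupp.add_apply]
    have hzero : ∀ S S' : PtBt t, (S ≠ S' ∧ S ≠ (flipOne 1 : Signs) • S') → f t R = S ∨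
        f t R = (flipOne 1 : Signs) • S →
        Finsupp.single S' (1:ℤ) (f t R) +
          Finsupp.single ((flipOne 1 : Signs) • S') 1 (f t R) = 0 := by
      rintro S S' ⟨h1, h2⟩ (h | h)
      · rw [h, Finsupp.single_eq_of_ne h1, Finsupp.single_eq_of_ne h2, add_zero]
      · rw [h, Finsupp.single_eq_of_ne, Finsupp.single_eq_of_ne, add_zero]
        · exact fun h => h1 (MulAction.injective _ h)
        · intro h
          apply h2
          rw [← h, smul_smul, signs_mul_self, one_smul]
    by_cases hRP : f t R = f t P ∨ f t R = (flipOne 1 : Signs) • f t P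
    · rw [hzero _ _ ⟨hx, hx'⟩ hRP, add_zero]
      exact hP2
    · rw [not_or] at hRP
      rw [Finsupp.single_eq_of_ne hRP.1, Finsupp.single_eq_of_ne hRP.2, zero_add, zero_add]
      exact hQ2
  · rw [deg_dv hL, deg_pullDiv]
    simp [deg_single]

end

section
variable {t : Triple}

/-! ### Relations between Weierstrass points -/

/-- The divisor of the hyperelliptic pencil through `x`. -/
def pencil (x : PtBt t) : DivBt t :=
  Finsupp.single x 1 + Finsupp.single ((flipOne 1 : Signs) • x) 1

lemma pencil_of_mem {x : PtBt t} (hx : x ∈ weier t) : pencil x = 2 • Finsupp.single x 1 := by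
  rw [pencil, flipOne_smul_eq_iff.2 hx, two_nsmul]

/-- There are eight Weierstrass points; this supplies auxiliary points in general position. -/
lemma exists_weier_notMem (s : Finset (PtBt t)) (hs : s.card < 8) : ∃ x ∈ weier t, x ∉ s := by
  classical
  have hd : Disjoint (finite_wSet t 1).toFinset (finite_wSet t 2).toFinset := by
    rw [Set.Finite.disjoint_toFinset]
    exact disjoint_wSet (by decide)
  have h8 : ((finite_wSet t 1).toFinset ∪ (finite_wSet t 2).toFinset).card = 8 := by
    rw [Finset.card_union_of_disjoint hd, card_wSet, card_wSet]
  obtain ⟨x, hx, hxs⟩ := Finset.exists_mem_notMem_of_card_lt_card (hs.trans_le h8.ge)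
  refine ⟨x, ?_, hxs⟩
  simpa [weier] using hx

lemma flip_eq_iff (s : Signs) (x y : PtBt t) : s • x = y ↔ x = s • y := by
  constructor
  · rintro rfl; rw [smul_smul, signs_mul_self, one_smul]
  · rintro rfl; rw [smul_smul, signs_mul_self, one_smul]

lemma exists_dv_eq_pencil {x y : PtBt t} (hx : x ≠ y) (hx' : x ≠ (flipOne 1 : Signs) • y) :
    ∃ L : Poly, IsForm t 1 L ∧ flipPoly sigmaSign L = L ∧
      dv t L = pullDiv t (pencil x + pencil y) := exists_dv_line hx hx'

/-- Choose z away from x, y and their conjugates: the quotient of the lines through x, z and through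
y, z has this divisor and is σ-invariant. -/
lemma pencil_sub_mem (x y : PtBt t) : pencil x - pencil y ∈ princBt t := by
  classical
  obtain ⟨z, -, hz⟩ := exists_weier_notMem {x, y, (flipOne 1 : Signs) • x, (flipOne 1 : Signs) • y}
    (Finset.card_le_four.trans_lt (by norm_num))
  simp only [Finset.mem_insert, Finset.mem_singleton, not_or] at hz
  obtain ⟨h1, h2, h3, h4⟩ := hz
  obtain ⟨L, hL, hs, hd⟩ := exists_dv_eq_pencil (x := x) (y := z) (Ne.symm h1)
    fun h => h3 ((flip_eq_iff _ _ _).2 h).symm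
  obtain ⟨L', hL', hs', hd'⟩ := exists_dv_eq_pencil (x := y) (y := z) (Ne.symm h2)
    fun h => h4 ((flip_eq_iff _ _ _).2 h).symm
  refine mem_princBt_iff.2 ⟨1, L, L', hL, hL', ?_, by rw [hs, hs']; simp⟩
  rw [hd, hd', ← map_sub]
  congr 1
  abel

/-- Divide the j-th coordinate, which σ negates for j ≠ 0, by the σ-invariant line through x and
another Weierstrass point y. The divisor is edge - 2x - 2y, and 2y ~ 2x with eigenvalue 1. -/
lemma semiInv_edge {j : Fin 3} (hj : j ≠ 0) {x : PtBt t} (hx : x ∈ weier t) :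
    SemiInv t sigmaSign (-1) (pullDiv t (edge t j - 4 • Finsupp.single x 1)) := by
  obtain ⟨y, hy, hxy⟩ := exists_weier_notMem {x} (by simp)
  rw [Finset.mem_singleton] at hxy
  obtain ⟨L, hL, hs, hd⟩ := exists_dv_eq_pencil (x := x) (y := y) (Ne.symm hxy)
    (by rw [flipOne_smul_eq_iff.2 hy]; exact Ne.symm hxy)
  have hX : flipPoly sigmaSign (X j.succ.succ) = -X j.succ.succ := by
    rw [flipPoly_X, eps_succ]
    fin_cases j
    · exact absurd rfl hj
    · simp [sigmaSign]
    · simp [sigmaSign]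
  have h1 : SemiInv t sigmaSign (-1) (pullDiv t (edge t j - (pencil x + pencil y))) :=
    ⟨1, X j.succ.succ, L, isForm_X j, hL, by rw [map_sub, pullDiv_edge, hd], by
      rw [hs, hX]; simp⟩
  have h2 := h1.add (mem_princBt_iff.1 (pencil_sub_mem y x))
  rw [← map_add, mul_one] at h2
  convert h2 using 2
  rw [pencil_of_mem hx, pencil_of_mem hy]
  abel

/-! ### The kernel of `f^*` -/

lemma ne_zero_of_semiInv {D : DivBt t} (h : SemiInv t sigmaSign (-1) (pullDiv t D)) :
    QuotientAddGroup.mk' (princBt t) D ≠ 0 := by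
  intro h0
  have h1 := (QuotientAddGroup.eq_zero_iff D).1 h0
  have := h.unique (mem_princBt_iff.1 h1)
  norm_num at this

lemma mk_mem_jacBt2 {D : DivBt t} (h0 : deg D = 0) (h2 : (2 : ℤ) • D ∈ princBt t) :
    QuotientAddGroup.mk' (princBt t) D ∈ jacBt2 t :=
  ⟨⟨D, h0, rfl⟩, (QuotientAddGroup.eq_zero_iff ((2 : ℤ) • D)).2 h2⟩

lemma fstar_mk_eq_zero_iff {D : DivBt t} (h : QuotientAddGroup.mk' (princBt t) D ∈ jacBt2 t) :
    fstar t ⟨_, h⟩ = 0 ↔ SemiInv t sigmaSign 1 (pullDiv t D) ∨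
      SemiInv t sigmaSign (-1) (pullDiv t D) := by
  rw [← pullDiv_mem_princB_iff, ← QuotientAddGroup.eq_zero_iff]
  exact Subtype.ext_iff

/-- The kernel of `f^*` has a unique nontrivial element. -/
theorem mem_ker_fstar_iff {W : PtBt t} (hW : W ∈ weier t) {κ : jacBt2 t}
    (hκ : (κ : PicBt t) = QuotientAddGroup.mk' (princBt t) (edge t 1 - 4 • Finsupp.single W 1))
    (x : jacBt2 t) : x ∈ (fstar t).ker ↔ x = 0 ∨ x = κ := by
  have h1 := semiInv_edge (j := 1) (by decide) hW
  obtain ⟨x, hx⟩ := x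
  obtain ⟨D, rfl⟩ := QuotientAddGroup.mk'_surjective _ x
  rw [AddMonoidHom.mem_ker, fstar_mk_eq_zero_iff]
  -- Eigenvalue 1 means that the class is zero on the quotient. Eigenvalue -1 means that it differs
  -- from κ, itself of eigenvalue -1, by a divisor of eigenvalue 1.
  refine or_congr ?_ ?_
  · rw [← mem_princBt_iff, ← QuotientAddGroup.eq_zero_iff, Subtype.ext_iff]; rfl
  · rw [Subtype.ext_iff, hκ]
    have e : QuotientAddGroup.mk' (princBt t) D =
        QuotientAddGroup.mk' (princBt t) (edge t 1 - 4 • Finsupp.single W 1) ↔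
        D - (edge t 1 - 4 • Finsupp.single W 1) ∈ princBt t := by
      rw [← sub_eq_zero, ← map_sub]
      exact QuotientAddGroup.eq_zero_iff _
    rw [e, mem_princBt_iff]
    constructor
    · intro h
      have := h.add (h1.neg (by norm_num))
      rw [← map_neg, ← map_add, ← sub_eq_add_neg] at this
      convert this using 1
      norm_num
    · intro h
      have := h.add h1
      rwa [← map_add, sub_add_cancel, one_mul] at this

lemma nonempty_addEquiv_zmod_two {G : Type*} [AddGroup G] {a : G} (ha : a ≠ 0)
    (h : ∀ x : G, x = 0 ∨ x = a) : Nonempty (G ≃+ ZMod 2) := by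
  have hc : Nat.card G = 2 := by
    rw [Nat.card_eq_two_iff]
    refine ⟨0, a, ha.symm, ?_⟩
    ext x
    simpa using h x
  have : IsAddCyclic G := isAddCyclic_of_prime_card (p := 2) hc
  exact ⟨(zmodAddCyclicAddEquiv this).symm.trans (ZMod.ringEquivCongr hc).toAddEquiv⟩

/-! ### Representing 2-torsion classes -/

/-- The hyperelliptic involution on divisors. -/
def hyp : DivBt t →+ DivBt t := Finsupp.mapDomain.addMonoidHom ((flipOne 1 : Signs) • ·)

lemma hyp_single (x : PtBt t) (n : ℤ) :
    hyp (Finsupp.single x n) = Finsupp.single ((flipOne 1 : Signs) • x) n :=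
  Finsupp.mapDomain_single

lemma hyp_apply (D : DivBt t) (x : PtBt t) : hyp D x = D ((flipOne 1 : Signs) • x) := by
  have h : hyp D ((flipOne 1 : Signs) • ((flipOne 1 : Signs) • x)) = D ((flipOne 1 : Signs) • x) :=
    Finsupp.mapDomain_apply (MulAction.injective _) D _
  rwa [smul_smul, signs_mul_self, one_smul] at h

lemma pullDiv_hyp (D : DivBt t) : pullDiv t (hyp D) = flipDiv (flipOne 1) (pullDiv t D) := by
  ext P
  rw [flipDiv_apply', pullDiv_apply, pullDiv_apply, hyp_apply, flip_f]

/-- D + hyp D is an integral combination of pencils, all equivalent, with total multiplicity deg D.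
-/
lemma add_hyp_mem {D : DivBt t} (hD : deg D = 0) : D + hyp D ∈ princBt t := by
  obtain ⟨y, -, -⟩ := exists_weier_notMem (t := t) ∅ (by simp)
  have : ∀ D : DivBt t, D + hyp D - deg D • pencil y ∈ princBt t := by
    intro D
    induction D using Finsupp.induction_linear with
    | zero => simp
    | add D D' h h' =>
      convert add_mem h h' using 1
      rw [map_add, map_add, add_smul]
      abel
    | single x n =>
      have e : Finsupp.single x n + hyp (Finsupp.single x n) - deg (Finsupp.single x n) • pencil y =
          n • (pencil x - pencil y) := by
        rw [hyp_single, deg_single, smul_sub]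
        congr 1
        rw [pencil, smul_add, Finsupp.smul_single, Finsupp.smul_single, smul_eq_mul, mul_one]
      rw [e]
      exact zsmul_mem (pencil_sub_mem x y) n
  simpa [hD] using this D

/-- Hilbert 90 for the hyperelliptic involution τ. If D - τD = div g, then g · τg is constant and
may be normalised to 1. For 1 + g ≠ 0 one has div(1 + g) - τ div(1 + g) = div g, so D - div(1 + g)
is τ-invariant. -/
lemma exists_hyp_eq {D : DivBt t} (hD : D - hyp D ∈ princBt t) :
    ∃ D', D - D' ∈ princBt t ∧ hyp D' = D' := by
  obtain ⟨d, F, G, hF, hG, hdiv, hs⟩ := mem_princBt_iff.1 hD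
  set τ : Signs := flipOne 1
  have hinv : dv t (F * flipPoly τ F) = dv t (G * flipPoly τ G) := by
    rw [dv_mul hF (hF.flip τ), dv_mul hG (hG.flip τ), dv_flip hF, dv_flip hG]
    have h1 := congrArg (flipDiv τ) hdiv
    rw [← pullDiv_hyp, map_sub hyp, map_sub] at h1
    have h2 : hyp (hyp D) = D := by
      ext x
      rw [hyp_apply, hyp_apply, smul_smul, signs_mul_self, one_smul]
    rw [h2, map_sub] at h1
    rw [map_sub] at hdiv
    rw [← sub_eq_zero]
    have : dv t F - dv t G + (flipDiv τ (dv t F) - flipDiv τ (dv t G)) = 0 := by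
      rw [← hdiv, ← h1]; abel
    rw [← this]; abel
  obtain ⟨k, hk, hm⟩ := exists_const_of_dv_eq (hF.mul (hF.flip τ)) (hG.mul (hG.flip τ)) hinv
  -- Rescaling G by a square root of the constant k normalises g = F / G' to satisfy g · τg = 1.
  obtain ⟨r, hr⟩ := IsAlgClosed.exists_pow_nat_eq k zero_lt_two
  have hr0 : r ≠ 0 := by rintro rfl; exact hk (by rw [← hr]; simp)
  obtain ⟨G₁, rfl⟩ : ∃ G₁, G₁ = C r * G := ⟨_, rfl⟩
  have hG1 : IsForm t d (C r * G) := by simpa using (isForm_C hr0).mul hG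
  have hdv1 : dv t (C r * G) = dv t G := by rw [dv_mul (isForm_C hr0) hG, dv_C hr0, zero_add]
  generalize hGG : C r * G = G' at hG1 hdv1
  have hm' : F * flipPoly τ F - G' * flipPoly τ G' ∈ idealB t := by
    rw [← hGG, map_mul, flipPoly_C]
    convert hm using 1
    rw [← hr, C_pow]; ring
  have hs' : F * flipPoly sigmaSign G' - flipPoly sigmaSign F * G' ∈ idealB t := by
    rw [← hGG, map_mul, flipPoly_C]
    convert (idealB t).mul_mem_left (C r) hs using 1
    rw [C_1]; ring
  -- Degenerate case g = -1: then div g = 0 and D is already invariant.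
  by_cases h0 : F + G' ∈ idealB t
  · refine ⟨D, by simp, ?_⟩
    have h1 : dv t F = dv t G := by
      have e : F - C (-1) * G' ∈ idealB t := by
        convert h0 using 1
        simp
      rw [dv_congr e, dv_mul (isForm_C (by norm_num)) hG1, dv_C (by norm_num), zero_add, hdv1]
    rw [h1, sub_self] at hdiv
    have := pullDiv_injective t (hdiv.trans (map_zero _).symm)
    exact (sub_eq_zero.1 this).symm
  · have hS : IsForm t d (F + G') := ⟨hF.1.add hG1.1, h0⟩
    have hsS : (F + G') * flipPoly sigmaSign G' - C 1 * (flipPoly sigmaSign (F + G') * G') ∈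
        idealB t := by
      convert hs' using 1
      rw [map_add, C_1]; ring
    have hU : SemiInv t sigmaSign 1 (dv t (F + G') - dv t G') := ⟨d, _, _, hS, hG1, rfl, hsS⟩
    obtain ⟨U, hU'⟩ := exists_pullDiv_eq (hU.flipDiv_eq one_ne_zero)
    rw [← hU'] at hU
    refine ⟨D - U, by simpa using mem_princBt_iff.2 hU, ?_⟩
    apply pullDiv_injective
    -- This is (1 + τg) · g = 1 + g with denominators cleared.
    have e : flipPoly τ (F + G') * F - flipPoly τ G' * (F + G') ∈ idealB t := by
      convert hm' using 1
      rw [map_add]; ring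
    have e1 := dv_congr e
    rw [dv_mul (hS.flip τ) hF, dv_mul (hG1.flip τ) hS, dv_flip hS, dv_flip hG1] at e1
    rw [map_sub hyp, map_sub, map_sub, pullDiv_hyp U, hU', map_sub (flipDiv τ)]
    rw [map_sub, ← hdv1] at hdiv
    rw [← sub_eq_zero] at hdiv e1 ⊢
    have e3 := congrArg₂ (· + ·) (congrArg (fun x => -x) hdiv) (congrArg (fun x => -x) e1)
    simp only [neg_zero, add_zero] at e3
    rw [← e3]
    abel

/-- A non-Weierstrass point x and its conjugate have the same coefficient n; subtracting n times
(pencil x - pencil y), with y a Weierstrass point, removes both without adding other non-Weierstrass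
points. -/
lemma exists_weier_support {D : DivBt t} (hD : hyp D = D) :
    ∃ D', D - D' ∈ princBt t ∧ ∀ x, D' x ≠ 0 → x ∈ weier t := by
  classical
  obtain ⟨y, hy, -⟩ := exists_weier_notMem (t := t) ∅ (by simp)
  generalize hn : (D.support.filter (· ∉ weier t)).card = n
  induction n using Nat.strong_induction_on generalizing D with
  | _ n ih =>
    by_cases h0 : ∀ x, D x ≠ 0 → x ∈ weier t
    · exact ⟨D, by simp, h0⟩
    push Not at h0
    obtain ⟨x, hx, hxw⟩ := h0
    have hne : (flipOne 1 : Signs) • x ≠ x := fun h => hxw (flipOne_smul_eq_iff.1 h)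
    have hyx : x ≠ y := by rintro rfl; exact hxw hy
    have hyx' : (flipOne 1 : Signs) • x ≠ y := by
      rintro rfl; rw [weier_smul] at hy; exact hxw hy
    have hDx : D ((flipOne 1 : Signs) • x) = D x := by rw [← hyp_apply, hD]
    let D₁ := D - D x • (pencil x - pencil y)
    have hval : ∀ z, z ∉ weier t → D₁ z =
        if z = x ∨ z = (flipOne 1 : Signs) • x then 0 else D z := by
      intro z hz
      have hzy : z ≠ y := by rintro rfl; exact hz hy
      simp only [D₁, pencil, flipOne_smul_eq_iff.2 hy, Finsupp.sub_apply, Finsupp.smul_apply,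
        Finsupp.add_apply, smul_eq_mul]
      rw [Finsupp.single_eq_of_ne hzy]
      by_cases h1 : z = x
      · subst h1
        rw [Finsupp.single_eq_same, Finsupp.single_eq_of_ne (Ne.symm hne)]
        simp
      · by_cases h2 : z = (flipOne 1 : Signs) • x
        · subst h2
          rw [Finsupp.single_eq_same, Finsupp.single_eq_of_ne hne]
          simp [hDx]
        · rw [Finsupp.single_eq_of_ne h1, Finsupp.single_eq_of_ne h2]
          simp [h1, h2]
    have hD₁ : hyp D₁ = D₁ := by
      have hp : ∀ z : PtBt t, hyp (pencil z) = pencil z := fun z => by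
        rw [pencil, map_add, hyp_single, hyp_single, smul_smul, signs_mul_self, one_smul, add_comm]
      simp only [D₁]
      rw [map_sub, map_zsmul, map_sub, hp, hp, hD]
    have hlt : (D₁.support.filter (· ∉ weier t)).card < n := by
      rw [← hn]
      refine Finset.card_lt_card ((Finset.ssubset_iff_of_subset fun z hz => ?_).2 ⟨x, ?_, ?_⟩)
      · rw [Finset.mem_filter, Finsupp.mem_support_iff] at hz ⊢
        refine ⟨fun h => hz.1 ?_, hz.2⟩
        rw [hval z hz.2, h, ite_self]
      · simp [hx, hxw]
      · simp [hval x hxw]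
    obtain ⟨D', h1, h2⟩ := ih _ hlt hD₁ rfl
    refine ⟨D', ?_, h2⟩
    have := add_mem h1 (zsmul_mem (pencil_sub_mem x y) (D x))
    convert this using 1
    simp only [D₁]
    abel

/-- Divisors of degree 0 supported in the Weierstrass points. -/
def weierDiv (t : Triple) : AddSubgroup (DivBt t) where
  carrier := {D | deg D = 0 ∧ ∀ x, D x ≠ 0 → x ∈ weier t}
  zero_mem' := ⟨map_zero _, by simp⟩
  add_mem' := by
    rintro D D' ⟨h1, h2⟩ ⟨h1', h2'⟩
    refine ⟨by rw [map_add, h1, h1', add_zero], fun x hx => ?_⟩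
    by_contra hw
    have e1 := not_not.1 fun h => hw (h2 x h)
    have e2 := not_not.1 fun h => hw (h2' x h)
    exact hx (by rw [Finsupp.add_apply, e1, e2, add_zero])
  neg_mem' := by
    rintro D ⟨h1, h2⟩
    exact ⟨by rw [map_neg, h1, neg_zero], fun x hx => h2 x (by simpa using hx)⟩

/-- The involution fixes such a D, so 2D = D + hyp D. -/
lemma two_zsmul_mem {D : DivBt t} (hD : D ∈ weierDiv t) : (2 : ℤ) • D ∈ princBt t := by
  have := add_hyp_mem hD.1
  have h2 : hyp D = D := by
    ext x
    rw [hyp_apply]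
    by_cases hx : x ∈ weier t
    · rw [flipOne_smul_eq_iff.2 hx]
    · have e1 := not_not.1 fun h => hx (hD.2 x h)
      have e2 := not_not.1 fun h => (weier_smul x (flipOne 1)).not.2 hx (hD.2 _ h)
      rw [e1, e2]
  rwa [h2, ← two_zsmul] at this

/-- From 2D ~ 0 and D + hyp D ~ 0 follows D - hyp D ~ 0. Thus D can be made hyp-invariant, and then
moved onto the Weierstrass points. -/
lemma exists_weierDiv (x : jacBt2 t) :
    ∃ D ∈ weierDiv t, (x : PicBt t) = QuotientAddGroup.mk' (princBt t) D := by
  obtain ⟨x, ⟨D, hD, rfl⟩, h2⟩ := x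
  have h2 : (2 : ℤ) • D ∈ princBt t := (QuotientAddGroup.eq_zero_iff ((2 : ℤ) • D)).1 h2
  have hD : deg D = 0 := hD
  obtain ⟨D₁, h3, h4⟩ := exists_hyp_eq (D := D) (by
    convert sub_mem h2 (add_hyp_mem hD) using 1
    rw [two_zsmul]; abel)
  obtain ⟨D₂, h5, h6⟩ := exists_weier_support h4
  have h7 : D - D₂ ∈ princBt t := by
    convert add_mem h3 h5 using 1
    abel
  refine ⟨D₂, ⟨?_, h6⟩, ?_⟩
  · have := deg_eq_zero_of_mem_princBt h7
    rw [map_sub, hD] at this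
    omega
  · change QuotientAddGroup.mk' (princBt t) D = _
    rw [← sub_eq_zero, ← map_sub]
    exact (QuotientAddGroup.eq_zero_iff _).2 h7

end

section
variable {t : Triple}

/-! ### Parity of divisors supported in the Weierstrass points -/

lemma wSet_subset_weier {j : Fin 3} (hj : j ≠ 0) : wSet t j ⊆ weier t := by
  fin_cases j
  · exact absurd rfl hj
  · exact Set.subset_union_left
  · exact Set.subset_union_right

lemma flipDiv_pullDiv_of_mem {D : DivBt t} (hD : D ∈ weierDiv t) (s : Signs) (hs : s 0 = 1) :
    flipDiv s (pullDiv t D) = pullDiv t D := by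
  ext P
  rw [flipDiv_apply', pullDiv_apply, pullDiv_apply, ← flip_f]
  by_cases hx : f t P ∈ weier t
  · rcases smul_eq_or hs (f t P) with h | h
    · rw [h]
    · rw [h, flipOne_smul_eq_iff.2 hx]
  · rw [not_not.1 fun h => hx (hD.2 _ h), not_not.1 fun h => (weier_smul _ s).not.2 hx (hD.2 _ h)]

/-- A function with this divisor is an eigenfunction of `flipOne j`, and its sign is the parity of
its order at every point where the j-th coordinate vanishes. -/
lemma even_sub_of_mem_princB {D : DivBt t} (hD : D ∈ weierDiv t) (h : pullDiv t D ∈ princB t)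
    {j : Fin 3} (hj : j ≠ 0) {x y : PtBt t} (hx : x ∈ wSet t j) (hy : y ∈ wSet t j) :
    Even (D x - D y) := by
  obtain ⟨P, hP, rfl⟩ := hx
  obtain ⟨Q, hQ, rfl⟩ := hy
  have hs := flipDiv_pullDiv_of_mem hD (flipOne j) (by simp [flipOne, hj.symm])
  rcases exists_semiInv h hs with h | h
  · exact even_sub_of_neg_one_zpow_eq ((h.parity hP).symm.trans (h.parity hQ))
  · exact even_sub_of_neg_one_zpow_eq ((h.parity hP).symm.trans (h.parity hQ))

/-- D is twice the degree-zero divisor D/2, still supported in the Weierstrass points. -/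
lemma mem_princBt_of_even {D : DivBt t} (hD : D ∈ weierDiv t) (h : ∀ x, Even (D x)) :
    D ∈ princBt t := by
  have hM : (2 : ℤ) • (D.mapRange (· / 2) (by norm_num) : DivBt t) = D := by
    ext x
    rw [Finsupp.smul_apply, Finsupp.mapRange_apply, smul_eq_mul]
    exact Int.mul_ediv_cancel' (h x).two_dvd
  rw [← hM]
  refine two_zsmul_mem ⟨?_, fun x hx => hD.2 x fun h0 => hx (by simp [h0])⟩
  have := hD.1
  rw [← hM, map_zsmul, smul_eq_mul] at this
  omega

lemma edge_sub_mem {i j : Fin 3} (hi : i ≠ 0) (hj : j ≠ 0) {x : PtBt t} (hx : x ∈ wSet t j) :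
    edge t i - 4 • Finsupp.single x 1 ∈ weierDiv t := by
  refine ⟨by rw [map_sub, deg_edge, map_nsmul, deg_single]; simp, fun y hy => ?_⟩
  by_contra hw
  apply hy
  rw [Finsupp.sub_apply, edge_apply, if_neg fun h => hw (wSet_subset_weier hi h),
    Finsupp.smul_apply, Finsupp.single_eq_of_ne]
  · simp
  · rintro rfl; exact hw (wSet_subset_weier hj hx)

lemma exists_mem_wSet (t : Triple) (j : Fin 3) : ∃ x, x ∈ wSet t j := by
  obtain ⟨P, hP⟩ := exists_pt_eq_zero t j
  exact ⟨f t P, P, hP, rfl⟩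

/-- For the converse, subtract from D multiples of edge 1 - 4x₁ and edge 2 - 4x₁, whose pullbacks
are principal, to make all coefficients even. The multiples of 4x₁ do not affect parity. -/
lemma pullDiv_mem_princB_iff_even {D : DivBt t} (hD : D ∈ weierDiv t) :
    pullDiv t D ∈ princB t ↔
      ∀ j : Fin 3, j ≠ 0 → ∀ x ∈ wSet t j, ∀ y ∈ wSet t j, Even (D x - D y) := by
  classical
  refine ⟨fun h j hj x hx y hy => even_sub_of_mem_princB hD h hj hx hy, fun h => ?_⟩
  obtain ⟨x₁, h1⟩ := exists_mem_wSet t 1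
  obtain ⟨x₂, h2⟩ := exists_mem_wSet t 2
  have m1 := edge_sub_mem (i := 1) (by decide) (by decide) h1
  have m2 := edge_sub_mem (i := 2) (by decide) (by decide) h1
  have hD' := sub_mem (sub_mem hD (zsmul_mem m1 (D x₁))) (zsmul_mem m2 (D x₂))
  have hp := mem_princBt_of_even hD' fun x => by
    simp only [Finsupp.sub_apply, Finsupp.smul_apply, edge_apply, smul_eq_mul, nsmul_eq_mul]
    have e4 : Even (D x₁ * ((4 : ℕ) * (Finsupp.single x₁ (1 : ℤ)) x) +
        D x₂ * ((4 : ℕ) * (Finsupp.single x₁ (1 : ℤ)) x)) :=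
      ⟨D x₁ * (2 * (Finsupp.single x₁ (1 : ℤ)) x) + D x₂ * (2 * (Finsupp.single x₁ (1 : ℤ)) x), by
        push_cast; ring⟩
    by_cases c1 : x ∈ wSet t 1
    · have c2 : x ∉ wSet t 2 := Set.disjoint_left.1 (disjoint_wSet (by decide)) c1
      rw [if_pos c1, if_neg c2]
      refine (congrArg Even ?_).mpr ((h 1 (by decide) x c1 x₁ h1).add e4)
      ring
    · by_cases c2 : x ∈ wSet t 2
      · rw [if_neg c1, if_pos c2]
        refine (congrArg Even ?_).mpr ((h 2 (by decide) x c2 x₂ h2).add e4)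
        ring
      · rw [if_neg c1, if_neg c2, not_not.1 fun h => (hD.2 x h).elim c1 c2]
        convert e4 using 1
        ring
  have hw := wSet_subset_weier (t := t) (j := 1) (by decide) h1
  have p0 := (mem_princBt_iff.1 hp).mem_princB
  have p1 := zsmul_mem (semiInv_edge (j := 1) (by decide) hw).mem_princB (D x₁)
  have p2 := zsmul_mem (semiInv_edge (j := 2) (by decide) hw).mem_princB (D x₂)
  rw [← map_zsmul] at p1 p2
  have := add_mem (add_mem p0 p1) p2
  rw [← map_add, ← map_add] at this
  convert this using 2
  abel

/-! ### The image of `f^*` -/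

/-- The class in the image of `f^*` of a divisor supported in the Weierstrass points. -/
def imClass (t : Triple) : weierDiv t →+ imF t :=
  (fstar t).rangeRestrict.comp
    (((QuotientAddGroup.mk' (princBt t)).comp (weierDiv t).subtype).codRestrict (jacBt2 t)
      fun D => mk_mem_jacBt2 D.2.1 (two_zsmul_mem D.2))

lemma imClass_surjective : Function.Surjective (imClass t) := by
  rintro ⟨_, x, rfl⟩
  obtain ⟨D, hD, h⟩ := exists_weierDiv x
  exact ⟨⟨D, hD⟩, Subtype.ext (congrArg (fstar t) (Subtype.ext h.symm))⟩

lemma imClass_eq_zero_iff (D : weierDiv t) : imClass t D = 0 ↔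
    ∀ j : Fin 3, j ≠ 0 → ∀ x ∈ wSet t j, ∀ y ∈ wSet t j, Even (D.1 x - D.1 y) := by
  rw [← pullDiv_mem_princB_iff_even D.2, pullDiv_mem_princB_iff,
    ← fstar_mk_eq_zero_iff (mk_mem_jacBt2 D.2.1 (two_zsmul_mem D.2))]
  exact Subtype.ext_iff

/-- The value at `x` minus the value at `y`, modulo 2. -/
def valDiff (x y : PtBt t) : weierDiv t →+ ZMod 2 where
  toFun D := ((D.1 x - D.1 y : ℤ) : ZMod 2)
  map_zero' := by simp
  map_add' D E := by push_cast; simp; ring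

/-- Parities are defined on the image of f^* only up to a constant on each of the two sets, so
differences within one set descend to functionals. All such functionals together separate the points
of the image. -/
lemma exists_imDiff (x y : PtBt t) {j : Fin 3} (hj : j ≠ 0) (hx : x ∈ wSet t j)
    (hy : y ∈ wSet t j) : ∃ φ : imF t →+ ZMod 2, ∀ D, φ (imClass t D) = valDiff x y D := by
  refine ⟨(imClass t).liftOfSurjective imClass_surjective ⟨valDiff x y, fun D hD => ?_⟩, fun D => ?_⟩
  · have := (imClass_eq_zero_iff D).1 hD j hj x hx y hy
    exact (ZMod.intCast_zmod_eq_zero_iff_dvd _ 2).2 this.two_dvd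
  · exact (imClass t).liftOfRightInverse_comp_apply _ _ _ D

end

section
variable {t : Triple}

/-! ### The Galois action on the Weierstrass points -/

lemma gal_rep (g : GK0) (P : PtB t) :
    ∃ r : Qbar, r ≠ 0 ∧ ∀ i, (g • P).rep i = r * g (P.rep i) := by
  have hx : galLin g P.rep ≠ 0 := fun h =>
    P.rep_ne_zero (galLin_injective g (h.trans (map_zero _).symm))
  have h : (g • P).1 = Projectivization.mk Qbar (galLin g P.rep) hx := by
    rw [smul_val]
    conv_lhs => rw [← Projectivization.mk_rep P.1]
    rfl
  obtain ⟨a, ha⟩ := Projectivization.exists_smul_eq_mk_rep Qbar (galLin g P.rep) hx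
  refine ⟨a, a.ne_zero, fun i => ?_⟩
  rw [PtB.rep, h, ← ha]
  rfl

lemma gal_mem_wSet (g : GK0) (x : PtBt t) (j : Fin 3) : g • x ∈ wSet t j ↔ x ∈ wSet t j := by
  obtain ⟨P, rfl⟩ := f_surjective t x
  obtain ⟨r, hr, h⟩ := gal_rep g P
  rw [smul_f, f_mem_wSet, f_mem_wSet, h, mul_eq_zero, or_iff_right hr]
  exact map_eq_zero_iff g g.injective

lemma flip_mem_wSet (s : Signs) (x : PtBt t) (j : Fin 3) : s • x ∈ wSet t j ↔ x ∈ wSet t j := by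
  obtain ⟨P, rfl⟩ := f_surjective t x
  rw [flip_f, f_mem_wSet, f_mem_wSet, flip_rep_eq_zero_iff]

lemma galP4_flipP4 (g : GK0) (s : Signs) (P : P4) : galP4 g (flipP4 s P) = flipP4 s (galP4 g P) := by
  induction P using Projectivization.ind with
  | h v hv =>
    simp only [galP4, flipP4, Projectivization.map_mk]
    congr 1
    ext i
    simp only [galLin_apply, flipLin, LinearMap.coe_mk, AddHom.coe_mk, map_mul]
    congr 1
    exact map_intCast g _

lemma gal_flip (g : GK0) (s : Signs) (x : PtBt t) : g • s • x = s • g • x := by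
  obtain ⟨P, rfl⟩ := f_surjective t x
  exact congrArg (f t) (Subtype.ext (galP4_flipP4 g s P.1))

lemma galDiv_mem_weierDiv (g : GK0) {D : DivBt t} (hD : D ∈ weierDiv t) :
    galDiv g D ∈ weierDiv t := by
  refine ⟨by rw [deg_galDiv, hD.1], fun x hx => ?_⟩
  obtain ⟨x, rfl⟩ := MulAction.surjective g x
  change galDiv g D (g • x) ≠ 0 at hx
  rw [galDiv_apply] at hx
  have := hD.2 x hx
  rw [weier, Set.mem_union] at this ⊢
  change g • x ∈ wSet t 1 ∨ g • x ∈ wSet t 2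
  rwa [gal_mem_wSet, gal_mem_wSet]

lemma smul_imClass (g : GK0) (D : weierDiv t) :
    g • imClass t D = imClass t ⟨galDiv g D.1, galDiv_mem_weierDiv g D.2⟩ :=
  Subtype.ext (fstar_smul t g _).symm

/-- A coordinate on the quotient, whose restriction to a set of four Weierstrass points identifies
these with the roots of a biquadratic equation. -/
structure RootCoord (t : Triple) (j : Fin 3) (d : ℤ) where
  y : PtBt t → Qbar
  inj : Set.InjOn y (wSet t j)
  ne_zero : ∀ x ∈ wSet t j, y x ≠ 0
  gal : ∀ (g : GK0) (x : PtBt t), x ∈ wSet t j → y (g • x) = g (y x)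
  flip : ∀ x, x ∈ wSet t j → y ((flipOne 0 : Signs) • x) = -y x
  α : Qbar
  β : Qbar
  κ : Qbar
  α_ne_zero : α ≠ 0
  κ_ne_zero : κ ≠ 0
  gal_κ : ∀ g : GK0, g κ = κ
  eq_zero : ∀ x ∈ wSet t j, α * y x ^ 4 + β * y x ^ 2 + α * κ ^ 2 * d = 0

/-- The orbit structure of the Galois group on four Weierstrass points. -/
structure IsFrame (t : Triple) (j : Fin 3) (d : ℤ) (x₁ x₂ x₃ x₄ : PtBt t) : Prop where
  mem : x₁ ∈ wSet t j ∧ x₂ ∈ wSet t j ∧ x₃ ∈ wSet t j ∧ x₄ ∈ wSet t j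
  ne : x₁ ≠ x₂ ∧ x₁ ≠ x₃ ∧ x₁ ≠ x₄ ∧ x₂ ≠ x₃ ∧ x₂ ≠ x₄ ∧ x₃ ≠ x₄
  eq_or : ∀ x ∈ wSet t j, x = x₁ ∨ x = x₂ ∨ x = x₃ ∨ x = x₄
  gal_mem : ∀ g ∈ galSqrt d, (g • x₁ = x₁ ∧ g • x₂ = x₂) ∨ (g • x₁ = x₂ ∧ g • x₂ = x₁) ∨
    (g • x₁ = x₃ ∧ g • x₂ = x₄) ∨ (g • x₁ = x₄ ∧ g • x₂ = x₃)
  gal_notMem : ∀ g ∉ galSqrt d, (g • x₁ = x₁ ∧ g • x₂ = x₄) ∨ (g • x₁ = x₄ ∧ g • x₂ = x₁) ∨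
    (g • x₁ = x₃ ∧ g • x₂ = x₂) ∨ (g • x₁ = x₂ ∧ g • x₂ = x₃)

lemma mem_galSqrt_iff {d : ℤ} {θ : Qbar} (hθ : θ ^ 2 = d) {g : GK0} :
    g ∈ galSqrt d ↔ g θ = θ := by
  rw [galSqrt, IntermediateField.mem_fixingSubgroup_iff]
  constructor
  · exact fun h => h θ (IntermediateField.subset_adjoin _ _ hθ)
  · intro h x hx
    induction hx using IntermediateField.adjoin_induction with
    | mem x hx =>
      have hx : x ^ 2 = d := hx
      rcases sq_eq_sq_iff_eq_or_eq_neg.1 (hx.trans hθ.symm) with rfl | rfl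
      · exact h
      · rw [map_neg, h]
    | algebraMap x => exact g.commutes x
    | add x y _ _ hx hy => rw [map_add, hx, hy]
    | inv x _ hx => rw [map_inv₀, hx]
    | mul x y _ _ hx hy => rw [map_mul, hx, hy]

lemma mem_K0_of_fixed {x : Qbar} (h : ∀ g : GK0, g x = x) : x ∈ K0 := by
  have : Algebra.IsAlgebraic ℚ Qbar := AlgebraicClosure.isAlgebraic ℚ
  have : Algebra.IsAlgebraic K0 Qbar := Algebra.IsAlgebraic.tower_top (K := ℚ) K0
  have : IsAlgClosure K0 Qbar := ⟨inferInstance, inferInstance⟩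
  have : IsGalois K0 Qbar :=
    { to_isSeparable := inferInstance, to_normal := IsAlgClosure.normal K0 Qbar }
  obtain ⟨y, rfl⟩ := (InfiniteGalois.mem_range_algebraMap_iff_fixed x).2 h
  exact y.2

lemma gal_apply_of_mem {x : Qbar} (hx : x ∈ K0) (g : GK0) : g x = x := g.commutes ⟨x, hx⟩

lemma exists_notMem_galSqrt {d : ℤ} (hd : ∀ x ∈ K0, x ^ 2 ≠ (d : Qbar)) : ∃ g, g ∉ galSqrt d := by
  obtain ⟨θ, hθ⟩ := IsAlgClosed.exists_pow_nat_eq (d : Qbar) zero_lt_two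
  by_contra! h
  exact hd θ (mem_K0_of_fixed fun g => (mem_galSqrt_iff hθ).1 (h g)) hθ

/-- A coordinate determines the orbit structure. -/
lemma RootCoord.exists_isFrame {j : Fin 3} {d : ℤ} (R : RootCoord t j d) :
    ∃ x₁ x₂ x₃ x₄, IsFrame t j d x₁ x₂ x₃ x₄ := by
  classical
  let ν : PtBt t → PtBt t := fun x => (flipOne 0 : Signs) • x
  have hν : ∀ x, ν x ∈ wSet t j ↔ x ∈ wSet t j := fun x => flip_mem_wSet _ x j
  have hνν : ∀ x, ν (ν x) = x := fun x => by
    simp only [ν]; rw [smul_smul, signs_mul_self, one_smul]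
  have hgν : ∀ (g : GK0) x, g • ν x = ν (g • x) := fun g x => gal_flip g _ x
  have hne : ∀ x ∈ wSet t j, ν x ≠ x := fun x hx h => by
    have := R.flip x hx
    rw [show (flipOne 0 : Signs) • x = x from h] at this
    exact R.ne_zero x hx (self_eq_neg.1 this)
  obtain ⟨x₁, h1⟩ := exists_mem_wSet t j
  obtain ⟨x₂, h2, h2'⟩ : ∃ x ∈ wSet t j, x ∉ ({x₁, ν x₁} : Finset (PtBt t)) := by
    obtain ⟨x, hx, hx'⟩ := Finset.exists_mem_notMem_of_card_lt_card
      (s := {x₁, ν x₁}) (t := (finite_wSet t j).toFinset)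
      ((Finset.card_le_two).trans_lt (by rw [card_wSet]; norm_num))
    exact ⟨x, by simpa using hx, hx'⟩
  simp only [Finset.mem_insert, Finset.mem_singleton, not_or] at h2'
  have h3 := (hν x₁).2 h1
  have h4 := (hν x₂).2 h2
  have n12 : x₁ ≠ x₂ := Ne.symm h2'.1
  have n13 : x₁ ≠ ν x₁ := (hne _ h1).symm
  have n14 : x₁ ≠ ν x₂ := fun h => h2'.2 (by rw [h, hνν])
  have n23 : x₂ ≠ ν x₁ := h2'.2
  have n24 : x₂ ≠ ν x₂ := (hne _ h2).symm
  have n34 : ν x₁ ≠ ν x₂ := fun h => n12 (by rw [← hνν x₁, h, hνν])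
  have hall : ∀ x ∈ wSet t j, x = x₁ ∨ x = x₂ ∨ x = ν x₁ ∨ x = ν x₂ := by
    intro x hx
    have hs : ({x₁, x₂, ν x₁, ν x₂} : Finset (PtBt t)) = (finite_wSet t j).toFinset := by
      refine Finset.eq_of_subset_of_card_le (fun z hz => ?_) ?_
      · simp only [Finset.mem_insert, Finset.mem_singleton] at hz
        rw [Set.Finite.mem_toFinset]
        rcases hz with rfl | rfl | rfl | rfl <;> assumption
      · rw [card_wSet, Finset.card_insert_of_notMem (by simp [n12, n13, n14]),
          Finset.card_insert_of_notMem (by simp [n23, n24]), Finset.card_pair n34]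
    have : x ∈ ({x₁, x₂, ν x₁, ν x₂} : Finset (PtBt t)) := by rw [hs]; simpa using hx
    simpa using this
  have y1 := R.ne_zero _ h1
  have y2 := R.ne_zero _ h2
  have y3 : R.y (ν x₁) = -R.y x₁ := R.flip x₁ h1
  have y4 : R.y (ν x₂) = -R.y x₂ := R.flip x₂ h2
  -- Vieta: y₁² and y₂² are the two roots of αT² + βT + ακ²d, so (y₁y₂)² = κ²d.
  have hprod : (R.y x₁ * R.y x₂ / R.κ) ^ 2 = (d : Qbar) := by
    have e1 := R.eq_zero _ h1
    have e2 := R.eq_zero _ h2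
    have hd : R.y x₁ ^ 2 - R.y x₂ ^ 2 ≠ 0 := by
      rw [sub_ne_zero]
      intro h
      rcases sq_eq_sq_iff_eq_or_eq_neg.1 h with h | h
      · exact n12 (R.inj h1 h2 h)
      · exact n14 (R.inj h1 h4 (h.trans y4.symm))
    have e3 : R.β = -R.α * (R.y x₁ ^ 2 + R.y x₂ ^ 2) := by
      have : (R.y x₁ ^ 2 - R.y x₂ ^ 2) * (R.β + R.α * (R.y x₁ ^ 2 + R.y x₂ ^ 2)) = 0 := by
        linear_combination e1 - e2
      linear_combination (mul_eq_zero.1 this).resolve_left hd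
    rw [e3] at e1
    have e4 : R.α * (R.κ ^ 2 * d - (R.y x₁ * R.y x₂) ^ 2) = 0 := by linear_combination e1
    have e5 := (mul_eq_zero.1 e4).resolve_left R.α_ne_zero
    rw [div_pow, div_eq_iff (pow_ne_zero 2 R.κ_ne_zero)]
    linear_combination -e5
  -- Since κ is Galois-fixed, y₁y₂ serves as √d: an automorphism fixes √d exactly when it preserves
  -- this product.
  have hmem : ∀ g : GK0, g ∈ galSqrt d ↔ R.y (g • x₁) * R.y (g • x₂) = R.y x₁ * R.y x₂ := by
    intro g
    rw [mem_galSqrt_iff hprod, map_div₀, map_mul, R.gal_κ, ← R.gal g _ h1, ← R.gal g _ h2,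
      div_left_inj' R.κ_ne_zero]
  have hyy : -(R.y x₁ * R.y x₂) ≠ R.y x₁ * R.y x₂ := fun h =>
    mul_ne_zero y1 y2 (neg_eq_self.1 h)
  have key : ∀ g : GK0, (g ∈ galSqrt d ∧ ((g • x₁ = x₁ ∧ g • x₂ = x₂) ∨
      (g • x₁ = x₂ ∧ g • x₂ = x₁) ∨ (g • x₁ = ν x₁ ∧ g • x₂ = ν x₂) ∨
      (g • x₁ = ν x₂ ∧ g • x₂ = ν x₁))) ∨ (g ∉ galSqrt d ∧ ((g • x₁ = x₁ ∧ g • x₂ = ν x₂) ∨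
      (g • x₁ = ν x₂ ∧ g • x₂ = x₁) ∨ (g • x₁ = ν x₁ ∧ g • x₂ = x₂) ∨
      (g • x₁ = x₂ ∧ g • x₂ = ν x₁))) := by
    intro g
    have m1 := hall _ ((gal_mem_wSet g x₁ j).2 h1)
    have m2 := hall _ ((gal_mem_wSet g x₂ j).2 h2)
    have i1 : g • x₁ ≠ g • x₂ := fun h => n12 (MulAction.injective g h)
    have i2 : g • x₂ ≠ ν (g • x₁) := fun h => n23 (MulAction.injective g (h.trans (hgν g x₁).symm))
    rw [hmem]
    -- Of the sixteen possible images of (x₁, x₂), injectivity and commutation with ν leave eight;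
    -- the sign of y₁y₂ divides them four and four.
    rcases m1 with m1 | m1 | m1 | m1 <;> rcases m2 with m2 | m2 | m2 | m2 <;>
      rw [m1, m2] at i1 i2 <;> simp only [hνν, ne_eq, not_true_eq_false] at i1 i2 <;>
      rw [m1, m2] <;> simp only [y3, y4, neg_mul, mul_neg, neg_neg, mul_comm (R.y x₂), hyy] <;>
      simp
  refine ⟨x₁, x₂, ν x₁, ν x₂, ⟨⟨h1, h2, h3, h4⟩, ⟨n12, n13, n14, n23, n24, n34⟩, hall,
    fun g hg => ?_, fun g hg => ?_⟩⟩
  · exact ((key g).resolve_right fun h => h.1 hg).2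
  · exact ((key g).resolve_left fun h => hg h.1).2

end

section
variable {t : Triple}

/-! ### Coordinates on the Weierstrass points -/

/-- The rational function `v₂ / (l₀v₀ + l₁v₁)` on points of the quotient. -/
def ratio (t : Triple) (l : Fin 2 → Qbar) : PtBt t → Qbar :=
  Quotient.lift (s := orbitSetoid t) (fun P => P.rep 2 / (l 0 * P.rep 0 + l 1 * P.rep 1)) (by
    have : ∀ P : PtB t, (sigma t P).rep 2 / (l 0 * (sigma t P).rep 0 + l 1 * (sigma t P).rep 1) =
        P.rep 2 / (l 0 * P.rep 0 + l 1 * P.rep 1) := fun P => by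
      obtain ⟨r, hr, h⟩ := flip_rep sigmaSign P
      have e2 : eps sigmaSign 2 = 1 := (eps_succ sigmaSign 0).trans (by simp [sigmaSign])
      rw [sigma_eq, h, h, h, show eps sigmaSign 0 = 1 from eps_castLE _ 0,
        show eps sigmaSign 1 = 1 from eps_castLE _ 1, e2, one_mul, one_mul, one_mul,
        show l 0 * (r * P.rep 0) + l 1 * (r * P.rep 1) = r * (l 0 * P.rep 0 + l 1 * P.rep 1) by ring,
        mul_div_mul_left _ _ hr]
    rintro P Q (rfl | rfl)
    · rfl
    · exact (this P).symm)

lemma ratio_f (l : Fin 2 → Qbar) (P : PtB t) :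
    ratio t l (f t P) = P.rep 2 / (l 0 * P.rep 0 + l 1 * P.rep 1) := rfl

lemma ratio_gal {l : Fin 2 → Qbar} {g : GK0} (hl : ∀ i, g (l i) = l i) (x : PtBt t) :
    ratio t l (g • x) = g (ratio t l x) := by
  obtain ⟨P, rfl⟩ := f_surjective t x
  obtain ⟨r, hr, h⟩ := gal_rep g P
  rw [smul_f, ratio_f, ratio_f, h, h, h, map_div₀, map_add, map_mul, map_mul, hl, hl,
    show l 0 * (r * g (P.rep 0)) + l 1 * (r * g (P.rep 1)) =
      r * (l 0 * g (P.rep 0) + l 1 * g (P.rep 1)) by ring, mul_div_mul_left _ _ hr]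

lemma ratio_flip (l : Fin 2 → Qbar) (x : PtBt t) :
    ratio t l ((flipOne 0 : Signs) • x) = -ratio t l x := by
  obtain ⟨P, rfl⟩ := f_surjective t x
  obtain ⟨r, hr, h⟩ := flip_rep (flipOne 0) P
  have e2 : eps (flipOne 0) 2 = -1 := (eps_succ (flipOne 0) 0).trans (by simp [flipOne])
  rw [flip_f, ratio_f, ratio_f, h, h, h, show eps (flipOne 0) 0 = 1 from eps_castLE _ 0,
    show eps (flipOne 0) 1 = 1 from eps_castLE _ 1, e2,
    show l 0 * (r * (1 * P.rep 0)) + l 1 * (r * (1 * P.rep 1)) =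
      r * (l 0 * P.rep 0 + l 1 * P.rep 1) by ring, mul_div_mul_left _ _ hr, neg_one_mul, neg_div]

/-- Over a branch point of the conic the double cover has a single point, so (v₀ : v₁ : v₂)
determines a Weierstrass point. -/
lemma f_eq_of_proportional {P Q : PtB t} (hP : f t P ∈ weier t) {c : Qbar}
    (h0 : Q.rep 0 = c * P.rep 0) (h1 : Q.rep 1 = c * P.rep 1) (h2 : Q.rep 2 = c * P.rep 2) :
    f t Q = f t P := by
  obtain ⟨s, rfl⟩ := exists_flip_eq (P := Q) (P₀ := P) (by
    change P.rep 1 * Q.rep 0 - P.rep 0 * Q.rep 1 = 0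
    rw [h0, h1]; ring)
  obtain ⟨r, hr, h⟩ := flip_rep s P
  rcases Int.units_eq_one_or (s 0) with hs | hs
  · rw [← flip_f]
    rcases smul_eq_or hs (f t P) with e | e
    · exact e
    · rw [e, flipOne_smul_eq_iff.2 hP]
  · exfalso
    have hP2 : P.rep 2 ≠ 0 := by
      rw [weier, Set.mem_union, f_mem_wSet, f_mem_wSet] at hP
      rcases hP with hP | hP
      · exact rep_ne_zero_of_ne (j := 0) hP (by decide)
      · exact rep_ne_zero_of_ne (j := 0) hP (by decide)
    rw [h, show eps s 0 = 1 from eps_castLE s 0] at h0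
    rw [h, show eps s 1 = 1 from eps_castLE s 1] at h1
    rw [h, show eps s 2 = -1 from (eps_succ s 0).trans (by simp [hs])] at h2
    have e2 : r + c = 0 := by
      have : (r + c) * P.rep 2 = 0 := by linear_combination -h2
      exact (mul_eq_zero.1 this).resolve_right hP2
    have hrc : r - c ≠ 0 := fun h => hr (by linear_combination (e2 + h) / 2)
    apply P.base_ne_zero
    ext i
    fin_cases i
    · change P.rep 0 = 0
      have : (r - c) * P.rep 0 = 0 := by linear_combination h0
      exact (mul_eq_zero.1 this).resolve_left hrc
    · change P.rep 1 = 0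
      have : (r - c) * P.rep 1 = 0 := by linear_combination h1
      exact (mul_eq_zero.1 this).resolve_left hrc

lemma PtB.eqns (P : PtB t) : P.rep 0 * P.rep 1 + 5 * P.rep 2 ^ 2 - P.rep 3 ^ 2 = 0 ∧
    (P.rep 0 + P.rep 1) * (P.rep 0 + 2 * P.rep 1) - P.rep 3 ^ 2 + 5 * P.rep 4 ^ 2 = 0 ∧
    (t.a : Qbar) * P.rep 0 ^ 2 + t.b * P.rep 1 ^ 2 + t.c * P.rep 2 ^ 2 = 0 := by
  have h1 := P.2.1.eval_rep
  have h2 := P.2.2.1.eval_rep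
  have h3 := P.2.2.2.eval_rep
  rw [eval_q1] at h1
  rw [eval_q2] at h2
  rw [eval_q3] at h3
  exact ⟨h1, h2, h3⟩

lemma rep_two_ne_zero {P : PtB t} {j : Fin 3} (hj : j ≠ 0) (h : P.rep j.succ.succ = 0) :
    P.rep 2 ≠ 0 := rep_ne_zero_of_ne (j := 0) h hj

lemma rep_one_ne_zero {P : PtB t} (h : P.rep 3 = 0) : P.rep 1 ≠ 0 := by
  intro h1
  have := P.eqns.1
  rw [h, h1] at this
  exact rep_two_ne_zero (j := 1) (by decide) h (by simpa using this)

/-- For w₀ = 0 and y = v₂/v₁ the first quadric gives v₀/v₁ = -5y²; substitute in the third. -/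
lemma ratio_root {x : PtBt t} (hx : x ∈ wSet t 1) :
    25 * (t.a : Qbar) * ratio t ![0, 1] x ^ 4 + t.c * ratio t ![0, 1] x ^ 2 + t.b = 0 := by
  obtain ⟨P, hP, rfl⟩ := hx
  have hP : P.rep 3 = 0 := hP
  have h1 := rep_one_ne_zero hP
  obtain ⟨e1, -, e3⟩ := P.eqns
  rw [hP] at e1
  have e0 : P.rep 0 = -5 * P.rep 2 ^ 2 / P.rep 1 := by
    rw [eq_div_iff h1]; linear_combination e1
  rw [e0] at e3
  rw [ratio_f]
  simp only [Matrix.cons_val_zero, Matrix.cons_val_one, zero_mul, zero_add, one_mul]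
  field_simp at e3 ⊢
  linear_combination e3

/-- The coordinate `v₂ / v₁` on the points where `w₀ = 0`. -/
def rootCoord₀ (t : Triple) : RootCoord t 1 (t.a * t.b) where
  y := ratio t ![0, 1]
  inj := by
    rintro _ ⟨P, hP, rfl⟩ _ ⟨Q, hQ, rfl⟩ h
    have hw : f t Q ∈ weier t := Or.inl (f_mem_wSet.2 hQ)
    have hP : P.rep 3 = 0 := hP
    have hQ : Q.rep 3 = 0 := hQ
    have p1 := rep_one_ne_zero hP
    have q1 := rep_one_ne_zero hQ
    have eP := P.eqns.1
    have eQ := Q.eqns.1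
    rw [hP] at eP
    rw [hQ] at eQ
    rw [ratio_f, ratio_f] at h
    simp only [Matrix.cons_val_zero, Matrix.cons_val_one, zero_mul, zero_add, one_mul] at h
    rw [div_eq_div_iff p1 q1] at h
    generalize hc : P.rep 1 / Q.rep 1 = c
    rw [div_eq_iff q1] at hc
    have e2 : P.rep 2 = c * Q.rep 2 := by
      rw [hc] at h
      have : Q.rep 1 * (P.rep 2 - c * Q.rep 2) = 0 := by linear_combination h
      exact sub_eq_zero.1 ((mul_eq_zero.1 this).resolve_left q1)
    have e0 : P.rep 1 * (P.rep 0 - c * Q.rep 0) = 0 := by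
      rw [hc, e2] at eP
      rw [hc]
      linear_combination eP - c ^ 2 * eQ
    exact f_eq_of_proportional (c := c) hw
      (sub_eq_zero.1 ((mul_eq_zero.1 e0).resolve_left p1)) hc e2
  ne_zero := by
    rintro _ ⟨P, hP, rfl⟩
    rw [ratio_f]
    refine div_ne_zero (rep_two_ne_zero (j := 1) (by decide) hP) ?_
    simpa using rep_one_ne_zero hP
  gal g x _ := ratio_gal (by simp) x
  flip x _ := ratio_flip _ x
  -- The product of the two values of y² is b/(25a) = ab/(5a)², hence d = ab and κ = 1/(5a).
  α := 25 * t.a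
  β := t.c
  κ := 1 / (5 * t.a)
  α_ne_zero := mul_ne_zero (by norm_num) t.ne_zero.1
  κ_ne_zero := one_div_ne_zero (mul_ne_zero (by norm_num) t.ne_zero.1)
  gal_κ := gal_apply_of_mem (div_mem (one_mem K0) (mul_mem (ofNat_mem K0 5) (intCast_mem K0 t.a)))
  eq_zero x hx := by
    have ha := t.ne_zero.1
    have e : 25 * (t.a : Qbar) * (1 / (5 * t.a)) ^ 2 * ((t.a * t.b : ℤ) : Qbar) = t.b := by
      push_cast
      field_simp
      norm_num
    linear_combination ratio_root hx + e

lemma exists_I : ∃ I ∈ K0, I ^ 2 = (-1 : Qbar) := by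
  obtain ⟨I, hI⟩ := IsAlgClosed.exists_pow_nat_eq (-1 : Qbar) zero_lt_two
  exact ⟨I, IntermediateField.subset_adjoin _ _ (Or.inl hI), hI⟩

/-- For w₁ = 0 the first two quadrics give (v₀ + (1 - i)v₁)(v₀ + (1 + i)v₁) = 5v₂², and v₂ ≠ 0
there. -/
lemma rep_add_ne_zero {I : Qbar} (hI : I ^ 2 = -1) {P : PtB t} (h : P.rep 4 = 0) :
    P.rep 0 + (1 - I) * P.rep 1 ≠ 0 := by
  intro h0
  obtain ⟨e1, e2, -⟩ := P.eqns
  rw [h] at e2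
  have e3 : 5 * P.rep 2 ^ 2 = 0 := by
    linear_combination e1 - e2 + (P.rep 0 + (1 + I) * P.rep 1) * h0 + P.rep 1 ^ 2 * hI
  exact rep_two_ne_zero (j := 2) (by decide) h (by simpa using e3)

/-- The coordinate `v₂ / (v₀ + (1 - i)v₁)` on the points where `w₁ = 0`. -/
def rootCoord₁ (t : Triple) {I : Qbar} (hI : I ^ 2 = -1) (hIK : I ∈ K0) :
    RootCoord t 2 (4 * t.a ^ 2 + t.b ^ 2) :=
  have hne : (t.b : Qbar) - 2 * I * t.a ≠ 0 := fun h => by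
    have := t.ne_zero.2.2.2.2.2.1
    apply this
    linear_combination (t.b + 2 * I * t.a : Qbar) * h + 4 * (t.a : Qbar) ^ 2 * hI
  have hIne : I ≠ 0 := by rintro rfl; norm_num at hI
  { y := ratio t ![1, 1 - I]
    inj := by
      rintro _ ⟨P, hP, rfl⟩ _ ⟨Q, hQ, rfl⟩ h
      have hw : f t Q ∈ weier t := Or.inr (f_mem_wSet.2 hQ)
      have hP : P.rep 4 = 0 := hP
      have hQ : Q.rep 4 = 0 := hQ
      have p1 := rep_add_ne_zero hI hP
      have q1 := rep_add_ne_zero hI hQ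
      obtain ⟨eP, eP', -⟩ := P.eqns
      obtain ⟨eQ, eQ', -⟩ := Q.eqns
      rw [hP] at eP'
      rw [hQ] at eQ'
      rw [ratio_f, ratio_f] at h
      simp only [Matrix.cons_val_zero, Matrix.cons_val_one, one_mul] at h
      rw [div_eq_div_iff p1 q1] at h
      generalize hc : (P.rep 0 + (1 - I) * P.rep 1) / (Q.rep 0 + (1 - I) * Q.rep 1) = c
      rw [div_eq_iff q1] at hc
      have e2 : P.rep 2 = c * Q.rep 2 := by
        rw [hc] at h
        have : (Q.rep 0 + (1 - I) * Q.rep 1) * (P.rep 2 - c * Q.rep 2) = 0 := by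
          linear_combination h
        exact sub_eq_zero.1 ((mul_eq_zero.1 this).resolve_left q1)
      have hP' : (P.rep 0 + (1 - I) * P.rep 1) * (P.rep 0 + (1 + I) * P.rep 1) = 5 * P.rep 2 ^ 2 := by
        linear_combination eP' - eP - P.rep 1 ^ 2 * hI
      have hQ' : (Q.rep 0 + (1 - I) * Q.rep 1) * (Q.rep 0 + (1 + I) * Q.rep 1) = 5 * Q.rep 2 ^ 2 := by
        linear_combination eQ' - eQ - Q.rep 1 ^ 2 * hI
      have e3 : P.rep 0 + (1 + I) * P.rep 1 = c * (Q.rep 0 + (1 + I) * Q.rep 1) := by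
        have : (P.rep 0 + (1 - I) * P.rep 1) * ((P.rep 0 + (1 + I) * P.rep 1) -
            c * (Q.rep 0 + (1 + I) * Q.rep 1)) = 0 := by
          rw [mul_sub, hP', hc, e2]
          linear_combination -c ^ 2 * hQ'
        exact sub_eq_zero.1 ((mul_eq_zero.1 this).resolve_left p1)
      have e1 : P.rep 1 = c * Q.rep 1 := by
        have : (2 * I) * (P.rep 1 - c * Q.rep 1) = 0 := by linear_combination e3 - hc
        exact sub_eq_zero.1 ((mul_eq_zero.1 this).resolve_left (mul_ne_zero two_ne_zero hIne))
      exact f_eq_of_proportional (c := c) hw (by linear_combination e3 - (1 + I) * e1) e1 e2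
    ne_zero := by
      rintro _ ⟨P, hP, rfl⟩
      rw [ratio_f]
      refine div_ne_zero (rep_two_ne_zero (j := 2) (by decide) hP) ?_
      simpa using rep_add_ne_zero hI hP
    gal := fun g x _ => ratio_gal (fun i => by
      fin_cases i
      · simp
      · simp [gal_apply_of_mem hIK]) x
    flip := fun x _ => ratio_flip _ x
    -- The product of the two values of y² is (b + 2ia)/(25(b - 2ia)) = (4a² + b²)/(5(b - 2ia))².
    -- The factor κ is Galois-fixed because i lies in `K0`.
    α := 25 * (t.b - 2 * I * t.a)
    β := -(20 * t.a + 10 * t.b + 4 * t.c)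
    κ := 1 / (5 * (t.b - 2 * I * t.a))
    α_ne_zero := mul_ne_zero (by norm_num) hne
    κ_ne_zero := one_div_ne_zero (mul_ne_zero (by norm_num) hne)
    gal_κ := gal_apply_of_mem (div_mem (one_mem K0) (mul_mem (ofNat_mem K0 5)
      (sub_mem (intCast_mem K0 t.b) (mul_mem (mul_mem (ofNat_mem K0 2) hIK) (intCast_mem K0 t.a)))))
    eq_zero := by
      rintro _ ⟨P, hP, rfl⟩
      have hP : P.rep 4 = 0 := hP
      have p1 := rep_add_ne_zero hI hP
      obtain ⟨e1, e2, e3⟩ := P.eqns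
      rw [hP] at e2
      rw [ratio_f]
      simp only [Matrix.cons_val_zero, Matrix.cons_val_one, one_mul]
      have hκ : 25 * ((t.b : Qbar) - 2 * I * t.a) * (1 / (5 * (t.b - 2 * I * t.a))) ^ 2 *
          ((4 * t.a ^ 2 + t.b ^ 2 : ℤ) : Qbar) = t.b + 2 * I * t.a := by
        push_cast
        field_simp
        linear_combination 100 * (t.a : Qbar) ^ 2 * hI
      rw [hκ]
      generalize hD : P.rep 0 + (1 - I) * P.rep 1 = D at p1
      have h2 : P.rep 2 = P.rep 2 / D * D := by field_simp
      generalize P.rep 2 / D = y at h2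
      -- The conjugate linear factor is 5y²D, so v₀ and v₁ are D times polynomials in y², and the
      -- third quadric becomes the biquadratic equation.
      have hE : P.rep 0 + (1 + I) * P.rep 1 = 5 * y ^ 2 * D := by
        have : D * (P.rep 0 + (1 + I) * P.rep 1 - 5 * y ^ 2 * D) = 0 := by
          rw [h2] at e1
          rw [← hD] at e1 ⊢
          linear_combination e2 - e1 - P.rep 1 ^ 2 * hI
        exact sub_eq_zero.1 ((mul_eq_zero.1 this).resolve_left p1)
      have h1 : 2 * I * P.rep 1 = (5 * y ^ 2 - 1) * D := by linear_combination hE - hD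
      have h0 : 2 * I * P.rep 0 = ((1 + I) - (1 - I) * (5 * y ^ 2)) * D := by
        linear_combination (1 + I) * hD - (1 - I) * hE
      have key : D ^ 2 * (25 * (t.b - 2 * I * t.a) * y ^ 4 +
          -(20 * t.a + 10 * t.b + 4 * t.c) * y ^ 2 + (t.b + 2 * I * t.a)) = 0 := by
        rw [h2] at e3
        linear_combination -4 * e3 -
          t.a * (2 * I * P.rep 0 + ((1 + I) - (1 - I) * (5 * y ^ 2)) * D) * h0 -
          t.b * (2 * I * P.rep 1 + (5 * y ^ 2 - 1) * D) * h1 +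
          (4 * t.a * P.rep 0 ^ 2 + 4 * t.b * P.rep 1 ^ 2 - t.a * D ^ 2 * (1 + 5 * y ^ 2) ^ 2) * hI
      exact (mul_eq_zero.1 key).resolve_left (pow_ne_zero 2 p1) }

end

/-! ### Induced modules modulo 2 -/

section
variable {G : Type*} [Group G] (S : Subgroup G)

/-- The homomorphism from an induced module given by a fixed vector of a subgroup. -/
lemma exists_ind_hom {M : Type*} [AddCommGroup M] [DistribMulAction G M] (h2 : ∀ m : M, 2 • m = 0)
    {ψ : M} (hψ : ∀ g ∈ S, g • ψ = ψ) :
    ∃ ι : Representation.IndV S.subtype (Representation.trivial (ZMod 2) S (ZMod 2)) →+ M,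
      (∀ g x, ι (Representation.ind S.subtype _ g x) = g • ι x) ∧
      ∀ h, ι (Representation.IndV.mk S.subtype _ h 1) = h⁻¹ • ψ := by
  let : Module (ZMod 2) M := AddCommGroup.zmodModule h2
  -- Frobenius reciprocity: h ⊗ a ↦ a · h⁻¹ψ. The inverse turns left translation by the subgroup,
  -- divided out in the coinvariants, into its action on ψ, which is trivial.
  let L : TensorProduct (ZMod 2) (MonoidAlgebra (ZMod 2) G) (ZMod 2) →ₗ[ZMod 2] M :=
    TensorProduct.lift (Finsupp.linearCombination (ZMod 2)
      (fun h : G => LinearMap.toSpanSingleton (ZMod 2) M (h⁻¹ • ψ)) ∘ₗ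
      (MonoidAlgebra.coeffLinearEquiv (ZMod 2)).toLinearMap)
  let ι : Representation.IndV S.subtype (Representation.trivial (ZMod 2) S (ZMod 2)) →ₗ[ZMod 2] M :=
    Representation.Coinvariants.lift _ L fun s => by
      ext h
      simp only [LinearMap.coe_comp, Function.comp_apply, MonoidAlgebra.lsingle_apply]
      simp [L, mul_smul, hψ _ (inv_mem s.2), Subgroup.coe_subtype]
  have hι : ∀ h, ι (Representation.IndV.mk S.subtype _ h 1) = h⁻¹ • ψ := fun h => by
    simp [ι, L]
  refine ⟨ι.toAddMonoidHom, fun g x => ?_, hι⟩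
  let T : M →ₗ[ZMod 2] M := (DistribSMul.toAddMonoidHom M g).toZModLinearMap 2
  have : ι ∘ₗ Representation.ind S.subtype _ g = T ∘ₗ ι := by
    refine Representation.IndV.hom_ext _ _ fun h => ?_
    ext
    change ι (Representation.ind S.subtype _ g (Representation.IndV.mk S.subtype _ h 1)) =
      g • ι (Representation.IndV.mk S.subtype _ h 1)
    rw [Representation.ind_mk, hι, hι, mul_inv_rev, inv_inv, mul_smul]
  exact LinearMap.congr_fun this x

lemma indV_mk_mul {s : G} (hs : s ∈ S) (h : G) :
    Representation.IndV.mk S.subtype (Representation.trivial (ZMod 2) S (ZMod 2)) (s * h) 1 =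
      Representation.IndV.mk S.subtype _ h 1 := by
  refine (Representation.Coinvariants.mk_eq_iff _).2
    (Representation.Coinvariants.mem_ker_of_eq ⟨s, hs⟩ (MonoidAlgebra.single h 1 ⊗ₜ 1) _ ?_)
  simp

/-- The four elements of a module modulo 2 induced from a subgroup of index 2. -/
lemma indV_cases {g : G} (hg : ∀ h ∉ S, h * g⁻¹ ∈ S)
    (x : Representation.IndV S.subtype (Representation.trivial (ZMod 2) S (ZMod 2))) :
    x = 0 ∨ x = Representation.IndV.mk S.subtype _ 1 1 ∨
      x = Representation.IndV.mk S.subtype _ g 1 ∨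
      x = Representation.IndV.mk S.subtype _ 1 1 + Representation.IndV.mk S.subtype _ g 1 := by
  set e := Representation.IndV.mk S.subtype (Representation.trivial (ZMod 2) S (ZMod 2)) 1 1
  set e' := Representation.IndV.mk S.subtype (Representation.trivial (ZMod 2) S (ZMod 2)) g 1
  have hx : x ∈ Submodule.span (ZMod 2) {e, e'} := by
    have hall : ∀ h, Representation.IndV.mk S.subtype
        (Representation.trivial (ZMod 2) S (ZMod 2)) h 1 ∈ Submodule.span (ZMod 2) {e, e'} := by
      intro h
      by_cases hh : h ∈ S
      · rw [← mul_one h, indV_mk_mul S hh]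
        exact Submodule.subset_span (by simp [e])
      · rw [← inv_mul_cancel_right h g, indV_mk_mul S (hg h hh)]
        exact Submodule.subset_span (by simp [e'])
    have htop : (Submodule.span (ZMod 2) {e, e'}).mkQ = 0 := by
      refine Representation.IndV.hom_ext _ _ fun h => ?_
      ext
      exact (Submodule.Quotient.mk_eq_zero _).2 (hall h)
    exact (Submodule.Quotient.mk_eq_zero _).1 (LinearMap.congr_fun htop x)
  obtain ⟨α, β, rfl⟩ := Submodule.mem_span_pair.1 hx
  have h01 : ∀ a : ZMod 2, a = 0 ∨ a = 1 := by decide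
  rcases h01 α with rfl | rfl <;> rcases h01 β with rfl | rfl <;> simp

end

section
variable {t : Triple}

/-! ### The orbit structure and the image of `f^*` -/

/-- The difference of two Weierstrass points. -/
def pairDiv {x y : PtBt t} (hx : x ∈ weier t) (hy : y ∈ weier t) : weierDiv t :=
  ⟨Finsupp.single x 1 - Finsupp.single y 1, by rw [map_sub, deg_single, deg_single, sub_self], by
    classical
    intro z hz
    by_contra hw
    apply hz
    rw [Finsupp.sub_apply, Finsupp.single_eq_of_ne, Finsupp.single_eq_of_ne, sub_self]
    · rintro rfl; exact hw hy
    · rintro rfl; exact hw hx⟩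

open scoped Classical in
lemma valDiff_pairDiv {x y : PtBt t} (hx : x ∈ weier t) (hy : y ∈ weier t) (u v : PtBt t) :
    valDiff u v (pairDiv hx hy) = (((if x = u then 1 else 0) - (if y = u then 1 else 0) -
      ((if x = v then 1 else 0) - (if y = v then 1 else 0)) : ℤ) : ZMod 2) := by
  change (((Finsupp.single x 1 - Finsupp.single y 1 : DivBt t) u -
    (Finsupp.single x 1 - Finsupp.single y 1 : DivBt t) v : ℤ) : ZMod 2) = _
  simp only [Finsupp.sub_apply, Finsupp.single_apply]

lemma smul_pairDiv (g : GK0) {x y : PtBt t} (hx : x ∈ weier t) (hy : y ∈ weier t)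
    (hx' : g • x ∈ weier t) (hy' : g • y ∈ weier t) :
    g • imClass t (pairDiv hx hy) = imClass t (pairDiv hx' hy') := by
  rw [smul_imClass]
  congr 1
  apply Subtype.ext
  change galDiv g (Finsupp.single x 1 - Finsupp.single y 1) = _
  rw [map_sub]
  simp only [galDiv, Finsupp.mapDomain.addMonoidHom_apply, Finsupp.mapDomain_single]
  rfl

lemma valDiff_eq_zero_iff {x y : PtBt t} {D : weierDiv t} :
    valDiff x y D = 0 ↔ Even (D.1 x - D.1 y) :=
  (ZMod.intCast_zmod_eq_zero_iff_dvd _ 2).trans even_iff_two_dvd.symm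

/-- The three differences connect all four points of the frame. -/
lemma IsFrame.imClass_eq_zero {j : Fin 3} {d : ℤ} {x₁ x₂ x₃ x₄ : PtBt t}
    (F : IsFrame t j d x₁ x₂ x₃ x₄) {D : weierDiv t} (h1 : valDiff x₁ x₃ D = 0)
    (h2 : valDiff x₂ x₄ D = 0) (h3 : valDiff x₁ x₂ D = 0) :
    ∀ x ∈ wSet t j, ∀ y ∈ wSet t j, Even (D.1 x - D.1 y) := by
  rw [valDiff_eq_zero_iff] at h1 h2 h3
  have key : ∀ x ∈ wSet t j, Even (D.1 x - D.1 x₁) := by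
    intro x hx
    rcases F.eq_or x hx with rfl | rfl | rfl | rfl <;> rw [Int.even_sub] at * <;> tauto
  intro x hx y hy
  have := (key x hx).sub (key y hy)
  rwa [sub_sub_sub_cancel_right] at this

lemma two_smul_imF (z : imF t) : 2 • z = 0 := by
  obtain ⟨D, rfl⟩ := imClass_surjective z
  rw [← map_nsmul, imClass_eq_zero_iff]
  intro j _ x _ y _
  change Even ((2 • D.1) x - (2 • D.1) y)
  rw [Finsupp.smul_apply, Finsupp.smul_apply, ← smul_sub, nsmul_eq_mul]
  exact even_two_mul _

end

section
variable {t : Triple}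

/-- Both automorphisms send √d to -√d. -/
lemma mul_inv_mem_galSqrt {d : ℤ} {g h : GK0} (hg : g ∉ galSqrt d) (hh : h ∉ galSqrt d) :
    h * g⁻¹ ∈ galSqrt d := by
  obtain ⟨θ, hθ⟩ := IsAlgClosed.exists_pow_nat_eq (d : Qbar) zero_lt_two
  have key : ∀ g : GK0, g ∉ galSqrt d → g θ = -θ := fun g hg => by
    rw [mem_galSqrt_iff hθ] at hg
    have : g θ ^ 2 = θ ^ 2 := by rw [← map_pow, hθ, map_intCast]
    exact (sq_eq_sq_iff_eq_or_eq_neg.1 this).resolve_left hg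
  rw [mem_galSqrt_iff hθ, AlgEquiv.mul_apply, key g⁻¹ (inv_mem_iff.not.2 hg), map_neg, key h hh,
    neg_neg]

/-- The differences of values at the points of a frame, as functionals on the image of `f^*`. -/
structure IsCoords (x₁ x₂ x₃ x₄ : PtBt t) (A B C : imF t →+ ZMod 2) : Prop where
  fst : ∀ D, A (imClass t D) = valDiff x₁ x₃ D
  snd : ∀ D, B (imClass t D) = valDiff x₂ x₄ D
  mix : ∀ D, C (imClass t D) = valDiff x₁ x₂ D

variable {j : Fin 3} {d : ℤ} {x₁ x₂ x₃ x₄ : PtBt t}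

lemma IsFrame.exists_isCoords (F : IsFrame t j d x₁ x₂ x₃ x₄) (hj : j ≠ 0) :
    ∃ A B C, IsCoords x₁ x₂ x₃ x₄ A B C := by
  obtain ⟨h1, h2, h3, h4⟩ := F.mem
  obtain ⟨A, hA⟩ := exists_imDiff x₁ x₃ hj h1 h3
  obtain ⟨B, hB⟩ := exists_imDiff x₂ x₄ hj h2 h4
  obtain ⟨C, hC⟩ := exists_imDiff x₁ x₂ hj h1 h2
  exact ⟨A, B, C, hA, hB, hC⟩

/-- Modulo 2 the divisor x₁ - x₂ is the pair {x₁, x₂}. Elements fixing √d keep it or replace it by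
its complement {x₃, x₄}; the others send it to {x₁, x₄} or {x₂, x₃}. The functional C tells the two
cases apart, and functionals of the other set of four points vanish. -/
lemma IsFrame.pair_values (F : IsFrame t j d x₁ x₂ x₃ x₄) (hj : j ≠ 0) {A B C : imF t →+ ZMod 2}
    (hc : IsCoords x₁ x₂ x₃ x₄ A B C) (g : GK0) :
    ∃ (h1 : x₁ ∈ weier t) (h2 : x₂ ∈ weier t),
      A (g • imClass t (pairDiv h1 h2)) = 1 ∧ B (g • imClass t (pairDiv h1 h2)) = 1 ∧
      (g ∈ galSqrt d → C (g • imClass t (pairDiv h1 h2)) = 0) ∧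
      (g ∉ galSqrt d → C (g • imClass t (pairDiv h1 h2)) = 1) ∧
      ∀ i ≠ j, ∀ u ∈ wSet t i, ∀ v ∈ wSet t i, ∀ φ : imF t →+ ZMod 2,
        (∀ D, φ (imClass t D) = valDiff u v D) → φ (g • imClass t (pairDiv h1 h2)) = 0 := by
  classical
  have hw := wSet_subset_weier (t := t) hj
  have m1 := F.mem.1
  have m2 := F.mem.2.1
  have m1' := (gal_mem_wSet g _ _).2 m1
  have m2' := (gal_mem_wSet g _ _).2 m2
  obtain ⟨n12, n13, n14, n23, n24, n34⟩ := F.ne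
  refine ⟨hw m1, hw m2, ?_⟩
  rw [smul_pairDiv g (hw m1) (hw m2) (hw m1') (hw m2'), hc.fst, hc.snd, hc.mix, valDiff_pairDiv,
    valDiff_pairDiv, valDiff_pairDiv]
  have h0 : ∀ i ≠ j, ∀ u ∈ wSet t i, ∀ v ∈ wSet t i, ∀ φ : imF t →+ ZMod 2,
      (∀ D, φ (imClass t D) = valDiff u v D) →
      φ (imClass t (pairDiv (hw m1') (hw m2'))) = 0 := by
    intro i hi u hu v hv φ hφ
    have hne : ∀ z ∈ wSet t i, g • x₁ ≠ z ∧ g • x₂ ≠ z := fun z hz =>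
      ⟨fun h => Set.disjoint_left.1 (disjoint_wSet hi) hz (h ▸ m1'),
        fun h => Set.disjoint_left.1 (disjoint_wSet hi) hz (h ▸ m2')⟩
    rw [hφ, valDiff_pairDiv, if_neg (hne u hu).1, if_neg (hne u hu).2, if_neg (hne v hv).1,
      if_neg (hne v hv).2]
    rfl
  have one : (-1 : ZMod 2) = 1 := by decide
  have two : (2 : ZMod 2) = 0 := by decide
  by_cases hg : g ∈ galSqrt d
  · have hC : ((((if g • x₁ = x₁ then 1 else 0) - (if g • x₂ = x₁ then 1 else 0) -
        ((if g • x₁ = x₂ then 1 else 0) - (if g • x₂ = x₂ then 1 else 0)) : ℤ) : ZMod 2) = 0) ∧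
        ((((if g • x₁ = x₁ then 1 else 0) - (if g • x₂ = x₁ then 1 else 0) -
        ((if g • x₁ = x₃ then 1 else 0) - (if g • x₂ = x₃ then 1 else 0)) : ℤ) : ZMod 2) = 1) ∧
        ((((if g • x₁ = x₂ then 1 else 0) - (if g • x₂ = x₂ then 1 else 0) -
        ((if g • x₁ = x₄ then 1 else 0) - (if g • x₂ = x₄ then 1 else 0)) : ℤ) : ZMod 2) = 1) := by
      rcases F.gal_mem g hg with ⟨e1, e2⟩ | ⟨e1, e2⟩ | ⟨e1, e2⟩ | ⟨e1, e2⟩ <;> rw [e1, e2] <;>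
        simp [n12, n13, n14, n23, n24, n34, n12.symm, n13.symm, n14.symm, n23.symm, n24.symm,
          n34.symm, two]
    exact ⟨hC.2.1, hC.2.2, fun _ => hC.1, fun h => absurd hg h, h0⟩
  · have hC : ((((if g • x₁ = x₁ then 1 else 0) - (if g • x₂ = x₁ then 1 else 0) -
        ((if g • x₁ = x₂ then 1 else 0) - (if g • x₂ = x₂ then 1 else 0)) : ℤ) : ZMod 2) = 1) ∧
        ((((if g • x₁ = x₁ then 1 else 0) - (if g • x₂ = x₁ then 1 else 0) -
        ((if g • x₁ = x₃ then 1 else 0) - (if g • x₂ = x₃ then 1 else 0)) : ℤ) : ZMod 2) = 1) ∧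
        ((((if g • x₁ = x₂ then 1 else 0) - (if g • x₂ = x₂ then 1 else 0) -
        ((if g • x₁ = x₄ then 1 else 0) - (if g • x₂ = x₄ then 1 else 0)) : ℤ) : ZMod 2) = 1) := by
      rcases F.gal_notMem g hg with ⟨e1, e2⟩ | ⟨e1, e2⟩ | ⟨e1, e2⟩ | ⟨e1, e2⟩ <;> rw [e1, e2] <;>
        simp [n12, n13, n14, n23, n24, n34, n12.symm, n13.symm, n14.symm, n23.symm, n24.symm,
          n34.symm, one]
    exact ⟨hC.2.1, hC.2.2, fun h => absurd h hg, fun _ => hC.1, h0⟩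

/-- The homomorphism from the module induced from `K₀(√d)` given by a vector. -/
lemma exists_hom_of_fixed {M : Type*} [AddCommGroup M] [DistribMulAction GK0 M]
    (h2 : ∀ m : M, 2 • m = 0) {d : ℤ} (hd : ∀ x ∈ K0, x ^ 2 ≠ (d : Qbar)) {ψ : M}
    (hψ : ∀ g ∈ galSqrt d, g • ψ = ψ) :
    ∃ (ι : IndV d →+ M) (e e' : IndV d) (g : GK0), g ∉ galSqrt d ∧
      (∀ g x, ι (indRep d g x) = g • ι x) ∧ ι e = ψ ∧ ι e' = g • ψ ∧
      ∀ x, x = 0 ∨ x = e ∨ x = e' ∨ x = e + e' := by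
  obtain ⟨ι, hι, hιmk⟩ := exists_ind_hom (galSqrt d) h2 hψ
  obtain ⟨g, hg⟩ := exists_notMem_galSqrt hd
  exact ⟨ι, _, _, g⁻¹, inv_mem_iff.not.2 hg, hι, by rw [hιmk, inv_one, one_smul], hιmk g,
    indV_cases (galSqrt d) fun h hh => mul_inv_mem_galSqrt hg hh⟩

/-- The induced submodule of the image of `f^*` given by a frame. -/
lemma IsFrame.exists_hom (F : IsFrame t j d x₁ x₂ x₃ x₄) (hj : j ≠ 0) {A B C : imF t →+ ZMod 2}
    (hc : IsCoords x₁ x₂ x₃ x₄ A B C) (hd : ∀ x ∈ K0, x ^ 2 ≠ (d : Qbar)) :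
    ∃ ι : IndV d →+ imF t, (∀ g x, ι (indRep d g x) = g • ι x) ∧
      (∀ x, A (ι x) = 0 → C (ι x) = 0 → x = 0) ∧
      (∀ a c, ∃ x, A (ι x) = a ∧ C (ι x) = c) ∧
      (∀ x, B (ι x) = A (ι x)) ∧
      ∀ i ≠ j, ∀ u ∈ wSet t i, ∀ v ∈ wSet t i, ∀ φ : imF t →+ ZMod 2,
        (∀ D, φ (imClass t D) = valDiff u v D) → ∀ x, φ (ι x) = 0 := by
  obtain ⟨h1, h2, -⟩ := F.pair_values hj hc 1
  set ψ := imClass t (pairDiv h1 h2) with hψdef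
  have hv : ∀ g : GK0, A (g • ψ) = 1 ∧ B (g • ψ) = 1 ∧ (g ∈ galSqrt d → C (g • ψ) = 0) ∧
      (g ∉ galSqrt d → C (g • ψ) = 1) ∧ ∀ i ≠ j, ∀ u ∈ wSet t i, ∀ v ∈ wSet t i,
        ∀ φ : imF t →+ ZMod 2, (∀ D, φ (imClass t D) = valDiff u v D) → φ (g • ψ) = 0 := fun g => by
    obtain ⟨_, _, h⟩ := F.pair_values hj hc g
    exact h
  -- The functionals separate points and take the same values on ψ and g • ψ; concretely, a pair and
  -- its complement define the same class.
  have hψ : ∀ g ∈ galSqrt d, g • ψ = ψ := by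
    intro g hg
    have e1 := hv g
    have e2 := hv 1
    rw [one_smul] at e2
    rw [← sub_eq_zero]
    obtain ⟨D, hD⟩ := imClass_surjective (g • ψ - ψ)
    rw [← hD, imClass_eq_zero_iff]
    intro i hi u hu v hv'
    by_cases hij : i = j
    · subst hij
      refine F.imClass_eq_zero ?_ ?_ ?_ u hu v hv'
      · rw [← hc.fst, hD, map_sub, e1.1, e2.1, sub_self]
      · rw [← hc.snd, hD, map_sub, e1.2.1, e2.2.1, sub_self]
      · rw [← hc.mix, hD, map_sub, e1.2.2.1 hg, e2.2.2.1 (one_mem _), sub_self]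
    · obtain ⟨φ, hφ⟩ := exists_imDiff u v hi hu hv'
      rw [← valDiff_eq_zero_iff, ← hφ, hD, map_sub, e1.2.2.2.2 i hij u hu v hv' φ hφ,
        e2.2.2.2.2 i hij u hu v hv' φ hφ, sub_self]
  obtain ⟨ι, e, e', g, hg, hι, he, he', hcases⟩ :=
    exists_hom_of_fixed (M := imF t) two_smul_imF hd hψ
  have v1 := hv 1
  have vg := hv g
  rw [one_smul, ← he] at v1
  rw [← he'] at vg
  have c1 := v1.2.2.1 (one_mem _)
  have cg := vg.2.2.2.1 hg
  have two : (1 + 1 : ZMod 2) = 0 := by decide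
  have h01 : ∀ a : ZMod 2, a = 0 ∨ a = 1 := by decide
  refine ⟨ι, hι, fun x hA hC => ?_, fun a c => ?_, fun x => ?_, fun i hi u hu v hv' φ hφ x => ?_⟩
  · rcases hcases x with rfl | rfl | rfl | rfl
    · rfl
    · rw [v1.1] at hA; exact absurd hA one_ne_zero
    · rw [vg.1] at hA; exact absurd hA one_ne_zero
    · rw [map_add, map_add, c1, cg] at hC; exact absurd hC (by decide)
  · rcases h01 a with rfl | rfl <;> rcases h01 c with rfl | rfl
    · exact ⟨0, by simp, by simp⟩
    · exact ⟨e + e', by rw [map_add, map_add, v1.1, vg.1, two], by rw [map_add, map_add, c1, cg, zero_add]⟩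
    · exact ⟨_, v1.1, c1⟩
    · exact ⟨_, vg.1, cg⟩
  · rcases hcases x with rfl | rfl | rfl | rfl
    · simp
    · rw [v1.1, v1.2.1]
    · rw [vg.1, vg.2.1]
    · rw [map_add, map_add, map_add, v1.1, v1.2.1, vg.1, vg.2.1]
  · have w1 := v1.2.2.2.2 i hi u hu v hv' φ hφ
    have wg := vg.2.2.2.2 i hi u hu v hv' φ hφ
    rcases hcases x with rfl | rfl | rfl | rfl
    · simp
    · exact w1
    · exact wg
    · rw [map_add, map_add, w1, wg, add_zero]

end

section
variable {t : Triple}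

/-! ### The nontrivial class in the kernel, the quotient map to ℤ/2ℤ, and the obstruction to
splitting. -/

lemma exists_enum (t : Triple) (j : Fin 3) : ∃ P : Fin 4 → PtBt t, Function.Injective P ∧
    Set.range P = wSet t j ∧ ∑ i, Finsupp.single (P i) (1 : ℤ) = edge t j := by
  let e := (finite_wSet t j).toFinset.equivFinOfCardEq (card_wSet t j)
  refine ⟨fun i => (e.symm i).1, Subtype.val_injective.comp e.symm.injective, ?_, ?_⟩
  · ext x
    constructor
    · rintro ⟨i, rfl⟩
      exact (Set.Finite.mem_toFinset _).1 (e.symm i).2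
    · intro hx
      exact ⟨e ⟨x, by simpa using hx⟩, by simp⟩
  · exact (Equiv.sum_comp e.symm fun x => (Finsupp.single x.1 1 : DivBt t)).trans
      (Finset.sum_coe_sort (finite_wSet t j).toFinset fun x => (Finsupp.single x 1 : DivBt t))

/-- Doubling squares the eigenvalue -1 to 1, so the class is 2-torsion; the eigenvalue -1 itself
shows that it is nonzero. -/
lemma exists_kernel_element {W : PtBt t} (hW : W ∈ weier t) : ∃ κ : jacBt2 t,
    (κ : PicBt t) = QuotientAddGroup.mk' (princBt t) (edge t 1 - 4 • Finsupp.single W 1) ∧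
      κ ≠ 0 := by
  have hs := semiInv_edge (j := 1) (by decide) hW
  have h2 : (2 : ℤ) • (edge t 1 - 4 • Finsupp.single W 1) ∈ princBt t := by
    rw [mem_princBt_iff, two_zsmul, map_add]
    simpa using hs.add hs
  refine ⟨⟨_, mk_mem_jacBt2 ?_ h2⟩, rfl, fun h => ?_⟩
  · rw [map_sub, deg_edge, map_nsmul, deg_single]; simp
  · exact ne_zero_of_semiInv hs (congrArg Subtype.val h)

/-! ### Sums of values modulo 2 -/

/-- The sum of the values at the points where a coordinate vanishes, modulo 2. -/
def valSum (j : Fin 3) (D : weierDiv t) : ZMod 2 :=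
  ∑ x ∈ (finite_wSet t j).toFinset, ((D.1 x : ℤ) : ZMod 2)

/-- The degree is zero, hence even. So either of the two sets may be used to define the map to ℤ/2ℤ.
-/
lemma valSum_add_valSum (D : weierDiv t) : valSum 1 D + valSum 2 D = 0 := by
  classical
  have hd : Disjoint (finite_wSet t 1).toFinset (finite_wSet t 2).toFinset := by
    rw [Set.Finite.disjoint_toFinset]
    exact disjoint_wSet (by decide)
  have h1 : deg D.1 = ∑ x ∈ (finite_wSet t 1).toFinset ∪ (finite_wSet t 2).toFinset, D.1 x := by
    rw [deg, Finsupp.liftAddHom_apply, Finsupp.sum_of_support_subset]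
    · rfl
    · intro x hx
      simpa [weier] using D.2.2 x (Finsupp.mem_support_iff.1 hx)
    · simp
  rw [D.2.1, Finset.sum_union hd] at h1
  have := congrArg (Int.cast (R := ZMod 2)) h1
  push_cast at this
  exact this.symm

lemma valSum_gal (j : Fin 3) (g : GK0) (D : weierDiv t) :
    valSum j ⟨galDiv g D.1, galDiv_mem_weierDiv g D.2⟩ = valSum j D := by
  refine Finset.sum_nbij' (g⁻¹ • ·) (g • ·) (fun x hx => ?_) (fun x hx => ?_) (fun x _ => ?_)
    (fun x _ => ?_) fun x _ => ?_
  · rw [Set.Finite.mem_toFinset] at hx ⊢; exact (gal_mem_wSet _ _ _).2 hx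
  · rw [Set.Finite.mem_toFinset] at hx ⊢; exact (gal_mem_wSet _ _ _).2 hx
  · exact smul_inv_smul g x
  · exact inv_smul_smul g x
  · rw [← galDiv_apply g D.1 (g⁻¹ • x), smul_inv_smul]

lemma IsFrame.valSum_eq {j : Fin 3} {d : ℤ} {x₁ x₂ x₃ x₄ : PtBt t}
    (F : IsFrame t j d x₁ x₂ x₃ x₄) (D : weierDiv t) : valSum j D =
      ((D.1 x₁ : ℤ) : ZMod 2) + ((D.1 x₂ : ℤ) : ZMod 2) + ((D.1 x₃ : ℤ) : ZMod 2) +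
        ((D.1 x₄ : ℤ) : ZMod 2) := by
  classical
  obtain ⟨h1, h2, h3, h4⟩ := F.mem
  obtain ⟨n12, n13, n14, n23, n24, n34⟩ := F.ne
  have : (finite_wSet t j).toFinset = {x₁, x₂, x₃, x₄} := by
    ext x
    simp only [Set.Finite.mem_toFinset, Finset.mem_insert, Finset.mem_singleton]
    refine ⟨F.eq_or x, ?_⟩
    rintro (rfl | rfl | rfl | rfl) <;> assumption
  rw [valSum, this, Finset.sum_insert (by simp [n12, n13, n14]),
    Finset.sum_insert (by simp [n23, n24]), Finset.sum_pair n34]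
  ring

/-- Modulo 2 signs disappear and A + B adds up all four coefficients. So the sum descends to the
image of f^*, which is consistent since each set has an even number of points. -/
lemma IsFrame.fst_add_snd {j : Fin 3} {d : ℤ} {x₁ x₂ x₃ x₄ : PtBt t}
    (F : IsFrame t j d x₁ x₂ x₃ x₄) {A B C : imF t →+ ZMod 2} (hc : IsCoords x₁ x₂ x₃ x₄ A B C)
    (D : weierDiv t) : A (imClass t D) + B (imClass t D) = valSum j D := by
  rw [F.valSum_eq, hc.fst, hc.snd]
  change ((D.1 x₁ - D.1 x₃ : ℤ) : ZMod 2) + ((D.1 x₂ - D.1 x₄ : ℤ) : ZMod 2) = _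
  push_cast
  rw [CharTwo.sub_eq_add, CharTwo.sub_eq_add]
  ring

/-! ### Classes without invariant lift -/

/-- A Galois-invariant class of odd type distinguishes a point of a frame. -/
lemma IsFrame.exists_fixed {j : Fin 3} (hj : j ≠ 0) {d : ℤ} {x₁ x₂ x₃ x₄ : PtBt t}
    (F : IsFrame t j d x₁ x₂ x₃ x₄) {D : weierDiv t} (h1 : valSum j D = 1)
    (hg : ∀ g : GK0, g • imClass t D = imClass t D) : ∃ ω ∈ wSet t j, ∀ g : GK0, g • ω = ω := by
  classical
  -- Four parities with odd sum: exactly one differs from the other three.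
  obtain ⟨ω, hω, hodd⟩ : ∃ ω ∈ wSet t j, ∀ y ∈ wSet t j, y ≠ ω →
      ((D.1 y : ℤ) : ZMod 2) = ((D.1 ω : ℤ) : ZMod 2) + 1 := by
    rw [F.valSum_eq] at h1
    have hc : ∀ a b c d : ZMod 2, a + b + c + d = 1 →
        (b = a + 1 ∧ c = a + 1 ∧ d = a + 1) ∨ (a = b + 1 ∧ c = b + 1 ∧ d = b + 1) ∨
        (a = c + 1 ∧ b = c + 1 ∧ d = c + 1) ∨ (a = d + 1 ∧ b = d + 1 ∧ c = d + 1) := by decide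
    obtain ⟨m1, m2, m3, m4⟩ := F.mem
    rcases hc _ _ _ _ h1 with h | h | h | h
    · refine ⟨x₁, m1, fun y hy hne => ?_⟩
      rcases F.eq_or y hy with rfl | rfl | rfl | rfl
      exacts [absurd rfl hne, h.1, h.2.1, h.2.2]
    · refine ⟨x₂, m2, fun y hy hne => ?_⟩
      rcases F.eq_or y hy with rfl | rfl | rfl | rfl
      exacts [h.1, absurd rfl hne, h.2.1, h.2.2]
    · refine ⟨x₃, m3, fun y hy hne => ?_⟩
      rcases F.eq_or y hy with rfl | rfl | rfl | rfl
      exacts [h.1, h.2.1, absurd rfl hne, h.2.2]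
    · refine ⟨x₄, m4, fun y hy hne => ?_⟩
      rcases F.eq_or y hy with rfl | rfl | rfl | rfl
      exacts [h.1, h.2.1, h.2.2, absurd rfl hne]
  refine ⟨ω, hω, fun g => ?_⟩
  by_contra hne
  have hgω := (gal_mem_wSet g ω j).2 hω
  -- If g moved ω, then gD - D would be odd at g • ω and even at a point y outside {ω, g • ω},
  -- although invariance of the class requires constant parity.
  obtain ⟨y, hy, hy'⟩ := Finset.exists_mem_notMem_of_card_lt_card (s := {ω, g • ω})
    (t := (finite_wSet t j).toFinset) (Finset.card_le_two.trans_lt (by rw [card_wSet]; norm_num))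
  rw [Set.Finite.mem_toFinset] at hy
  simp only [Finset.mem_insert, Finset.mem_singleton, not_or] at hy'
  have h0 := hg g
  rw [smul_imClass, ← sub_eq_zero, ← map_sub, imClass_eq_zero_iff] at h0
  have h0 := h0 j hj _ hgω _ hy
  change Even ((galDiv g D.1 (g • ω) - D.1 (g • ω)) - (galDiv g D.1 y - D.1 y)) at h0
  have hy2 : g⁻¹ • y ≠ ω := fun h => hy'.2 (by rw [← h, smul_inv_smul])
  have e1 := hodd _ hgω hne
  have e2 := hodd y hy hy'.1
  have e3 := hodd _ ((gal_mem_wSet g⁻¹ y j).2 hy) hy2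
  rw [galDiv_apply] at h0
  have e4 : galDiv g D.1 y = D.1 (g⁻¹ • y) := by
    rw [← galDiv_apply g D.1 (g⁻¹ • y), smul_inv_smul]
  rw [e4] at h0
  have h5 := (ZMod.intCast_zmod_eq_zero_iff_dvd _ 2).2 (even_iff_two_dvd.1 h0)
  push_cast at h5
  rw [e1, e2, e3] at h5
  have : ∀ a : ZMod 2, a - (a + 1) - (a + 1 - (a + 1)) ≠ 0 := by decide
  exact this _ h5

/-- A Weierstrass point over `w₀ = 0` defined over `K₀` gives a square root of `c² - 100ab`. -/
lemma exists_sqrt_of_fixed {ω : PtBt t} (hω : ω ∈ wSet t 1) (hg : ∀ g : GK0, g • ω = ω) :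
    ∃ x ∈ K0, x ^ 2 = ((t.c ^ 2 - 100 * t.a * t.b : ℤ) : Qbar) := by
  have hK : ratio t ![0, 1] ω ∈ K0 := mem_K0_of_fixed fun g => by
    rw [← ratio_gal (by simp) ω, hg]
  -- Completing the square in 25aT² + cT + b with T = (v₂/v₁)²: (50aT + c)² = c² - 100ab.
  refine ⟨50 * t.a * ratio t ![0, 1] ω ^ 2 + t.c, add_mem (mul_mem (mul_mem (ofNat_mem K0 50)
    (intCast_mem K0 t.a)) (pow_mem hK 2)) (intCast_mem K0 t.c), ?_⟩
  push_cast
  linear_combination 100 * (t.a : Qbar) * ratio_root hω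

end

end EnriquesBranch

end

/-! ### Assembly of the kernel and image statements. -/

open EnriquesBranch in
theorem proposition3p3 (t : Triple) :
    -- the kernel of `f^*`
    (∃ P Q : Fin 4 → PtBt t,
      (Function.Injective P ∧ Set.range P = fVw0 t) ∧
      (Function.Injective Q ∧ Set.range Q = fVw1 t) ∧
      Nonempty ((fstar t).ker ≃+ ZMod 2) ∧
      ∀ W ∈ Set.range P ∪ Set.range Q,
        ∃ κ : jacBt2 t, (κ : PicBt t) = subsetClass t P W ∧ κ ≠ 0 ∧
          ∀ x : jacBt2 t, x ∈ (fstar t).ker ↔ x = 0 ∨ x = κ) ∧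
    -- the image of `f^*`, when `√(ab)`, `θ₀` and `η₀` do not lie in `K₀`
    ((∀ x ∈ K0, x ^ 2 ≠ ((t.a * t.b : ℤ) : Qbar)) →
     (∀ x ∈ K0, x ^ 2 ≠ ((4 * t.a ^ 2 + t.b ^ 2 : ℤ) : Qbar)) →
     (∀ x ∈ K0, x ^ 2 ≠ ((t.c ^ 2 - 100 * t.a * t.b : ℤ) : Qbar)) →
      ∃ (ι : IndV (4 * t.a ^ 2 + t.b ^ 2) × IndV (t.a * t.b) →+ imF t) (p : imF t →+ ZMod 2),
        (∀ (g : GK0) (x : IndV (4 * t.a ^ 2 + t.b ^ 2)) (y : IndV (t.a * t.b)),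
          ι (indRep _ g x, indRep _ g y) = g • ι (x, y)) ∧
        (∀ (g : GK0) (z : imF t), p (g • z) = p z) ∧
        Function.Injective ι ∧ ι.range = p.ker ∧ Function.Surjective p ∧
        ¬ ∃ s : ZMod 2 →+ imF t, (∀ n, p (s n) = n) ∧ ∀ (g : GK0) (n : ZMod 2), g • s n = s n) := by
  refine ⟨?_, fun hab hθ hη => ?_⟩
  · obtain ⟨P, hP, hPr, hPe⟩ := exists_enum t 1
    obtain ⟨Q, hQ, hQr, -⟩ := exists_enum t 2
    have hsub : ∀ W, subsetClass t P W =
        QuotientAddGroup.mk' (princBt t) (edge t 1 - 4 • Finsupp.single W 1) := fun W => by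
      rw [subsetClass, hPe]; rfl
    refine ⟨P, Q, ⟨hP, hPr.trans fVw0_eq.symm⟩, ⟨hQ, hQr.trans fVw1_eq.symm⟩, ?_, fun W hW => ?_⟩
    · have hW : P 0 ∈ weier t := Or.inl (hPr ▸ Set.mem_range_self 0)
      obtain ⟨κ, hκ, hκ0⟩ := exists_kernel_element hW
      have hker := mem_ker_fstar_iff hW hκ
      refine nonempty_addEquiv_zmod_two (a := ⟨κ, (hker κ).2 (Or.inr rfl)⟩)
        (fun h => hκ0 (congrArg Subtype.val h)) fun x => ?_
      exact ((hker x.1).1 x.2).imp (fun h => Subtype.ext h) fun h => Subtype.ext h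
    · rw [hPr, hQr] at hW
      obtain ⟨κ, hκ, hκ0⟩ := exists_kernel_element hW
      exact ⟨κ, hκ.trans (hsub W).symm, hκ0, mem_ker_fstar_iff hW hκ⟩
  · obtain ⟨I, hIK, hI⟩ := exists_I
    obtain ⟨x₁, x₂, x₃, x₄, F⟩ := (rootCoord₀ t).exists_isFrame
    obtain ⟨y₁, y₂, y₃, y₄, F'⟩ := (rootCoord₁ t hI hIK).exists_isFrame
    obtain ⟨A, B, C, hc⟩ := F.exists_isCoords (by decide)
    obtain ⟨A', B', C', hc'⟩ := F'.exists_isCoords (by decide)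
    have H := F.exists_hom (by decide) hc hab
    have H' := F'.exists_hom (by decide) hc' hθ
    obtain ⟨ι, hι, inj, surj, hB, hv⟩ := H
    obtain ⟨ι', hι', inj', surj', hB', hv'⟩ := H'
    obtain ⟨m1, m2, m3, m4⟩ := F.mem
    obtain ⟨m1', m2', m3', m4'⟩ := F'.mem
    have hA0 : ∀ x, A (ι' x) = 0 := hv' 1 (by decide) _ m1 _ m3 _ hc.fst
    have hB0 : ∀ x, B (ι' x) = 0 := hv' 1 (by decide) _ m2 _ m4 _ hc.snd
    have hC0 : ∀ x, C (ι' x) = 0 := hv' 1 (by decide) _ m1 _ m2 _ hc.mix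
    have hA0' : ∀ x, A' (ι x) = 0 := hv 2 (by decide) _ m1' _ m3' _ hc'.fst
    have hB0' : ∀ x, B' (ι x) = 0 := hv 2 (by decide) _ m2' _ m4' _ hc'.snd
    have hC0' : ∀ x, C' (ι x) = 0 := hv 2 (by decide) _ m1' _ m2' _ hc'.mix
    -- The six functionals embed the image of f^*; `hsum` is the relation among them coming from
    -- even degree.
    have hsep : ∀ z : imF t, A z = 0 → B z = 0 → C z = 0 → A' z = 0 → B' z = 0 → C' z = 0 →
        z = 0 := by
      intro z h1 h2 h3 h4 h5 h6
      obtain ⟨D, rfl⟩ := imClass_surjective z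
      rw [imClass_eq_zero_iff]
      intro j hj
      obtain rfl | rfl : j = 1 ∨ j = 2 := by omega
      · exact F.imClass_eq_zero (by rwa [← hc.fst]) (by rwa [← hc.snd]) (by rwa [← hc.mix])
      · exact F'.imClass_eq_zero (by rwa [← hc'.fst]) (by rwa [← hc'.snd]) (by rwa [← hc'.mix])
    have hsum : ∀ z : imF t, A z + B z = A' z + B' z := by
      intro z
      obtain ⟨D, rfl⟩ := imClass_surjective z
      rw [F.fst_add_snd hc, F'.fst_add_snd hc', ← sub_eq_zero, CharTwo.sub_eq_add]
      exact valSum_add_valSum D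
    have hι2 : ∀ x y, (ι'.coprod ι) (x, y) = ι' x + ι y := fun x y => rfl
    -- The projection is A + B, the parity of the sum over the points with w₀ = 0. Each induced
    -- module is invisible to the functionals of the other set, so injectivity is checked separately
    -- on the two factors.
    refine ⟨ι'.coprod ι, A + B, fun g x y => ?_, fun g z => ?_, ?_, ?_, ?_, ?_⟩
    · rw [hι2, hι2, hι, hι', smul_add]
    · obtain ⟨D, rfl⟩ := imClass_surjective z
      rw [smul_imClass]
      exact (F.fst_add_snd hc _).trans ((valSum_gal 1 g D).trans (F.fst_add_snd hc D).symm)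
    · rw [injective_iff_map_eq_zero]
      rintro ⟨x, y⟩ h
      rw [hι2] at h
      have a := congrArg A h
      have c := congrArg C h
      have a' := congrArg A' h
      have c' := congrArg C' h
      rw [map_add, map_zero, hA0, zero_add] at a
      rw [map_add, map_zero, hC0, zero_add] at c
      rw [map_add, map_zero, hA0', add_zero] at a'
      rw [map_add, map_zero, hC0', add_zero] at c'
      rw [inj y a c, inj' x a' c']
      rfl
    · ext z
      constructor
      · rintro ⟨⟨x, y⟩, rfl⟩
        change A (ι' x + ι y) + B (ι' x + ι y) = 0
        rw [map_add, map_add, hA0, hB0, hB, zero_add, CharTwo.add_self_eq_zero]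
      · intro hz
        have hz : A z + B z = 0 := hz
        have hz' := (hsum z).symm.trans hz
        -- Match A, C and A', C'. The values of B and B' then agree as well, because B = A on the
        -- induced module and A + B = A' + B' = 0 on z.
        obtain ⟨y, ya, yc⟩ := surj (A z) (C z)
        obtain ⟨x, xa, xc⟩ := surj' (A' z) (C' z)
        refine ⟨(x, y), ?_⟩
        rw [hι2, ← sub_eq_zero]
        refine hsep _ ?_ ?_ ?_ ?_ ?_ ?_
        · rw [map_sub, map_add, hA0, ya, zero_add, sub_self]
        · rw [map_sub, map_add, hB0, hB, ya, zero_add, CharTwo.sub_eq_add, hz]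
        · rw [map_sub, map_add, hC0, yc, zero_add, sub_self]
        · rw [map_sub, map_add, hA0', xa, add_zero, sub_self]
        · rw [map_sub, map_add, hB0', hB', xa, add_zero, CharTwo.sub_eq_add, hz']
        · rw [map_sub, map_add, hC0', xc, add_zero, sub_self]
    -- The difference of a point with w₀ = 0 and a point with w₁ = 0 has odd sum on each set.
    · have hw1 := wSet_subset_weier (j := 1) (by decide) m1
      have hw2 := wSet_subset_weier (j := 2) (by decide) m1'
      have hp : A (imClass t (pairDiv hw1 hw2)) + B (imClass t (pairDiv hw1 hw2)) = 1 := by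
        classical
        obtain ⟨n12, n13, n14, -⟩ := F.ne
        have hne : ∀ x ∈ wSet t 1, y₁ ≠ x := fun x hx h =>
          Set.disjoint_left.1 (disjoint_wSet (i := 1) (j := 2) (by decide)) hx (h ▸ m1')
        rw [hc.fst, hc.snd, valDiff_pairDiv, valDiff_pairDiv]
        simp [n12, n13, n14, hne _ m1, hne _ m2, hne _ m3, hne _ m4]
      intro n
      have h01 : ∀ a : ZMod 2, a = 0 ∨ a = 1 := by decide
      rcases h01 n with rfl | rfl
      · exact ⟨0, map_zero _⟩
      · exact ⟨_, hp⟩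
    -- The image of 1 under an equivariant section is an invariant class of odd sum, which
    -- distinguishes a Galois-fixed point with w₀ = 0.
    · rintro ⟨s, hs, hg⟩
      obtain ⟨D, hD⟩ := imClass_surjective (s 1)
      have h1 := hs 1
      rw [← hD] at h1
      obtain ⟨ω, hω, hfix⟩ := F.exists_fixed (by decide)
        ((F.fst_add_snd hc D).symm.trans h1) fun g => by rw [hD, hg]
      obtain ⟨x, hx, hx2⟩ := exists_sqrt_of_fixed hω hfix
      exact hη x hx hx2
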